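/- For a compact convex set $\Omega\subset\mathbb R^2$ of positive area $|\Omega|$, let $P(\Omega)=\lim_{\varepsilon\to0^+}\varepsilon^{-1}\bigl(|\{x: d(x,\Omega)\le\varepsilon\}|-|\Omega|\bigr)$ be its (Minkowski) perimeter, let $B_\Omega$ be the closed disc centred at the barycentre $\frac1{|\Omega|}\int_\Omega x\,dx$ of $\Omega$ with $|B_\Omega|=|\Omega|$ (the barycentric disc), and let $$\delta(\Omega)=\frac{P(\Omega)-P(B_\Omega)}{P(B_\Omega)},\qquad \lambda_0(\Omega)=\frac{|\Omega\,\Delta\, B_\Omega|}{|\Omega|}$$ be the isoperimetric deficit and the barycentric asymmetry. **Theorem 5.2.** Let $\Omega$ be a minimizer of $\delta/\lambda_0^2$ among all compact convex sets in $\mathbb R^2$ of positive area with $\lambda_0\neq0$ (that is, other than discs). Then: 1. the boundary of $\Omega$ is of class $C^{1,1}$: near each $p\in\partial\Omega$, in suitable Cartesian coordinates, $\Omega$ is the epigraph of a $C^1$ function of one variable with Lipschitz derivative; 2. if $\Gamma\subset\partial\Omega$ is relatively open in $\partial\Omega$ and contains no nondegenerate line segment (a strictly convex part of the boundary), then $\partial\Omega$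 is of class $C^\infty$ near every point of $\Gamma\setminus\partial B_\Omega$, in the same sense: $\Omega$ is locally the epigraph of a $C^\infty$ function. -/

import Mathlib

open scoped ContDiff symmDiff

namespace PlanarShape

/-- The Euclidean plane. -/
abbrev Plane : Type := EuclideanSpace ℝ (Fin 2)

open MeasureTheory in
/-- The area `|Ω|` (Lebesgue measure). -/
noncomputable def area (Ω : Set Plane) : ℝ := volume.real Ω

/-- The perimeter in the Minkowski sense, `lim_{ε → 0⁺} (|Ω^ε| - |Ω|) / ε`, where
`Ω^ε = {x : d(x, Ω) ≤ ε}`. The limit exists for every compact convex set. -/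
noncomputable def perimeter (Ω : Set Plane) : ℝ :=
  Filter.limUnder (nhdsWithin (0 : ℝ) (Set.Ioi 0))
    (fun ε : ℝ => (area (Metric.cthickening ε Ω) - area Ω) / ε)

/-- The barycentre `|Ω|⁻¹ ∫_Ω x dx`. -/
noncomputable def barycentre (Ω : Set Plane) : Plane :=
  (area Ω)⁻¹ • ∫ x in Ω, x

/-- The radius of the discs that have the same area as `Ω`. -/
noncomputable def discRadius (Ω : Set Plane) : ℝ := Real.sqrt (area Ω / Real.pi)

/-- The barycentric disc: the disc centred at the barycentre of `Ω`, with the same area as `Ω`. -/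
noncomputable def barycentricDisc (Ω : Set Plane) : Set Plane :=
  Metric.closedBall (barycentre Ω) (discRadius Ω)

/-- The circle that bounds the barycentric disc. -/
noncomputable def barycentricCircle (Ω : Set Plane) : Set Plane :=
  Metric.sphere (barycentre Ω) (discRadius Ω)

/-- The isoperimetric deficit `(P(Ω) - P(B)) / P(B)`, where `B` is a disc with `|B| = |Ω|`. -/
noncomputable def deficit (Ω : Set Plane) : ℝ :=
  (perimeter Ω - perimeter (barycentricDisc Ω)) / perimeter (barycentricDisc Ω)

/-- The barycentric asymmetry `|Ω ∆ B| / |Ω|`, where `B` is the barycentric disc of `Ω`. -/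
noncomputable def asymmetry (Ω : Set Plane) : ℝ :=
  area (Ω ∆ barycentricDisc Ω) / area Ω

/-- The functional `δ / λ₀²`. -/
noncomputable def ratio (Ω : Set Plane) : ℝ := deficit Ω / asymmetry Ω ^ 2

/-- The compact convex sets on which `δ / λ₀²` is defined: those with positive area and
`λ₀ ≠ 0` (that is, other than discs). -/
structure Admissible (Ω : Set Plane) : Prop where
  isCompact : IsCompact Ω
  convex : Convex ℝ Ω
  area_pos : 0 < area Ω
  asymmetry_ne_zero : asymmetry Ω ≠ 0

/-- `Ω` minimizes `δ / λ₀²` among the planar compact convex sets. -/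
def IsMinimizer (Ω : Set Plane) : Prop :=
  Admissible Ω ∧ ∀ K : Set Plane, Admissible K → ratio Ω ≤ ratio K

/-- Near its boundary point `p`, the set `Ω` is, in suitable Cartesian coordinates `(s, t)` with
origin `p`, the epigraph `f s ≤ t` of a function `f` on `(-r, r)` that satisfies `R f r`. -/
def IsLocalEpigraphAt (R : (ℝ → ℝ) → ℝ → Prop) (Ω : Set Plane) (p : Plane) : Prop :=
  ∃ (φ : Plane ≃ᵃⁱ[ℝ] Plane) (f : ℝ → ℝ) (r h : ℝ),
    φ 0 = p ∧ 0 < r ∧ 0 < h ∧ f 0 = 0 ∧ R f r ∧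
    (∀ s ∈ Set.Ioo (-r) r, f s ∈ Set.Ioo (-h) h) ∧
    ∀ s ∈ Set.Ioo (-r) r, ∀ t ∈ Set.Ioo (-h) h, φ !₂[s, t] ∈ Ω ↔ f s ≤ t

/-- `f` is of class `C^{1,1}` on `(-r, r)`: it is `C¹` with Lipschitz derivative. -/
def IsC11 (f : ℝ → ℝ) (r : ℝ) : Prop :=
  ContDiffOn ℝ 1 f (Set.Ioo (-r) r) ∧
    ∃ K : NNReal, LipschitzOnWith K (deriv f) (Set.Ioo (-r) r)

/-- `f` is of class `C^∞` on `(-r, r)`. -/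
def IsSmooth (f : ℝ → ℝ) (r : ℝ) : Prop :=
  ContDiffOn ℝ ∞ f (Set.Ioo (-r) r)

/-- The boundary of `Ω` is of class `C^{1,1}` near its point `p`. -/
def BoundaryC11At (Ω : Set Plane) (p : Plane) : Prop := IsLocalEpigraphAt IsC11 Ω p

/-- The boundary of `Ω` is of class `C^∞` near its point `p`. -/
def BoundarySmoothAt (Ω : Set Plane) (p : Plane) : Prop := IsLocalEpigraphAt IsSmooth Ω p

/-- `Γ` is a strictly convex part of the boundary of the convex set `Ω`: a relatively open
subset of the boundary that contains no nondegenerate line segment. -/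
def IsStrictlyConvexPart (Ω Γ : Set Plane) : Prop :=
  (∃ U : Set Plane, IsOpen U ∧ Γ = frontier Ω ∩ U) ∧
    ∀ x y : Plane, segment ℝ x y ⊆ Γ → x = y

end PlanarShape

namespace PlanarShape

open MeasureTheory Set Filter Topology Metric
open scoped Pointwise ENNReal NNReal Interval

/-! Minimality is an inequality: with `m = ratio Ω`, every convex body `K` satisfies `P(K) ≥
2√(π|K|)(1 + m λ₀(K)²)`, with equality for `Ω`. The asymmetry depends only on the area of `K` and on
its overlap with its barycentric disc, whose centre and radius are smooth functions of the area and
first moment of `K`. The overlap of the fixed set `Ω` with a moving disc need not be visibly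
differentiable, but by Brunn–Minkowski its square root is concave in centre and radius. A
supergradient therefore bounds it from above, hence the asymmetry from below, which is the direction
needed. If the overlap of `K` exceeds that of `Ω` with the same disc by at most a multiple of the
area change, it follows that `P(K) - P(Ω)` is at least a linear functional of the changes of area
and moment, up to a small error (`IsMinimizer.exists_linear_lower_bound`).

In the other direction, replacing the lower boundary `f` over `[a, b]` by `w` changes the Minkowski
perimeter by at most the difference of two arc length integrals (`ReplacesLower.perimeter_sub_le`),
and changes area and moment by explicit integrals of `f - w`.

Regularity `C^{1,1}`: cutting `Ω` along a chord over `[a, b]` can only decrease the overlap, so the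
lower bound applies even on the barycentric circle. If `Δ` is the second difference of `f` on `[a,
b]`, the cut gains length at least of order `Δ²/(b - a)` and costs at most of order `Δ(b - a)`.
Hence `Δ = O((b - a)²)`, and a convex function with this property has a Lipschitz derivative.

Smoothness: off the circle a local change happens wholly inside or wholly outside the disc, so the
overlap changes by exactly the area change or not at all, and outward changes are allowed too. The
first variation along fibrewise mixtures with a convex competitor, integrated by parts, reads `∫ (D
- c)(p - f') ≤ 0` for all `c`, where `D = Q - f'/√(1 + f'²)`, `Q'` is affine in `s` and `f`, and `p`
is the slope of the competitor. Chords (`p` constant) force `D` to be monotone, since strict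
convexity makes `f'` strictly increasing (`monotoneOn_of_integral_le`). Caps bounded by two tangents
(`p` a step function) then force `D` to be constant (`eqOn_of_integral_le`). The resulting Euler
equation expresses `f'` smoothly through `Q`, and a bootstrap gives `C^∞`. -/

/-! ### Vertical slices of planar sets -/

/-- The point with given Cartesian coordinates, as a measurable equivalence. -/
noncomputable def coordEquiv : ℝ × ℝ ≃ᵐ Plane :=
  MeasurableEquiv.finTwoArrow.symm.trans (MeasurableEquiv.toLp 2 (Fin 2 → ℝ))

lemma coordEquiv_apply (x : ℝ × ℝ) : coordEquiv x = !₂[x.1, x.2] := by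
  ext i; fin_cases i <;> rfl

lemma measurePreserving_coordEquiv : MeasurePreserving coordEquiv volume volume :=
  (volume_preserving_finTwoArrow ℝ).symm.trans (PiLp.volume_preserving_toLp (Fin 2))

/-- The vertical slice of `X` at the abscissa `s`. -/
def slice (X : Set Plane) (s : ℝ) : Set ℝ := {t | !₂[s, t] ∈ X}

lemma mem_slice {X : Set Plane} {s t : ℝ} : t ∈ slice X s ↔ !₂[s, t] ∈ X := Iff.rfl

lemma mk_coords (x : Plane) : !₂[x 0, x 1] = x := by
  ext i; fin_cases i <;> rfl

lemma continuous_mk : Continuous fun x : ℝ × ℝ => (!₂[x.1, x.2] : Plane) := by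
  refine (PiLp.continuous_toLp 2 _).comp ?_
  refine continuous_pi fun i => ?_
  fin_cases i
  · exact continuous_fst
  · exact continuous_snd

lemma continuous_mk_right (s : ℝ) : Continuous fun t : ℝ => (!₂[s, t] : Plane) :=
  continuous_mk.comp (by fun_prop : Continuous fun t : ℝ => (s, t))

lemma add_mk (s t s' t' : ℝ) : (!₂[s, t] : Plane) + !₂[s', t'] = !₂[s + s', t + t'] := by
  ext i; fin_cases i <;> simp

lemma sub_mk (s t s' t' : ℝ) : (!₂[s, t] : Plane) - !₂[s', t'] = !₂[s - s', t - t'] := by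
  ext i; fin_cases i <;> simp

lemma smul_mk (c s t : ℝ) : c • (!₂[s, t] : Plane) = !₂[c * s, c * t] := by
  ext i; fin_cases i <;> simp

lemma norm_mk (s t : ℝ) : ‖(!₂[s, t] : Plane)‖ = √(s ^ 2 + t ^ 2) := by
  simp [EuclideanSpace.norm_eq]

lemma abs_fst_le_norm (x : Plane) : |x 0| ≤ ‖x‖ := by
  simpa using PiLp.norm_apply_le x 0

lemma abs_snd_le_norm (x : Plane) : |x 1| ≤ ‖x‖ := by
  simpa using PiLp.norm_apply_le x 1

lemma isClosed_slice {X : Set Plane} (hX : IsClosed X) (s : ℝ) : IsClosed (slice X s) :=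
  hX.preimage (continuous_mk_right s)

lemma exists_abs_le_of_isBounded {X : Set Plane} (hX : Bornology.IsBounded X) :
    ∃ R > 0, ∀ s t, !₂[s, t] ∈ X → |s| ≤ R ∧ |t| ≤ R := by
  obtain ⟨R, hR, h⟩ := hX.exists_pos_norm_le
  refine ⟨R, hR, fun s t hst => ⟨?_, ?_⟩⟩
  · simpa using (abs_fst_le_norm _).trans (h _ hst)
  · simpa using (abs_snd_le_norm _).trans (h _ hst)

lemma isCompact_slice {X : Set Plane} (hX : IsCompact X) (s : ℝ) : IsCompact (slice X s) := by
  obtain ⟨R, -, h⟩ := exists_abs_le_of_isBounded hX.isBounded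
  refine (isCompact_Icc (a := -R) (b := R)).of_isClosed_subset (isClosed_slice hX.isClosed s) ?_
  exact fun t ht => abs_le.1 (h s t ht).2

lemma convex_mix_mem {X : Set Plane} (hX : Convex ℝ X) {s t s' t' a b : ℝ}
    (h : !₂[s, t] ∈ X) (h' : !₂[s', t'] ∈ X) (ha : 0 ≤ a) (hb : 0 ≤ b) (hab : a + b = 1) :
    !₂[a * s + b * s', a * t + b * t'] ∈ X := by
  have := hX h h' ha hb hab
  rwa [smul_mk, smul_mk, add_mk] at this

lemma convex_slice {X : Set Plane} (hX : Convex ℝ X) (s : ℝ) : Convex ℝ (slice X s) := by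
  intro t ht t' ht' a b ha hb hab
  have := convex_mix_mem hX ht ht' ha hb hab
  rw [← add_mul, hab, one_mul] at this
  exact this

lemma volume_eq_lintegral_slice {X : Set Plane} (hX : MeasurableSet X) :
    volume X = ∫⁻ s, volume (slice X s) := by
  rw [← measurePreserving_coordEquiv.measure_preimage hX.nullMeasurableSet,
    Measure.volume_eq_prod, Measure.prod_apply (coordEquiv.measurable hX)]
  refine lintegral_congr fun s => congrArg _ ?_
  ext t
  simp [coordEquiv_apply, slice]

lemma measurable_volume_slice {X : Set Plane} (hX : MeasurableSet X) :
    Measurable fun s => volume (slice X s) := by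
  have := measurable_measure_prodMk_left (ν := (volume : Measure ℝ)) (coordEquiv.measurable hX)
  convert! this using 3

/-! ### The planar Brunn–Minkowski inequality -/

/-- One-dimensional Brunn–Minkowski inequality for intervals. -/
lemma volume_add_volume_le_of_add_subset {X Y Z : Set ℝ} (hX : Convex ℝ X) (hY : Convex ℝ Y)
    (hXb : Bornology.IsBounded X) (hYb : Bornology.IsBounded Y) (hXn : X.Nonempty)
    (hYn : Y.Nonempty) (h : X + Y ⊆ Z) : volume X + volume Y ≤ volume Z := by
  have hsub : ∀ W : Set ℝ, Bornology.IsBounded W → W ⊆ Icc (sInf W) (sSup W) := fun W hW w hw =>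
    ⟨csInf_le hW.bddBelow hw, le_csSup hW.bddAbove hw⟩
  have hle : ∀ W : Set ℝ, Bornology.IsBounded W → W.Nonempty → sInf W ≤ sSup W :=
    fun W hW ⟨w, hw⟩ => (hsub W hW hw).1.trans (hsub W hW hw).2
  have hIoo : Ioo (sInf X + sInf Y) (sSup X + sSup Y) ⊆ Z := by
    intro z ⟨hz1, hz2⟩
    refine h ?_
    obtain ⟨x, hx, hx'⟩ := exists_lt_of_csInf_lt hXn
      (show sInf X < sInf X + (z - (sInf X + sInf Y)) / 2 by linarith)
    obtain ⟨y, hy, hy'⟩ := exists_lt_of_csInf_lt hYn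
      (show sInf Y < sInf Y + (z - (sInf X + sInf Y)) / 2 by linarith)
    obtain ⟨x₂, hx₂, hx₂'⟩ := exists_lt_of_lt_csSup hXn
      (show sSup X - (sSup X + sSup Y - z) / 2 < sSup X by linarith)
    obtain ⟨y₂, hy₂, hy₂'⟩ := exists_lt_of_lt_csSup hYn
      (show sSup Y - (sSup X + sSup Y - z) / 2 < sSup Y by linarith)
    exact (hX.add hY).ordConnected.out (add_mem_add hx hy) (add_mem_add hx₂ hy₂)
      ⟨by linarith, by linarith⟩
  calc volume X + volume Y ≤ ENNReal.ofReal (sSup X - sInf X) + ENNReal.ofReal (sSup Y - sInf Y) := by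
        gcongr
        · simpa using measure_mono (μ := volume) (hsub X hXb)
        · simpa using measure_mono (μ := volume) (hsub Y hYb)
    _ = ENNReal.ofReal (sSup X + sSup Y - (sInf X + sInf Y)) := by
        rw [← ENNReal.ofReal_add (sub_nonneg.2 (hle X hXb hXn)) (sub_nonneg.2 (hle Y hYb hYn))]
        congr 1; ring
    _ = volume (Ioo (sInf X + sInf Y) (sSup X + sSup Y)) := by rw [Real.volume_Ioo]
    _ ≤ volume Z := measure_mono hIoo

/-- The length of the vertical slice of `X` at the abscissa `s`. -/
noncomputable def sliceLength (X : Set Plane) (s : ℝ) : ℝ := volume.real (slice X s)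

lemma ofReal_sliceLength {X : Set Plane} (hX : IsCompact X) (s : ℝ) :
    ENNReal.ofReal (sliceLength X s) = volume (slice X s) :=
  ENNReal.ofReal_toReal (isCompact_slice hX s).measure_lt_top.ne

lemma sliceLength_nonneg (X : Set Plane) (s : ℝ) : 0 ≤ sliceLength X s := measureReal_nonneg

lemma measurable_sliceLength {X : Set Plane} (hX : IsCompact X) : Measurable (sliceLength X) :=
  (measurable_volume_slice hX.measurableSet).ennreal_toReal

lemma nonempty_slice_of_sliceLength_pos {X : Set Plane} {s : ℝ} (h : 0 < sliceLength X s) :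
    (slice X s).Nonempty := by
  by_contra hne
  rw [not_nonempty_iff_eq_empty] at hne
  simp [sliceLength, hne] at h

lemma sliceLength_add {A B C : Set Plane} (hA : IsCompact A) (hA' : Convex ℝ A)
    (hB : IsCompact B) (hB' : Convex ℝ B) (hC : IsCompact C) (h : A + B ⊆ C) {s s' : ℝ}
    (hs : (slice A s).Nonempty) (hs' : (slice B s').Nonempty) :
    sliceLength A s + sliceLength B s' ≤ sliceLength C (s + s') := by
  have := volume_add_volume_le_of_add_subset (Z := slice C (s + s')) (convex_slice hA' s)
    (convex_slice hB' s') (isCompact_slice hA s).isBounded (isCompact_slice hB s').isBounded hs hs'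
    (by
      rintro _ ⟨t, ht, t', ht', rfl⟩
      have := h (add_mem_add (mem_slice.1 ht) (mem_slice.1 ht'))
      rwa [add_mk] at this)
  rw [← ofReal_sliceLength hA, ← ofReal_sliceLength hB, ← ofReal_sliceLength hC,
    ← ENNReal.ofReal_add (sliceLength_nonneg _ _) (sliceLength_nonneg _ _)] at this
  exact (ENNReal.ofReal_le_ofReal_iff (sliceLength_nonneg _ _)).1 this

lemma exists_sliceLength_le {X : Set Plane} (hX : IsCompact X) : ∃ R, ∀ s, sliceLength X s ≤ R := by
  obtain ⟨R, hR, h⟩ := exists_abs_le_of_isBounded hX.isBounded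
  refine ⟨2 * R, fun s => ?_⟩
  have : volume.real (slice X s) ≤ volume.real (Icc (-R) R) :=
    measureReal_mono (fun t ht => abs_le.1 (h s t ht).2) (by simp)
  rw [Real.volume_real_Icc_of_le (by linarith)] at this
  exact this.trans (by linarith)

/-- By convexity, a mixture of two slices lies in the slice over the mixed abscissa, so the
one-dimensional inequality makes the slice length concave where it is positive. Superlevel sets are
thus intervals, to which that inequality can be applied a second time. -/
lemma convex_sliceLength_superlevel {X : Set Plane} (hX : IsCompact X) (hX' : Convex ℝ X) {c : ℝ}
    (hc : 0 ≤ c) : Convex ℝ {s | c < sliceLength X s} := by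
  intro s hs s' hs' a b ha hb hab
  have hs0 : c < sliceLength X s := hs
  have hs0' : c < sliceLength X s' := hs'
  have hc1 := isCompact_slice hX s
  have hc2 := isCompact_slice hX s'
  have := volume_add_volume_le_of_add_subset (Z := slice X (a * s + b * s'))
    ((convex_slice hX' s).smul a) ((convex_slice hX' s').smul b) (hc1.smul a).isBounded
    (hc2.smul b).isBounded
    ((nonempty_slice_of_sliceLength_pos (hc.trans_lt hs0)).smul_set)
    ((nonempty_slice_of_sliceLength_pos (hc.trans_lt hs0')).smul_set)
    (by
      rintro _ ⟨_, ⟨t, ht, rfl⟩, _, ⟨t', ht', rfl⟩, rfl⟩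
      exact convex_mix_mem hX' ht ht' ha hb hab)
  rw [Measure.addHaar_smul, Measure.addHaar_smul, ← ofReal_sliceLength hX, ← ofReal_sliceLength hX,
    ← ofReal_sliceLength hX, ← ENNReal.ofReal_mul (abs_nonneg _),
    ← ENNReal.ofReal_mul (abs_nonneg _), ← ENNReal.ofReal_add
      (mul_nonneg (abs_nonneg _) (sliceLength_nonneg _ _))
      (mul_nonneg (abs_nonneg _) (sliceLength_nonneg _ _)),
    ENNReal.ofReal_le_ofReal_iff (sliceLength_nonneg _ _)] at this
  simp only [Module.finrank_self, pow_one, abs_of_nonneg ha, abs_of_nonneg hb] at this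
  change c < sliceLength X (a * s + b * s')
  refine lt_of_lt_of_le ?_ this
  rcases ha.eq_or_lt with rfl | ha
  · obtain rfl : b = 1 := by linarith
    linarith
  · have : c = a * c + b * c := by rw [← add_mul, hab, one_mul]
    nlinarith [mul_lt_mul_of_pos_left hs0 ha, mul_le_mul_of_nonneg_left hs0'.le hb]

lemma isBounded_sliceLength_superlevel {X : Set Plane} (hX : IsCompact X) {c : ℝ}
    (hc : 0 ≤ c) : Bornology.IsBounded {s | c < sliceLength X s} := by
  obtain ⟨R, hR, h⟩ := exists_abs_le_of_isBounded hX.isBounded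
  refine (Metric.isBounded_Icc (-R) R).subset fun s hs => ?_
  obtain ⟨t, ht⟩ := nonempty_slice_of_sliceLength_pos (hc.trans_lt hs)
  exact abs_le.1 (h s t ht).1

lemma volume_eq_lintegral_sliceLength {X : Set Plane} (hX : IsCompact X) :
    volume X = ∫⁻ s, ENNReal.ofReal (sliceLength X s) := by
  rw [volume_eq_lintegral_slice hX.measurableSet]
  exact lintegral_congr fun s => (ofReal_sliceLength hX s).symm

lemma integrable_sliceLength {X : Set Plane} (hX : IsCompact X) : Integrable (sliceLength X) := by
  refine ⟨(measurable_sliceLength hX).aestronglyMeasurable, ?_⟩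
  rw [hasFiniteIntegral_iff_ofReal (Eventually.of_forall fun s => sliceLength_nonneg X s),
    ← volume_eq_lintegral_sliceLength hX]
  exact hX.measure_lt_top

lemma area_eq_integral_sliceLength {X : Set Plane} (hX : IsCompact X) :
    area X = ∫ s, sliceLength X s := by
  rw [area, Measure.real, volume_eq_lintegral_sliceLength hX,
    integral_eq_lintegral_of_nonneg_ae (Eventually.of_forall fun s => sliceLength_nonneg X s)
      (measurable_sliceLength hX).aestronglyMeasurable]

lemma area_nonneg (X : Set Plane) : 0 ≤ area X := measureReal_nonneg

lemma lintegral_sliceLength_div {X : Set Plane} (hX : IsCompact X) {c : ℝ} (hc : 0 < c) :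
    ∫⁻ s, ENNReal.ofReal (sliceLength X s / c) = ENNReal.ofReal (area X / c) := by
  rw [area_eq_integral_sliceLength hX, ← integral_div, ofReal_integral_eq_lintegral_ofReal]
  · exact (integrable_sliceLength hX).div_const c
  · exact Eventually.of_forall fun s => div_nonneg (sliceLength_nonneg X s) hc.le

lemma lintegral_sliceLength_div_eq_superlevel {X : Set Plane} (hX : IsCompact X) {c : ℝ}
    (hc : 0 < c) : ENNReal.ofReal (area X / c) =
      ∫⁻ t in Ioi 0, volume {s | c * t < sliceLength X s} := by
  rw [← lintegral_sliceLength_div hX hc, lintegral_eq_lintegral_meas_lt volume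
    (Eventually.of_forall fun s => div_nonneg (sliceLength_nonneg X s) hc.le)
    ((measurable_sliceLength hX).div_const c).aemeasurable]
  refine lintegral_congr fun t => congrArg _ ?_
  ext s
  simp [lt_div_iff₀ hc, mul_comm]

lemma area_mono {X Y : Set Plane} (hY : IsCompact Y) (h : X ⊆ Y) : area X ≤ area Y :=
  measureReal_mono h hY.measure_lt_top.ne

lemma exists_isLUB_sliceLength {X : Set Plane} (hX : IsCompact X) (h : 0 < area X) :
    ∃ c > 0, IsLUB (range (sliceLength X)) c := by
  obtain ⟨R, hR⟩ := exists_sliceLength_le hX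
  have hlub := isLUB_ciSup (f := sliceLength X) ⟨R, forall_mem_range.2 hR⟩
  refine ⟨_, ?_, hlub⟩
  by_contra! hle
  have : ∀ s, sliceLength X s = 0 := fun s =>
    le_antisymm ((hlub.1 (mem_range_self s)).trans hle) (sliceLength_nonneg X s)
  rw [area_eq_integral_sliceLength hX] at h
  simp [this] at h

lemma area_add_left (x : Plane) (X : Set Plane) : area ({x} + X) = area X := by
  simp [area, Measure.real, singleton_add]

/-- Bonnesen's form of the planar Brunn–Minkowski inequality for convex bodies. -/
lemma exists_brunnMinkowski_bonnesen {A B : Set Plane} (hA : IsCompact A) (hA' : Convex ℝ A)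
    (hB : IsCompact B) (hB' : Convex ℝ B) (hA0 : 0 < area A) (hB0 : 0 < area B) :
    ∃ a > 0, ∃ b > 0, (a + b) * (area A / a + area B / b) ≤ area (A + B) := by
  obtain ⟨a, ha, hlubA⟩ := exists_isLUB_sliceLength hA hA0
  obtain ⟨b, hb, hlubB⟩ := exists_isLUB_sliceLength hB hB0
  refine ⟨a, ha, b, hb, ?_⟩
  have hC : IsCompact (A + B) := hA.add hB
  -- Measuring slice lengths relative to their suprema `a` and `b` makes both superlevel sets
  -- nonempty at every relative height `t < 1`, as the one-dimensional inequality requires.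
  have key : ∀ t ∈ Ioo (0 : ℝ) 1, volume {s | a * t < sliceLength A s} +
      volume {s | b * t < sliceLength B s} ≤ volume {s | (a + b) * t < sliceLength (A + B) s} := by
    intro t ⟨ht0, ht1⟩
    refine volume_add_volume_le_of_add_subset
      (convex_sliceLength_superlevel hA hA' (by positivity))
      (convex_sliceLength_superlevel hB hB' (by positivity))
      (isBounded_sliceLength_superlevel hA (by positivity))
      (isBounded_sliceLength_superlevel hB (by positivity)) ?_ ?_ ?_
    · obtain ⟨_, ⟨s, rfl⟩, hs⟩ := hlubA.exists_between (show a * t < a by nlinarith)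
      exact ⟨s, hs.1⟩
    · obtain ⟨_, ⟨s, rfl⟩, hs⟩ := hlubB.exists_between (show b * t < b by nlinarith)
      exact ⟨s, hs.1⟩
    · rintro _ ⟨s, hs, s', hs', rfl⟩
      have hs0 : a * t < sliceLength A s := hs
      have hs0' : b * t < sliceLength B s' := hs'
      have := sliceLength_add hA hA' hB hB' hC subset_rfl
        (nonempty_slice_of_sliceLength_pos (lt_trans (by positivity) hs0))
        (nonempty_slice_of_sliceLength_pos (lt_trans (by positivity) hs0'))
      change (a + b) * t < sliceLength (A + B) (s + s')
      linarith
  -- Relative heights `t ≥ 1` contribute nothing for `A` and `B`; for `A + B` they are simply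
  -- discarded at the end.
  have hcut : ∀ (X : Set Plane) (c : ℝ), 0 < c → IsLUB (range (sliceLength X)) c →
      ∫⁻ t in Ioi (0 : ℝ), volume {s | c * t < sliceLength X s} =
        ∫⁻ t in Ioo (0 : ℝ) 1, volume {s | c * t < sliceLength X s} := by
    intro X c hc hlub
    rw [← lintegral_indicator measurableSet_Ioi, ← lintegral_indicator measurableSet_Ioo]
    refine lintegral_congr fun t => ?_
    by_cases ht : t ∈ Ioo (0 : ℝ) 1
    · rw [indicator_of_mem ht, indicator_of_mem (mem_Ioi.2 ht.1)]
    · rw [indicator_of_notMem ht]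
      refine indicator_apply_eq_zero.2 fun ht0 => ?_
      have ht1 : 1 ≤ t := by
        by_contra! h
        exact ht ⟨ht0, h⟩
      have : {s | c * t < sliceLength X s} = ∅ := by
        ext s
        simp only [mem_ofPred_eq, mem_empty_iff_false, iff_false, not_lt]
        nlinarith [hlub.1 (mem_range_self s)]
      rw [this, measure_empty]
  have hmeasure : Measurable fun t => volume {s | a * t < sliceLength A s} := by
    refine Antitone.measurable fun t t' htt' => measure_mono fun s hs => ?_
    exact lt_of_le_of_lt (mul_le_mul_of_nonneg_left htt' ha.le) hs
  have hfinal : ENNReal.ofReal (area A / a) + ENNReal.ofReal (area B / b) ≤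
      ENNReal.ofReal (area (A + B) / (a + b)) := by
    rw [lintegral_sliceLength_div_eq_superlevel hA ha, lintegral_sliceLength_div_eq_superlevel hB hb,
      lintegral_sliceLength_div_eq_superlevel hC (add_pos ha hb), hcut A a ha hlubA,
      hcut B b hb hlubB, ← lintegral_add_left hmeasure]
    exact (setLIntegral_mono' measurableSet_Ioo key).trans
      (lintegral_mono_set Ioo_subset_Ioi_self)
  rw [← ENNReal.ofReal_add (by positivity) (by positivity), ENNReal.ofReal_le_ofReal_iff
    (div_nonneg (area_nonneg _) (by positivity)), le_div_iff₀ (by positivity)] at hfinal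
  linarith

/-- The planar Brunn–Minkowski inequality for compact convex sets. -/
theorem sqrt_area_add_le {A B : Set Plane} (hA : IsCompact A) (hA' : Convex ℝ A)
    (hB : IsCompact B) (hB' : Convex ℝ B) (hAn : A.Nonempty) (hBn : B.Nonempty) :
    √(area A) + √(area B) ≤ √(area (A + B)) := by
  have hC : IsCompact (A + B) := hA.add hB
  -- If one set is null, the sum still contains a translate of the other.
  rcases (area_nonneg A).eq_or_lt with h0 | hA0
  · obtain ⟨x, hx⟩ := hAn
    rw [← h0, Real.sqrt_zero, zero_add, ← area_add_left x B]
    exact Real.sqrt_le_sqrt (area_mono hC (add_subset_add_right (singleton_subset_iff.2 hx)))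
  rcases (area_nonneg B).eq_or_lt with h0 | hB0
  · obtain ⟨x, hx⟩ := hBn
    rw [← h0, Real.sqrt_zero, add_zero, ← area_add_left x A, add_comm {x} A]
    exact Real.sqrt_le_sqrt (area_mono hC (add_subset_add_left (singleton_subset_iff.2 hx)))
  obtain ⟨a, ha, b, hb, h⟩ := exists_brunnMinkowski_bonnesen hA hA' hB hB' hA0 hB0
  refine Real.le_sqrt_of_sq_le (le_trans ?_ h)
  set x := √(area A)
  set y := √(area B)
  have hx : area A = x ^ 2 := (Real.sq_sqrt hA0.le).symm
  have hy : area B = y ^ 2 := (Real.sq_sqrt hB0.le).symm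
  rw [hx, hy]
  -- Bonnesen's bound exceeds the Brunn–Minkowski bound by a square, whatever `a` and `b` are.
  have : (a + b) * (x ^ 2 / a + y ^ 2 / b) - (x + y) ^ 2 = (b * x - a * y) ^ 2 / (a * b) := by
    field_simp; ring
  have h2 : 0 ≤ (b * x - a * y) ^ 2 / (a * b) := by positivity
  linarith

/-! ### The perimeter and the isoperimetric inequality -/

lemma area_smul {c : ℝ} (hc : 0 ≤ c) (X : Set Plane) : area (c • X) = c ^ 2 * area X := by
  rw [area, Measure.real, Measure.addHaar_smul, ENNReal.toReal_mul,
    ENNReal.toReal_ofReal (abs_nonneg _), finrank_euclideanSpace_fin,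
    abs_of_nonneg (pow_nonneg hc 2)]
  rfl

lemma area_closedBall (x : Plane) {r : ℝ} (hr : 0 ≤ r) : area (closedBall x r) = Real.pi * r ^ 2 := by
  rw [area, Measure.real, EuclideanSpace.volume_closedBall_fin_two]
  rw [ENNReal.toReal_mul, ENNReal.toReal_pow, ENNReal.toReal_ofReal hr, mul_comm,
    ENNReal.toReal_ofReal Real.pi_pos.le]

lemma nonempty_of_area_pos {K : Set Plane} (h : 0 < area K) : K.Nonempty := by
  by_contra hne
  rw [not_nonempty_iff_eq_empty] at hne
  simp [hne, area] at h

lemma interior_nonempty_of_area_pos {K : Set Plane} (hK : Convex ℝ K) (h : 0 < area K) :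
    (interior K).Nonempty := by
  by_contra hne
  rw [not_nonempty_iff_eq_empty] at hne
  have h1 : volume K ≤ volume (frontier K) := by
    refine measure_mono ?_
    rw [frontier, hne, sdiff_empty]
    exact subset_closure
  rw [hK.addHaar_frontier volume] at h1
  have h2 : volume K = 0 := le_antisymm h1 bot_le
  simp [area, Measure.real, h2] at h

lemma cthickening_eq_add {K : Set Plane} (hK : IsCompact K) {ε : ℝ} (hε : 0 ≤ ε) :
    cthickening ε K = K + closedBall 0 ε :=
  (hK.add_closedBall_zero hε).symm

lemma sqrt_area_smul {c : ℝ} (hc : 0 ≤ c) (X : Set Plane) : √(area (c • X)) = c * √(area X) := by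
  rw [area_smul hc, Real.sqrt_mul (sq_nonneg c), Real.sqrt_sq hc]

lemma isCompact_cthickening {K : Set Plane} (hK : IsCompact K) (ε : ℝ) :
    IsCompact (cthickening ε K) :=
  Metric.isCompact_of_isClosed_isBounded isClosed_cthickening hK.isBounded.cthickening

/-- For `θ = ε / ε'`, the `ε`-neighbourhood of a convex set contains `(1 - θ)K` plus `θ` times the
`ε'`-neighbourhood. Brunn–Minkowski then gives the concavity inequality for `√area` between `0`, `ε`
and `ε'`. Monotone slopes have a limit as soon as they are bounded. -/
lemma antitoneOn_slope_sqrt_area_cthickening {K : Set Plane} (hK : IsCompact K) (hK' : Convex ℝ K)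
    (hne : K.Nonempty) :
    AntitoneOn (fun ε => (√(area (cthickening ε K)) - √(area K)) / ε) (Ioi 0) := by
  intro ε hε ε' hε' hle
  rw [mem_Ioi] at hε hε'
  have hl0 : 0 ≤ ε / ε' := by positivity
  have hl1 : 0 ≤ 1 - ε / ε' := by rw [sub_nonneg, div_le_one hε']; exact hle
  have hsub : (1 - ε / ε') • K + (ε / ε') • cthickening ε' K ⊆ cthickening ε K := by
    rw [cthickening_eq_add hK hε.le, cthickening_eq_add hK hε'.le]
    rintro _ ⟨_, ⟨x, hx, rfl⟩, _, ⟨_, ⟨y, hy, z, hz, rfl⟩, rfl⟩, rfl⟩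
    refine ⟨(1 - ε / ε') • x + (ε / ε') • y, hK' hx hy hl1 hl0 (by ring), (ε / ε') • z, ?_, ?_⟩
    · rw [mem_closedBall_zero_iff] at hz ⊢
      rw [norm_smul, Real.norm_of_nonneg hl0]
      calc ε / ε' * ‖z‖ ≤ ε / ε' * ε' := by gcongr
        _ = ε := by field_simp
    · simp only [smul_add]; abel
  have hne' : (cthickening ε' K).Nonempty := hne.mono (self_subset_cthickening K)
  have h1 := sqrt_area_add_le (hK.smul (1 - ε / ε')) (hK'.smul (1 - ε / ε'))
    ((isCompact_cthickening hK ε').smul (ε / ε')) ((hK'.cthickening ε').smul (ε / ε'))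
    hne.smul_set hne'.smul_set
  rw [sqrt_area_smul hl1, sqrt_area_smul hl0] at h1
  have h2 := h1.trans (Real.sqrt_le_sqrt (area_mono (isCompact_cthickening hK ε) hsub))
  change (√(area (cthickening ε' K)) - √(area K)) / ε' ≤ (√(area (cthickening ε K)) - √(area K)) / ε
  rw [le_div_iff₀ hε]
  calc _ = ε / ε' * (√(area (cthickening ε' K)) - √(area K)) := by ring
    _ ≤ _ := by linarith

/-- If `K` contains a ball of radius `r`, a ball of radius `ε` fits in a translate of `(ε / r)K`, so
the `ε`-neighbourhood fits in a translate of `(1 + ε / r)K`. -/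
lemma exists_slope_sqrt_area_cthickening_le {K : Set Plane} (hK : IsCompact K) (hK' : Convex ℝ K)
    (h : 0 < area K) :
    ∃ C, ∀ ε > 0, (√(area (cthickening ε K)) - √(area K)) / ε ≤ C := by
  obtain ⟨x, hx⟩ := interior_nonempty_of_area_pos hK' h
  obtain ⟨r, hr, hball⟩ := Metric.nhds_basis_closedBall.mem_iff.1 (mem_interior_iff_mem_nhds.1 hx)
  refine ⟨√(area K) / r, fun ε hε => ?_⟩
  have hsub : cthickening ε K ⊆ {-(ε / r) • x} + (1 + ε / r) • K := by
    rw [cthickening_eq_add hK hε.le, hK'.add_smul zero_le_one (by positivity), one_smul]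
    rintro _ ⟨y, hy, z, hz, rfl⟩
    rw [mem_closedBall_zero_iff] at hz
    have hz' : x + (r / ε) • z ∈ K := by
      refine hball ?_
      rw [mem_closedBall, dist_eq_norm, add_sub_cancel_left, norm_smul,
        Real.norm_of_nonneg (by positivity)]
      calc r / ε * ‖z‖ ≤ r / ε * ε := by gcongr
        _ = r := by field_simp
    refine ⟨_, rfl, y + (ε / r) • (x + (r / ε) • z), add_mem_add hy (smul_mem_smul_set hz'), ?_⟩
    simp only [smul_add, smul_smul, neg_smul]
    rw [show ε / r * (r / ε) = 1 by field_simp, one_smul]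
    abel
  have h1 := Real.sqrt_le_sqrt (area_mono (isCompact_singleton.add (hK.smul _)) hsub)
  rw [area_add_left, sqrt_area_smul (by positivity)] at h1
  rw [div_le_iff₀ hε]
  calc _ ≤ (1 + ε / r) * √(area K) - √(area K) := by linarith
    _ = _ := by ring

/-- The limit that defines the perimeter exists for compact convex sets with positive area, and the
isoperimetric inequality holds. -/
lemma tendsto_perimeter_and_isoperimetric {K : Set Plane} (hK : IsCompact K) (hK' : Convex ℝ K)
    (h : 0 < area K) :
    Tendsto (fun ε => (area (cthickening ε K) - area K) / ε) (𝓝[>] 0) (𝓝 (perimeter K)) ∧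
      2 * √(Real.pi * area K) ≤ perimeter K := by
  obtain ⟨C, hC⟩ := exists_slope_sqrt_area_cthickening_le hK hK' h
  have hne := nonempty_of_area_pos h
  set u : ℝ → ℝ := fun ε => √(area (cthickening ε K)) with hu
  set u₀ := √(area K) with hu₀
  set σ : ℝ → ℝ := fun ε => (u ε - u₀) / ε with hσ
  obtain ⟨l, hl⟩ : ∃ l, Tendsto σ (𝓝[>] 0) (𝓝 l) :=
    ⟨_, (antitoneOn_slope_sqrt_area_cthickening hK hK' hne).tendsto_nhdsGT
      ⟨C, forall_mem_image.2 fun ε hε => hC ε hε⟩⟩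
  have hid : Tendsto (fun ε : ℝ => ε) (𝓝[>] 0) (𝓝 0) := tendsto_nhdsWithin_of_tendsto_nhds tendsto_id
  -- The area quotient is `(u² - u₀²) / ε`, and `u = u₀ + εσ`.
  have hlim : Tendsto (fun ε => σ ε * (ε * σ ε + 2 * u₀)) (𝓝[>] 0) (𝓝 (l * (0 * l + 2 * u₀))) :=
    hl.mul ((hid.mul hl).add_const _)
  have hlim2 : Tendsto (fun ε => (area (cthickening ε K) - area K) / ε) (𝓝[>] 0)
      (𝓝 (l * (0 * l + 2 * u₀))) := by
    refine hlim.congr' ?_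
    filter_upwards [self_mem_nhdsWithin] with ε hε
    have hε : 0 < ε := hε
    have h1 : ε * σ ε = u ε - u₀ := by simp only [hσ]; field_simp
    rw [h1, show area (cthickening ε K) = u ε ^ 2 from (Real.sq_sqrt (area_nonneg _)).symm,
      show area K = u₀ ^ 2 from (Real.sq_sqrt (area_nonneg _)).symm]
    simp only [hσ]
    field_simp
    ring
  have hper : perimeter K = l * (0 * l + 2 * u₀) := hlim2.limUnder_eq
  refine ⟨hper ▸ hlim2, ?_⟩
  -- Brunn–Minkowski for `K` and a disc of radius `ε` bounds every slope below by `√π`; this is the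
  -- isoperimetric inequality.
  have hle : √Real.pi ≤ l := by
    refine ge_of_tendsto hl ?_
    filter_upwards [self_mem_nhdsWithin] with ε hε
    have hε : 0 < ε := hε
    have h1 := sqrt_area_add_le hK hK' (isCompact_closedBall (0 : Plane) ε)
      (convex_closedBall (0 : Plane) ε) hne ⟨0, mem_closedBall_self hε.le⟩
    rw [← cthickening_eq_add hK hε.le, area_closedBall _ hε.le, Real.sqrt_mul Real.pi_pos.le,
      Real.sqrt_sq hε.le] at h1
    simp only [hσ]
    rw [le_div_iff₀ hε]
    linarith
  rw [hper, Real.sqrt_mul Real.pi_pos.le]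
  have : 0 ≤ u₀ := Real.sqrt_nonneg _
  nlinarith [mul_le_mul_of_nonneg_right hle this]

lemma tendsto_perimeter {K : Set Plane} (hK : IsCompact K) (hK' : Convex ℝ K) (h : 0 < area K) :
    Tendsto (fun ε => (area (cthickening ε K) - area K) / ε) (𝓝[>] 0) (𝓝 (perimeter K)) :=
  (tendsto_perimeter_and_isoperimetric hK hK' h).1

/-- The isoperimetric inequality for planar convex bodies. -/
theorem isoperimetric {K : Set Plane} (hK : IsCompact K) (hK' : Convex ℝ K) (h : 0 < area K) :
    2 * √(Real.pi * area K) ≤ perimeter K :=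
  (tendsto_perimeter_and_isoperimetric hK hK' h).2

lemma perimeter_closedBall (x : Plane) {r : ℝ} (hr : 0 < r) :
    perimeter (closedBall x r) = 2 * Real.pi * r := by
  refine Tendsto.limUnder_eq ?_
  have hid : Tendsto (fun ε : ℝ => Real.pi * (2 * r + ε)) (𝓝[>] 0) (𝓝 (Real.pi * (2 * r + 0))) :=
    tendsto_nhdsWithin_of_tendsto_nhds (Continuous.tendsto (by fun_prop) 0)
  rw [show 2 * Real.pi * r = Real.pi * (2 * r + 0) by ring]
  refine hid.congr' ?_
  filter_upwards [self_mem_nhdsWithin] with ε hε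
  have hε : 0 < ε := hε
  rw [cthickening_closedBall hε.le hr.le, area_closedBall _ (by positivity), area_closedBall _ hr.le]
  field_simp
  ring

/-! ### Minimality as a lower bound for the perimeter -/

lemma discRadius_pos {K : Set Plane} (h : 0 < area K) : 0 < discRadius K :=
  Real.sqrt_pos.2 (div_pos h Real.pi_pos)

lemma area_barycentricDisc (K : Set Plane) : area (barycentricDisc K) = area K := by
  rw [barycentricDisc, area_closedBall _ (show 0 ≤ discRadius K from Real.sqrt_nonneg _), discRadius,
    Real.sq_sqrt (div_nonneg (area_nonneg K) Real.pi_pos.le)]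
  field_simp

lemma perimeter_barycentricDisc {K : Set Plane} (h : 0 < area K) :
    perimeter (barycentricDisc K) = 2 * √(Real.pi * area K) := by
  rw [barycentricDisc, perimeter_closedBall _ (discRadius_pos h), discRadius, Real.sqrt_div' _
    Real.pi_pos.le, Real.sqrt_mul Real.pi_pos.le]
  have : √Real.pi ≠ 0 := (Real.sqrt_pos.2 Real.pi_pos).ne'
  field_simp
  rw [Real.sq_sqrt Real.pi_pos.le]

/-- The area of the part of `X` inside the disc of centre `c` and radius `r`. -/
noncomputable def overlap (X : Set Plane) (c : Plane) (r : ℝ) : ℝ := area (X ∩ closedBall c r)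

/-- The set and its disc have equal area, so the two halves of the symmetric difference have equal
area, which is `|K|` minus the overlap. -/
lemma asymmetry_eq {K : Set Plane} (hK : IsCompact K) (h : 0 < area K) :
    asymmetry K = 2 * (1 - overlap K (barycentre K) (discRadius K) / area K) := by
  have h1 : area (K ∆ barycentricDisc K) =
      2 * (area K - overlap K (barycentre K) (discRadius K)) := by
    have hB : IsCompact (barycentricDisc K) := isCompact_closedBall _ _
    have h2 := measureReal_sdiff_add_inter (μ := volume) (s := K) hB.measurableSet hK.measure_lt_top.ne
    have h3 := measureReal_sdiff_add_inter (μ := volume) (s := barycentricDisc K) hK.measurableSet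
      hB.measure_lt_top.ne
    have h4 := measureReal_symmDiff_eq (μ := volume) hK.measurableSet hB.measurableSet
      hK.measure_lt_top.ne hB.measure_lt_top.ne
    have h5 := area_barycentricDisc K
    rw [inter_comm] at h3
    simp only [overlap, area, barycentricDisc] at *
    linarith
  rw [asymmetry, h1]
  field_simp

lemma le_ratio_iff {K : Set Plane} (h : 0 < area K) (hne : asymmetry K ≠ 0) {m : ℝ} :
    m ≤ ratio K ↔ 2 * √(Real.pi * area K) * (1 + m * asymmetry K ^ 2) ≤ perimeter K := by
  have hP : 0 < 2 * √(Real.pi * area K) := by have := Real.pi_pos; positivity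
  rw [ratio, deficit, perimeter_barycentricDisc h, le_div_iff₀ (by positivity), le_div_iff₀ hP]
  constructor <;> intro h <;> linarith

lemma ratio_le_iff {K : Set Plane} (h : 0 < area K) (hne : asymmetry K ≠ 0) {m : ℝ} :
    ratio K ≤ m ↔ perimeter K ≤ 2 * √(Real.pi * area K) * (1 + m * asymmetry K ^ 2) := by
  have hP : 0 < 2 * √(Real.pi * area K) := by have := Real.pi_pos; positivity
  rw [ratio, deficit, perimeter_barycentricDisc h, div_le_iff₀ (by positivity), div_le_iff₀ hP]
  constructor <;> intro h <;> linarith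

lemma IsMinimizer.ratio_nonneg {Ω : Set Plane} (hΩ : IsMinimizer Ω) : 0 ≤ ratio Ω := by
  have h := hΩ.1
  rw [le_ratio_iff h.area_pos h.asymmetry_ne_zero]
  simpa using isoperimetric h.isCompact h.convex h.area_pos

/-- The lower bound for the perimeter that expresses minimality. -/
lemma IsMinimizer.le_perimeter {Ω K : Set Plane} (hΩ : IsMinimizer Ω) (hK : IsCompact K)
    (hK' : Convex ℝ K) (h : 0 < area K) :
    2 * √(Real.pi * area K) * (1 + ratio Ω * asymmetry K ^ 2) ≤ perimeter K := by
  by_cases hne : asymmetry K = 0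
  · simpa [hne] using isoperimetric hK hK' h
  · exact (le_ratio_iff h hne).1 (hΩ.2 K ⟨hK, hK', h, hne⟩)

lemma IsMinimizer.perimeter_eq {Ω : Set Plane} (hΩ : IsMinimizer Ω) :
    perimeter Ω = 2 * √(Real.pi * area Ω) * (1 + ratio Ω * asymmetry Ω ^ 2) :=
  le_antisymm ((ratio_le_iff hΩ.1.area_pos hΩ.1.asymmetry_ne_zero).1 le_rfl)
    (hΩ.le_perimeter hΩ.1.isCompact hΩ.1.convex hΩ.1.area_pos)

/-! ### Supergradients and the linear lower bound -/

/-- Hahn–Banach separates the open strict hypograph from the point on the graph. The separating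
functional is not vertical because the hypograph contains points directly below. -/
lemma exists_supergradient {E : Type*} [NormedAddCommGroup E] [NormedSpace ℝ E]
    [FiniteDimensional ℝ E] {s : Set E} {f : E → ℝ} (hf : ConcaveOn ℝ s f) (hs : IsOpen s) {x₀ : E}
    (hx₀ : x₀ ∈ s) : ∃ l : E →L[ℝ] ℝ, ∀ x ∈ s, f x ≤ f x₀ + l (x - x₀) := by
  have hopen : IsOpen {p : E × ℝ | p.1 ∈ s ∧ p.2 < f p.1} := by
    rw [isOpen_iff_mem_nhds]
    rintro ⟨x, y⟩ ⟨hx, hy⟩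
    have hcont : ContinuousAt f x := (hf.continuousOn hs).continuousAt (hs.mem_nhds hx)
    have h1 : ∀ᶠ p : E × ℝ in 𝓝 (x, y), p.1 ∈ s :=
      continuous_fst.continuousAt.eventually (hs.mem_nhds hx)
    have h2 : ∀ᶠ p : E × ℝ in 𝓝 (x, y), p.2 < f p.1 :=
      continuous_snd.continuousAt.eventually_lt
        (ContinuousAt.comp (f := Prod.fst) hcont continuous_fst.continuousAt) hy
    exact h1.and h2
  obtain ⟨L, hL⟩ := geometric_hahn_banach_open_point hf.convex_strict_hypograph hopen
    (show (x₀, f x₀) ∉ {p : E × ℝ | p.1 ∈ s ∧ p.2 < f p.1} from fun h => lt_irrefl _ h.2)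
  have hsplit : ∀ x y, L (x, y) = L (x, 0) + y * L (0, 1) := by
    intro x y
    rw [← smul_eq_mul, ← map_smul, ← map_add]
    simp
  have hc : 0 < L (0, 1) := by
    have := hL (x₀, f x₀ - 1) ⟨hx₀, by simp⟩
    rw [hsplit x₀ (f x₀ - 1), hsplit x₀ (f x₀)] at this
    linarith
  refine ⟨-(L (0, 1))⁻¹ • (L.comp (ContinuousLinearMap.inl ℝ E ℝ)), fun x hx => ?_⟩
  have hle : f x * L (0, 1) ≤ L (x₀, 0) + f x₀ * L (0, 1) - L (x, 0) := by
    refine le_of_forall_lt fun z hz => ?_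
    have := hL (x, z / L (0, 1)) ⟨hx, by rw [div_lt_iff₀ hc]; exact hz⟩
    rw [hsplit x _, hsplit x₀ (f x₀), div_mul_cancel₀ _ hc.ne'] at this
    linarith
  have hsub : L (x - x₀, 0) = L (x, 0) - L (x₀, 0) := by
    rw [← map_sub]; simp
  have : f x ≤ (L (x₀, 0) + f x₀ * L (0, 1) - L (x, 0)) / L (0, 1) := by rwa [le_div_iff₀ hc]
  refine this.trans (le_of_eq ?_)
  simp [hsub]
  field_simp
  ring

/-- A mixture of `Ω ∩ B(p, r)` and `Ω ∩ B(q, t)` lies in `Ω` intersected with the mixed ball, so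
Brunn–Minkowski applies. The domain consists of the balls with `c₀` in their interior; it is convex
and keeps every intersection nonempty. -/
lemma concaveOn_sqrt_overlap {Ω : Set Plane} (hΩ : IsCompact Ω) (hΩ' : Convex ℝ Ω) {c₀ : Plane}
    (hc₀ : c₀ ∈ Ω) :
    ConcaveOn ℝ {p : Plane × ℝ | ‖p.1 - c₀‖ < p.2} fun p => √(overlap Ω p.1 p.2) := by
  have hmix : ∀ (p q : Plane) (x : Plane) (a b : ℝ), 0 ≤ a → 0 ≤ b → a + b = 1 → ∀ y : Plane,
      ‖a • x + b • y - (a • p + b • q)‖ ≤ a * ‖x - p‖ + b * ‖y - q‖ := by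
    intro p q x a b ha hb _ y
    rw [show a • x + b • y - (a • p + b • q) = a • (x - p) + b • (y - q) by
      simp only [smul_sub]; abel]
    refine (norm_add_le _ _).trans ?_
    rw [norm_smul, norm_smul, Real.norm_of_nonneg ha, Real.norm_of_nonneg hb]
  constructor
  · rintro ⟨p, r⟩ hp ⟨q, t⟩ hq a b ha hb hab
    simp only [mem_ofPred_eq, smul_eq_mul, Prod.smul_mk, Prod.mk_add_mk] at hp hq ⊢
    have h1 := hmix c₀ c₀ p a b ha hb hab q
    rw [← add_smul, hab, one_smul] at h1
    refine h1.trans_lt ?_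
    rcases ha.eq_or_lt with rfl | ha
    · obtain rfl : b = 1 := by linarith
      linarith
    · nlinarith [mul_lt_mul_of_pos_left hp ha, mul_le_mul_of_nonneg_left hq.le hb]
  · rintro ⟨p, r⟩ hp ⟨q, t⟩ hq a b ha hb hab
    simp only [mem_ofPred_eq] at hp hq
    simp only [Prod.smul_mk, Prod.mk_add_mk, smul_eq_mul]
    rw [overlap, overlap, overlap, ← sqrt_area_smul ha, ← sqrt_area_smul hb]
    have hcomp : ∀ (p : Plane) (r : ℝ), IsCompact (Ω ∩ closedBall p r) := fun p r =>
      hΩ.inter_right isClosed_closedBall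
    have hconv : ∀ (p : Plane) (r : ℝ), Convex ℝ (Ω ∩ closedBall p r) := fun p r =>
      hΩ'.inter (convex_closedBall p r)
    have hne : ∀ (p : Plane) (r : ℝ), ‖p - c₀‖ < r → (Ω ∩ closedBall p r).Nonempty := fun p r h =>
      ⟨c₀, hc₀, by rw [mem_closedBall, dist_comm, dist_eq_norm]; exact h.le⟩
    refine (sqrt_area_add_le ((hcomp p r).smul a) ((hconv p r).smul a) ((hcomp q t).smul b)
      ((hconv q t).smul b) (hne p r hp).smul_set (hne q t hq).smul_set).trans ?_
    refine Real.sqrt_le_sqrt (area_mono (hcomp _ _) ?_)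
    rintro _ ⟨_, ⟨x, ⟨hx, hx'⟩, rfl⟩, _, ⟨y, ⟨hy, hy'⟩, rfl⟩, rfl⟩
    rw [mem_closedBall, dist_eq_norm] at hx' hy'
    refine ⟨hΩ' hx hy ha hb hab, ?_⟩
    rw [mem_closedBall, dist_eq_norm]
    refine (hmix p q x a b ha hb hab y).trans ?_
    gcongr

/-- The first moment of a set. -/
noncomputable def moment (X : Set Plane) : Plane := ∫ x in X, x

lemma integrableOn_of_isCompact {K : Set Plane} (hK : IsCompact K) {E : Type*}
    [NormedAddCommGroup E] {g : Plane → E} (hg : Continuous g) :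
    IntegrableOn g K := hg.continuousOn.integrableOn_compact hK

lemma barycentre_mem {Ω : Set Plane} (hΩ : IsCompact Ω) (hΩ' : Convex ℝ Ω) (h : 0 < area Ω) :
    barycentre Ω ∈ Ω := by
  have h0 : volume Ω ≠ 0 := fun h0 => by simp [area, Measure.real, h0] at h
  have := hΩ'.set_average_mem (f := fun x => x) hΩ.isClosed h0 hΩ.measure_lt_top.ne
    ((ae_restrict_mem hΩ.measurableSet)) (integrableOn_of_isCompact hΩ continuous_id)
  rwa [setAverage_eq] at this

/-- The change of area and of the first moment. -/
noncomputable def increment (Ω K : Set Plane) : ℝ × Plane :=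
  (area K - area Ω, moment K - moment Ω)

lemma increment_eq_sub (Ω K : Set Plane) :
    increment Ω K = (area K, moment K) - (area Ω, moment Ω) := rfl

/-- The barycentre and the disc radius as a function of the area and the first moment. -/
noncomputable def discData (x : ℝ × Plane) : Plane × ℝ := (x.1⁻¹ • x.2, √(x.1 / Real.pi))

lemma discData_area_moment (K : Set Plane) :
    discData (area K, moment K) = (barycentre K, discRadius K) := rfl

lemma differentiableAt_discData {x : ℝ × Plane} (hx : 0 < x.1) :
    DifferentiableAt ℝ discData x := by
  have h1 : x.1 ≠ 0 := hx.ne'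
  have h2 : x.1 / Real.pi ≠ 0 := (div_pos hx Real.pi_pos).ne'
  unfold discData
  fun_prop (disch := assumption)

lemma exists_dist_disc_lt {Ω : Set Plane} (h : 0 < area Ω) {ε : ℝ} (hε : 0 < ε) :
    ∃ η > 0, ∀ K : Set Plane, ‖increment Ω K‖ ≤ η →
      dist (barycentre K) (barycentre Ω) < ε ∧ |discRadius K - discRadius Ω| < ε := by
  have hc := (differentiableAt_discData (x := (area Ω, moment Ω)) h).continuousAt
  obtain ⟨η, hη, H⟩ := Metric.nhds_basis_closedBall.mem_iff.1
    (hc.preimage_mem_nhds (Metric.ball_mem_nhds _ hε))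
  refine ⟨η, hη, fun K hK => ?_⟩
  have := H (show (area K, moment K) ∈ _ by rwa [mem_closedBall, dist_eq_norm, ← increment_eq_sub])
  rw [mem_preimage, discData_area_moment, discData_area_moment, mem_ball, Prod.dist_eq] at this
  exact ⟨(le_max_left _ _).trans_lt this, by
    have := (le_max_right _ _).trans_lt this
    rwa [Real.dist_eq] at this⟩

/-- First-order lower bound for the perimeter of the competitors of a minimizer. -/
lemma IsMinimizer.exists_linear_lower_bound {Ω : Set Plane} (hΩ : IsMinimizer Ω) (χ : ℝ) :
    ∃ D : ℝ × Plane →L[ℝ] ℝ, ∀ e > 0, ∃ η > 0, ∀ K : Set Plane, IsCompact K → Convex ℝ K →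
      ‖increment Ω K‖ ≤ η →
      overlap K (barycentre K) (discRadius K) ≤
        overlap Ω (barycentre K) (discRadius K) + χ * (area K - area Ω) →
      D (increment Ω K) - e * ‖increment Ω K‖ ≤ perimeter K - perimeter Ω := by
  have hadm := hΩ.1
  have ha₀ := hadm.area_pos
  have hc₀ := barycentre_mem hadm.isCompact hadm.convex ha₀
  set U : Set (Plane × ℝ) := {p | ‖p.1 - barycentre Ω‖ < p.2} with hU
  have hUo : IsOpen U := isOpen_lt (by fun_prop) (by fun_prop)
  have hmem : (barycentre Ω, discRadius Ω) ∈ U := by simpa [hU] using discRadius_pos ha₀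
  obtain ⟨l, hl⟩ := exists_supergradient
    (concaveOn_sqrt_overlap hadm.isCompact hadm.convex hc₀) hUo hmem
  simp only at hl
  set x₀ : ℝ × Plane := (area Ω, moment Ω) with hx₀
  set N₀ := √(overlap Ω (barycentre Ω) (discRadius Ω)) with hN₀
  -- A differentiable lower bound for the asymmetry in terms of area and moment: the overlap is
  -- replaced by the square of its supergradient bound plus the allowance `χ` times the area change.
  -- It is exact at `Ω`, so `H` below touches the perimeter there.
  set lam : ℝ × Plane → ℝ := fun x => 2 * (1 - ((N₀ + l (discData x - discData x₀)) ^ 2 +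
    χ * (x.1 - area Ω)) / x.1) with hlam
  set H : ℝ × Plane → ℝ := fun x => 2 * √(Real.pi * x.1) * (1 + ratio Ω * lam x ^ 2) with hH
  have hdd := differentiableAt_discData (x := x₀) ha₀
  have hldiff : DifferentiableAt ℝ lam x₀ := by
    have h1 : x₀.1 ≠ 0 := ha₀.ne'
    have h2 : DifferentiableAt ℝ (fun x => l (discData x - discData x₀)) x₀ :=
      l.differentiableAt.comp x₀ (hdd.sub_const _)
    simp only [hlam]
    fun_prop (disch := assumption)
  have hHdiff : DifferentiableAt ℝ H x₀ := by
    have h1 : Real.pi * x₀.1 ≠ 0 := (mul_pos Real.pi_pos ha₀).ne'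
    simp only [hH]
    fun_prop (disch := assumption)
  have hlam₀ : lam x₀ = asymmetry Ω := by
    rw [asymmetry_eq hadm.isCompact ha₀]
    simp [hlam, hN₀, hx₀, Real.sq_sqrt (show 0 ≤ overlap Ω _ _ from area_nonneg _)]
  have hlampos : 0 < lam x₀ := by
    rw [hlam₀]
    exact lt_of_le_of_ne (div_nonneg (area_nonneg _) (area_nonneg _)) (Ne.symm hadm.asymmetry_ne_zero)
  have hH₀ : H x₀ = perimeter Ω := by
    rw [hΩ.perimeter_eq, hH]
    simp only [hlam₀]
    rfl
  refine ⟨fderiv ℝ H x₀, fun e he => ?_⟩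
  have ev1 : ∀ᶠ x in 𝓝 x₀, 0 < x.1 := continuous_fst.continuousAt.eventually (lt_mem_nhds ha₀)
  -- Positivity lets the bound on the asymmetry be squared; it holds near `Ω` because `λ₀(Ω) ≠ 0`.
  have ev2 : ∀ᶠ x in 𝓝 x₀, 0 < lam x := hldiff.continuousAt.eventually (lt_mem_nhds hlampos)
  have ev3 : ∀ᶠ x in 𝓝 x₀, discData x ∈ U := hdd.continuousAt.eventually (hUo.mem_nhds hmem)
  have ev4 := hHdiff.hasFDerivAt.isLittleO.def he
  obtain ⟨η, hη, hev⟩ := Metric.nhds_basis_closedBall.eventually_iff.1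
    (ev1.and (ev2.and (ev3.and ev4)))
  refine ⟨η, hη, fun K hK hK' hinc hover => ?_⟩
  obtain ⟨k1, k2, k3, k4⟩ := hev (show (area K, moment K) ∈ _ by
    rwa [mem_closedBall, dist_eq_norm, ← increment_eq_sub])
  have hKa : 0 < area K := k1
  rw [discData_area_moment] at k3
  have hsq : overlap Ω (barycentre K) (discRadius K) ≤
      (N₀ + l (discData (area K, moment K) - discData x₀)) ^ 2 := by
    have := hl _ k3
    rw [← Real.sq_sqrt (show 0 ≤ overlap Ω (barycentre K) (discRadius K) from area_nonneg _)]
    exact pow_le_pow_left₀ (Real.sqrt_nonneg _) this 2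
  have hasym : lam (area K, moment K) ≤ asymmetry K := by
    rw [asymmetry_eq hK hKa]
    simp only [hlam]
    gcongr
    linarith
  have hF : H (area K, moment K) ≤ perimeter K := by
    refine le_trans ?_ (hΩ.le_perimeter hK hK' hKa)
    have := hΩ.ratio_nonneg
    simp only [hH]
    gcongr
  rw [← increment_eq_sub, hH₀] at k4
  have := (abs_le.1 ((Real.norm_eq_abs _).symm.le.trans k4)).1
  linarith

/-! ### Perimeter change when the lower boundary is replaced -/

/-- `K` arises from `Ω` when, over `[a, b]`, the lower boundary `f` is replaced by `w`. -/
structure ReplacesLower (Ω K : Set Plane) (a b : ℝ) (f w : ℝ → ℝ) : Prop where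
  slices : ∀ s ∈ Icc a b, ∃ g, slice Ω s = Icc (f s) g ∧ slice K s = Icc (w s) g ∧
    f s ≤ g ∧ w s ≤ g
  slice_eq : ∀ s ∉ Icc a b, slice K s = slice Ω s

lemma ReplacesLower.symm {Ω K : Set Plane} {a b : ℝ} {f w : ℝ → ℝ}
    (h : ReplacesLower Ω K a b f w) : ReplacesLower K Ω a b w f where
  slices s hs := by
    obtain ⟨g, h1, h2, h3, h4⟩ := h.slices s hs
    exact ⟨g, h2, h1, h4, h3⟩
  slice_eq s hs := (h.slice_eq s hs).symm

/-- Only lower ends of slices change. In this form the fact passes to neighbourhoods and allows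
upper ends to be compared without describing the upper boundary. -/
lemma ReplacesLower.exists_ge_mem {Ω K : Set Plane} {a b : ℝ} {f w : ℝ → ℝ}
    (h : ReplacesLower Ω K a b f w) {s t : ℝ} (ht : !₂[s, t] ∈ K) : ∃ t' ≥ t, !₂[s, t'] ∈ Ω := by
  by_cases hs : s ∈ Icc a b
  · obtain ⟨g, h1, h2, h3, h4⟩ := h.slices s hs
    rw [← mem_slice, h2] at ht
    exact ⟨g, ht.2, by rw [← mem_slice, h1]; exact ⟨h3, le_rfl⟩⟩
  · rw [← mem_slice, h.slice_eq s hs] at ht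
    exact ⟨t, le_rfl, ht⟩

lemma ReplacesLower.sliceLength_sub {Ω K : Set Plane} {a b : ℝ} {f w : ℝ → ℝ}
    (h : ReplacesLower Ω K a b f w) {s : ℝ} (hs : s ∈ Icc a b) :
    sliceLength K s - sliceLength Ω s = f s - w s := by
  obtain ⟨g, h1, h2, h3, h4⟩ := h.slices s hs
  rw [sliceLength, sliceLength, h1, h2, Real.volume_real_Icc_of_le h3, Real.volume_real_Icc_of_le h4]
  ring

lemma mem_cthickening_iff_exists {K : Set Plane} (hK : IsCompact K) {ε : ℝ} (hε : 0 ≤ ε)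
    {x : Plane} : x ∈ cthickening ε K ↔ ∃ y ∈ K, dist x y ≤ ε := by
  rw [hK.cthickening_eq_biUnion_closedBall hε]
  simp

lemma dist_mk (s t s' t' : ℝ) :
    dist (!₂[s, t] : Plane) !₂[s', t'] = √((s - s') ^ 2 + (t - t') ^ 2) := by
  rw [dist_eq_norm, sub_mk, norm_mk]

/-- Cauchy–Schwarz against `(p, 1)`: a half-plane above a line of slope `p`, thickened by `ε`,
descends vertically by `ε√(1 + p²)`. -/
lemma mul_add_le_of_dist_le {ε p s t s' t' : ℝ}
    (h : dist (!₂[s, t] : Plane) !₂[s', t'] ≤ ε) :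
    t' - t - p * (s' - s) ≤ ε * √(1 + p ^ 2) := by
  rw [dist_mk] at h
  have hε : 0 ≤ ε := (Real.sqrt_nonneg _).trans h
  have h1 : (s - s') ^ 2 + (t - t') ^ 2 ≤ ε ^ 2 := (Real.sqrt_le_left hε).1 h
  rw [← Real.sqrt_sq hε, ← Real.sqrt_mul (sq_nonneg _)]
  refine Real.le_sqrt_of_sq_le ?_
  nlinarith [sq_nonneg ((s - s') - p * (t' - t)), mul_le_mul_of_nonneg_right h1
    (show 0 ≤ 1 + p ^ 2 by positivity), sq_nonneg ((s' - s) + p * (t' - t))]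

lemma exists_mem_Icc_of_mem_cthickening {K : Set Plane} (hK : IsCompact K) {ε : ℝ} (hε : 0 ≤ ε)
    {s t : ℝ} (h : !₂[s, t] ∈ cthickening ε K) :
    ∃ s' t', !₂[s', t'] ∈ K ∧ dist (!₂[s, t] : Plane) !₂[s', t'] ≤ ε ∧ |s - s'| ≤ ε := by
  obtain ⟨y, hy, hd⟩ := (mem_cthickening_iff_exists hK hε).1 h
  refine ⟨y 0, y 1, by rwa [mk_coords], by rwa [mk_coords], ?_⟩
  have := abs_fst_le_norm (!₂[s, t] - y)
  rw [← dist_eq_norm] at this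
  simpa using this.trans hd

lemma ReplacesLower.exists_ge_mem_cthickening {Ω K : Set Plane} {a b : ℝ} {f w : ℝ → ℝ}
    (h : ReplacesLower Ω K a b f w) (hΩ : IsCompact Ω) (hK : IsCompact K) {ε : ℝ} (hε : 0 ≤ ε)
    {s t : ℝ} (ht : !₂[s, t] ∈ cthickening ε K) : ∃ t' ≥ t, !₂[s, t'] ∈ cthickening ε Ω := by
  obtain ⟨s', t', hmem, hd, -⟩ := exists_mem_Icc_of_mem_cthickening hK hε ht
  obtain ⟨t'', hle, hmem'⟩ := h.exists_ge_mem hmem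
  refine ⟨t + (t'' - t'), by linarith, (mem_cthickening_iff_exists hΩ hε).2 ⟨_, hmem', ?_⟩⟩
  rw [dist_mk] at hd ⊢
  convert! hd using 4
  ring

/-- The top of the thickened slice of `K` lies below some point of the thickened slice of `Ω`, which
is an interval through `B`. The upper ends therefore cancel favourably. -/
lemma ReplacesLower.sliceLength_cthickening_sub_le {Ω K : Set Plane} {a b : ℝ} {f w : ℝ → ℝ}
    (h : ReplacesLower Ω K a b f w) (hΩ : IsCompact Ω) (hΩ' : Convex ℝ Ω) (hK : IsCompact K)
    {ε : ℝ} (hε : 0 ≤ ε) {s A B : ℝ} (hA : ∀ t, !₂[s, t] ∈ cthickening ε K → A ≤ t)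
    (hB : !₂[s, B] ∈ cthickening ε Ω) :
    sliceLength (cthickening ε K) s - sliceLength (cthickening ε Ω) s ≤ B - A := by
  obtain ⟨t₀, -, ht₀⟩ := h.symm.exists_ge_mem_cthickening hK hΩ hε hB
  have hcK := isCompact_slice (isCompact_cthickening hK ε) s
  have hcΩ := isCompact_slice (isCompact_cthickening hΩ ε) s
  obtain ⟨T, hT, hTmax⟩ := hcK.exists_isGreatest ⟨t₀, ht₀⟩
  obtain ⟨T', hle, hT'⟩ := h.exists_ge_mem_cthickening hΩ hK hε hT
  have h1 : sliceLength (cthickening ε K) s ≤ T - A := by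
    rw [← Real.volume_real_Icc_of_le (hA T hT)]
    exact measureReal_mono (fun t ht => ⟨hA t ht, hTmax ht⟩) (by simp)
  have h2 : T' - B ≤ sliceLength (cthickening ε Ω) s := by
    rcases le_total B T' with hBT | hBT
    · rw [← Real.volume_real_Icc_of_le hBT]
      exact measureReal_mono ((convex_slice (hΩ'.cthickening ε) s).ordConnected.out hB hT')
        hcΩ.measure_lt_top.ne
    · exact (sub_nonpos.2 hBT).trans (sliceLength_nonneg _ _)
  linarith

lemma ReplacesLower.sliceLength_cthickening_le_of_notMem {Ω K : Set Plane} {a b : ℝ} {f w : ℝ → ℝ}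
    (h : ReplacesLower Ω K a b f w) (hΩ : IsCompact Ω) (hK : IsCompact K)
    {ε : ℝ} (hε : 0 ≤ ε) {s : ℝ} (hs : s ∉ Icc (a - ε) (b + ε)) :
    sliceLength (cthickening ε K) s ≤ sliceLength (cthickening ε Ω) s := by
  refine measureReal_mono (fun t ht => ?_)
    (isCompact_slice (isCompact_cthickening hΩ ε) s).measure_lt_top.ne
  obtain ⟨s', t', hmem, hd, hs'⟩ := exists_mem_Icc_of_mem_cthickening hK hε ht
  refine (mem_cthickening_iff_exists hΩ hε).2 ⟨_, ?_, hd⟩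
  rw [← mem_slice, ← h.slice_eq s', mem_slice]
  · exact hmem
  · rw [abs_le] at hs'
    exact fun hs'' => hs ⟨by linarith [hs''.1], by linarith [hs''.2]⟩

lemma integrableOn_of_abs_le {s : Set ℝ} (hs : MeasurableSet s) (hs' : volume s ≠ ⊤) {g : ℝ → ℝ}
    (hg : Measurable g) {C : ℝ} (hC : ∀ x ∈ s, |g x| ≤ C) : IntegrableOn g s :=
  Measure.integrableOn_of_bounded hs' hg.aestronglyMeasurable
    (M := C) ((ae_restrict_iff' hs).2 (Eventually.of_forall hC))

/-- The direction in which the outer parallel curve of a graph with slope `p` is reached. -/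
noncomputable def normalSlope (p : ℝ) : ℝ := -p / √(1 + p ^ 2)

lemma normalSlope_sq (p : ℝ) : 1 - normalSlope p ^ 2 = (1 / √(1 + p ^ 2)) ^ 2 := by
  rw [normalSlope, div_pow, div_pow, Real.sq_sqrt (by positivity)]
  field_simp
  ring

lemma abs_normalSlope_le (p : ℝ) : |normalSlope p| ≤ 1 := by
  rw [← sq_le_one_iff_abs_le_one]
  nlinarith [normalSlope_sq p, sq_nonneg (1 / √(1 + p ^ 2))]

lemma normalSlope_identity (p : ℝ) : -(p * normalSlope p) + 1 / √(1 + p ^ 2) = √(1 + p ^ 2) := by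
  have h : 0 < √(1 + p ^ 2) := by positivity
  rw [normalSlope]
  field_simp
  rw [Real.sq_sqrt (by positivity)]
  ring

lemma measurable_normalSlope : Measurable normalSlope := by
  unfold normalSlope
  fun_prop

/-- The rate at which the outer parallel curve descends above a fixed abscissa is the arc length
density. The displaced base point supplies `-f' ν` and the vertical component of the unit normal
supplies the rest. -/
lemma tendsto_outward_rate {f : ℝ → ℝ} {s : ℝ} (hf : DifferentiableAt ℝ f s) :
    Tendsto (fun ε => (f s - f (s + ε * normalSlope (deriv f s))) / ε + 1 / √(1 + deriv f s ^ 2))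
      (𝓝[>] 0) (𝓝 (√(1 + deriv f s ^ 2))) := by
  set ν := normalSlope (deriv f s) with hν
  have h1 : HasDerivAt (fun ε : ℝ => f (s + ε * ν)) (deriv f s * (1 * ν)) 0 := by
    have h2 : HasDerivAt (fun ε : ℝ => s + ε * ν) (1 * ν) 0 :=
      ((hasDerivAt_id (0 : ℝ)).mul_const ν).const_add s
    refine HasDerivAt.comp (h₂ := f) 0 ?_ h2
    simpa using hf.hasDerivAt
  have h3 := (hasDerivAt_iff_tendsto_slope.1 h1).mono_left
    (nhdsWithin_mono 0 (show Ioi (0 : ℝ) ⊆ {0}ᶜ from fun x hx => (ne_of_gt hx)))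
  have h4 := h3.neg.add_const (1 / √(1 + deriv f s ^ 2))
  rw [one_mul, normalSlope_identity] at h4
  refine h4.congr fun ε => ?_
  simp only [slope_def_field, zero_mul, add_zero, sub_zero]
  ring

/-- Upper bound for the change of the perimeter when a part of the boundary is replaced. -/
theorem ReplacesLower.perimeter_sub_le {Ω K : Set Plane} {a b : ℝ} {f w p : ℝ → ℝ}
    (h : ReplacesLower Ω K a b f w) (hab : a ≤ b)
    (hΩ : IsCompact Ω) (hΩ' : Convex ℝ Ω) (hΩa : 0 < area Ω)
    (hK : IsCompact K) (hK' : Convex ℝ K) (hKa : 0 < area K)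
    {L : ℝ≥0} (hf : LipschitzWith L f) {d : ℝ} (hd : 0 < d)
    (hfΩ : ∀ s ∈ Icc (a - d) (b + d), !₂[s, f s] ∈ Ω) (hfa : w a = f a) (hfb : w b = f b)
    (hp : Measurable p) (hpL : ∀ s ∈ Icc a b, |p s| ≤ L)
    (hpK : ∀ s ∈ Icc a b, ∀ σ τ, !₂[σ, τ] ∈ K → w s + p s * (σ - s) ≤ τ) :
    perimeter K - perimeter Ω ≤
      (∫ s in a..b, √(1 + p s ^ 2)) - ∫ s in a..b, √(1 + deriv f s ^ 2) := by
  set ν : ℝ → ℝ := fun s => normalSlope (deriv f s) with hν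
  set E : ℝ → ℝ → ℝ := fun ε s => (f s - f (s + ε * ν s)) / ε + 1 / √(1 + deriv f s ^ 2) with hE
  have hfm : Measurable f := hf.continuous.measurable
  have hνm : Measurable ν := measurable_normalSlope.comp (measurable_deriv f)
  have hEm : ∀ ε, Measurable (E ε) := by
    intro ε
    have h1 : Measurable fun s => f (s + ε * ν s) := hfm.comp (by fun_prop)
    have h2 := measurable_deriv f
    simp only [hE]
    fun_prop
  have hone : ∀ p : ℝ, 1 ≤ √(1 + p ^ 2) := fun p => by
    rw [Real.one_le_sqrt]; nlinarith [sq_nonneg p]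
  have hEb : ∀ ε > 0, ∀ s, |E ε s| ≤ L + 1 := by
    intro ε hε s
    refine (abs_add_le _ _).trans (add_le_add ?_ ?_)
    · rw [abs_div, abs_of_pos hε, div_le_iff₀ hε, ← Real.dist_eq]
      refine (hf.dist_le_mul _ _).trans ?_
      rw [Real.dist_eq, sub_add_cancel_left, abs_neg, abs_mul, abs_of_pos hε]
      have := abs_normalSlope_le (deriv f s)
      gcongr
      exact mul_le_of_le_one_right hε.le this
    · rw [abs_of_nonneg (by positivity), div_le_one (by positivity)]
      exact hone _
  have hElim : Tendsto (fun ε => ∫ s in Icc a b, E ε s) (𝓝[>] 0)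
      (𝓝 (∫ s in Icc a b, √(1 + deriv f s ^ 2))) := by
    refine tendsto_integral_filter_of_dominated_convergence (fun _ => (L : ℝ) + 1)
      (Eventually.of_forall fun ε => (hEm ε).aestronglyMeasurable) ?_
      (integrable_const _) ?_
    · filter_upwards [self_mem_nhdsWithin] with ε hε
      exact Eventually.of_forall fun s => hEb ε hε s
    · refine ae_restrict_of_ae ?_
      filter_upwards [hf.ae_differentiableAt_real] with s hs
      exact tendsto_outward_rate hs
  set C : ℝ := 2 * L + √(1 + (L : ℝ) ^ 2) with hC
  have hC0 : 0 ≤ C := by positivity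
  -- The supporting line of slope `p s` bounds the thickened competitor from below.
  have hlow : ∀ ε ≥ 0, ∀ s ∈ Icc a b, ∀ σ t, !₂[σ, t] ∈ cthickening ε K →
      w s + p s * (σ - s) - ε * √(1 + p s ^ 2) ≤ t := by
    intro ε hε s hs σ t ht
    obtain ⟨s', t', hmem, hd, -⟩ := exists_mem_Icc_of_mem_cthickening hK hε ht
    have h1 := hpK s hs s' t' hmem
    have h2 := mul_add_le_of_dist_le (p := p s) hd
    linarith
  have hsqrtL : ∀ s ∈ Icc a b, √(1 + p s ^ 2) ≤ √(1 + (L : ℝ) ^ 2) := by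
    intro s hs
    refine Real.sqrt_le_sqrt (add_le_add le_rfl ?_)
    rw [← sq_abs]
    exact pow_le_pow_left₀ (abs_nonneg _) (hpL s hs) 2
  have hpt : ∀ ε ∈ Ioc 0 d, ∀ s, sliceLength (cthickening ε K) s - sliceLength (cthickening ε Ω) s ≤
      (sliceLength K s - sliceLength Ω s) +
        (Icc a b).indicator (fun s => ε * (√(1 + p s ^ 2) - E ε s)) s +
        ((Icc (a - ε) a).indicator (fun _ => C * ε) s + (Icc b (b + ε)).indicator (fun _ => C * ε) s) := by
    intro ε ⟨hε, hεd⟩ s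
    have hind : ∀ S : Set ℝ, 0 ≤ S.indicator (fun _ => C * ε) s := fun S =>
      indicator_nonneg (fun _ _ => by positivity) s
    have hself : ∀ s ∈ Icc (a - ε) (b + ε), !₂[s, f s] ∈ cthickening ε Ω := fun s hs =>
      self_subset_cthickening Ω (hfΩ s ⟨by linarith [hs.1], by linarith [hs.2]⟩)
    by_cases hs : s ∈ Icc a b
    · rw [indicator_of_mem hs, h.sliceLength_sub hs]
      -- The point of the graph over `s + εν`, displaced by `ε` along the outward normal of slope
      -- `f'(s)`, lands exactly over `s`.
      have hB : !₂[s, f (s + ε * ν s) - ε * (1 / √(1 + deriv f s ^ 2))] ∈ cthickening ε Ω := by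
        have hνε := abs_le.1 (abs_normalSlope_le (deriv f s))
        refine (mem_cthickening_iff_exists hΩ hε.le).2 ⟨_, hfΩ (s + ε * ν s)
          ⟨by nlinarith [hs.1], by nlinarith [hs.2]⟩, ?_⟩
        rw [dist_mk]
        refine Real.sqrt_le_iff.2 ⟨hε.le, ?_⟩
        have := normalSlope_sq (deriv f s)
        simp only [hν] at *
        nlinarith
      have h1 := h.sliceLength_cthickening_sub_le hΩ hΩ' hK hε.le
        (A := w s - ε * √(1 + p s ^ 2)) (fun t ht => by
          have := hlow ε hε.le s hs s t ht
          simpa using this) hB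
      have h2 : ε * E ε s = f s - f (s + ε * ν s) + ε * (1 / √(1 + deriv f s ^ 2)) := by
        simp only [hE]; field_simp
      nlinarith [hind (Icc (a - ε) a), hind (Icc b (b + ε))]
    rw [indicator_of_notMem hs]
    have hzero : sliceLength K s - sliceLength Ω s = 0 := by
      rw [sliceLength, sliceLength, h.slice_eq s hs, sub_self]
    rw [hzero]
    by_cases hs' : s ∈ Icc (a - ε) (b + ε)
    · have hend : ∀ e ∈ Icc a b, w e = f e → |s - e| ≤ ε →
          sliceLength (cthickening ε K) s - sliceLength (cthickening ε Ω) s ≤ C * ε := by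
        intro e he hwe hse
        refine (h.sliceLength_cthickening_sub_le hΩ hΩ' hK hε.le
          (fun t ht => hlow ε hε.le e he s t ht) (hself s hs')).trans ?_
        have h1 := hf.dist_le_mul s e
        rw [Real.dist_eq, Real.dist_eq] at h1
        have h2 : f s - f e ≤ L * ε := (le_abs_self _).trans (h1.trans (by gcongr))
        have h3 : -(p e * (s - e)) ≤ L * ε := by
          refine (neg_le_abs _).trans ?_
          rw [abs_mul]
          exact mul_le_mul (hpL e he) hse (abs_nonneg _) L.2
        have h4 := mul_le_mul_of_nonneg_left (hsqrtL e he) hε.le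
        rw [hC]
        linarith
      rcases lt_or_ge s a with hsa | hsa
      · have := hend a ⟨le_rfl, hab⟩ hfa (abs_le.2 ⟨by linarith [hs'.1], by linarith⟩)
        rw [indicator_of_mem (show s ∈ Icc (a - ε) a from ⟨hs'.1, hsa.le⟩)]
        linarith [hind (Icc b (b + ε))]
      · have hsb : b < s := by
          by_contra! hsb
          exact hs ⟨hsa, hsb⟩
        have := hend b ⟨hab, le_rfl⟩ hfb (abs_le.2 ⟨by linarith, by linarith [hs'.2]⟩)
        rw [indicator_of_mem (show s ∈ Icc b (b + ε) from ⟨hsb.le, hs'.2⟩)]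
        linarith [hind (Icc (a - ε) a)]
    · linarith [h.sliceLength_cthickening_le_of_notMem hΩ hK hε.le hs', hind (Icc (a - ε) a),
        hind (Icc b (b + ε))]
  have hpint : IntegrableOn (fun s => √(1 + p s ^ 2)) (Icc a b) :=
    integrableOn_of_abs_le measurableSet_Icc (by simp) (by fun_prop) (C := √(1 + (L : ℝ) ^ 2))
      fun s hs => by rw [abs_of_nonneg (Real.sqrt_nonneg _)]; exact hsqrtL s hs
  have hineq : ∀ ε ∈ Ioc 0 d, (area (cthickening ε K) - area K) / ε -
      (area (cthickening ε Ω) - area Ω) / ε ≤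
        (∫ s in Icc a b, √(1 + p s ^ 2)) - (∫ s in Icc a b, E ε s) + 2 * C * ε := by
    intro ε hε
    have hε0 : 0 < ε := hε.1
    have hEint : IntegrableOn (E ε) (Icc a b) :=
      integrableOn_of_abs_le measurableSet_Icc (by simp) (hEm ε) fun s _ => hEb ε hε0 s
    have hi1 := integrable_sliceLength (isCompact_cthickening hK ε)
    have hi2 := integrable_sliceLength (isCompact_cthickening hΩ ε)
    have hi3 := integrable_sliceLength hK
    have hi4 := integrable_sliceLength hΩ
    have hi5 : Integrable ((Icc a b).indicator (fun s => ε * (√(1 + p s ^ 2) - E ε s))) :=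
      IntegrableOn.integrable_indicator (Integrable.const_mul (hpint.sub hEint) ε) measurableSet_Icc
    have hi6 : ∀ u v : ℝ, Integrable ((Icc u v).indicator fun _ => C * ε) := fun u v =>
      IntegrableOn.integrable_indicator (integrableOn_const (by simp)) measurableSet_Icc
    have hint := integral_mono (hi1.sub hi2) (((hi3.sub hi4).add hi5).add
      ((hi6 (a - ε) a).add (hi6 b (b + ε)))) (fun s => hpt ε hε s)
    rw [integral_add' ((hi3.sub hi4).add hi5) ((hi6 (a - ε) a).add (hi6 b (b + ε))),
      integral_add' (hi3.sub hi4) hi5, integral_add' (hi6 (a - ε) a) (hi6 b (b + ε)),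
      integral_sub' hi1 hi2, integral_sub' hi3 hi4, integral_indicator measurableSet_Icc,
      integral_indicator measurableSet_Icc, integral_indicator measurableSet_Icc,
      integral_const_mul, integral_sub hpint hEint, setIntegral_const, setIntegral_const,
      Real.volume_real_Icc_of_le (by linarith), Real.volume_real_Icc_of_le (by linarith),
      ← area_eq_integral_sliceLength (isCompact_cthickening hK ε),
      ← area_eq_integral_sliceLength (isCompact_cthickening hΩ ε),
      ← area_eq_integral_sliceLength hK, ← area_eq_integral_sliceLength hΩ] at hint
    simp only [smul_eq_mul] at hint
    rw [← sub_div, div_le_iff₀ hε0]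
    linarith
  have hlim1 := (tendsto_perimeter hK hK' hKa).sub (tendsto_perimeter hΩ hΩ' hΩa)
  have hid : Tendsto (fun ε : ℝ => 2 * C * ε) (𝓝[>] 0) (𝓝 (2 * C * 0)) :=
    tendsto_nhdsWithin_of_tendsto_nhds (Continuous.tendsto (by fun_prop) 0)
  have hlim2 := (hElim.const_sub (∫ s in Icc a b, √(1 + p s ^ 2))).add hid
  have := le_of_tendsto_of_tendsto hlim1 hlim2 (by
    filter_upwards [Ioc_mem_nhdsGT hd] with ε hε using hineq ε hε)
  rw [intervalIntegral.integral_of_le hab, intervalIntegral.integral_of_le hab,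
    ← integral_Icc_eq_integral_Ioc, ← integral_Icc_eq_integral_Ioc]
  linarith

/-! ### Change of area, moment and overlap -/

lemma setIntegral_eq_integral_slice {X : Set Plane} (hX : IsCompact X) {ξ : Plane → ℝ}
    (hξ : Continuous ξ) :
    Integrable (fun s => ∫ t in slice X s, ξ !₂[s, t]) ∧
      ∫ x in X, ξ x = ∫ s, ∫ t in slice X s, ξ !₂[s, t] := by
  have hi : Integrable (X.indicator ξ) :=
    (integrableOn_of_isCompact hX hξ).integrable_indicator hX.measurableSet
  have hi' : Integrable (fun x => X.indicator ξ (coordEquiv x)) :=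
    (measurePreserving_coordEquiv.integrable_comp_emb coordEquiv.measurableEmbedding).2 hi
  have hslice : ∀ s, ∫ t, X.indicator ξ (coordEquiv (s, t)) = ∫ t in slice X s, ξ !₂[s, t] := by
    intro s
    rw [← integral_indicator (isClosed_slice hX.isClosed s).measurableSet]
    refine integral_congr_ae (Eventually.of_forall fun t => ?_)
    simp only [indicator, mem_slice, coordEquiv_apply]
    rfl
  rw [Measure.volume_eq_prod] at hi'
  constructor
  · have := hi'.integral_prod_left
    simpa only [hslice] using this
  · rw [← integral_indicator hX.measurableSet,
      ← measurePreserving_coordEquiv.integral_comp coordEquiv.measurableEmbedding,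
      Measure.volume_eq_prod, integral_prod _ hi']
    simp only [hslice]

lemma ReplacesLower.setIntegral_sub {Ω K : Set Plane} {a b : ℝ} {f w : ℝ → ℝ}
    (h : ReplacesLower Ω K a b f w) (hab : a ≤ b) (hΩ : IsCompact Ω) (hK : IsCompact K)
    {ξ : Plane → ℝ} (hξ : Continuous ξ) :
    (∫ x in K, ξ x) - ∫ x in Ω, ξ x = ∫ s in a..b, ∫ t in w s..f s, ξ !₂[s, t] := by
  obtain ⟨hi1, he1⟩ := setIntegral_eq_integral_slice hK hξ
  obtain ⟨hi2, he2⟩ := setIntegral_eq_integral_slice hΩ hξ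
  rw [he1, he2, ← integral_sub hi1 hi2, intervalIntegral.integral_of_le hab,
    ← integral_Icc_eq_integral_Ioc, ← integral_indicator measurableSet_Icc]
  refine integral_congr_ae (Eventually.of_forall fun s => ?_)
  by_cases hs : s ∈ Icc a b
  · simp only [indicator_of_mem hs]
    obtain ⟨g, h1, h2, h3, h4⟩ := h.slices s hs
    have hc : Continuous fun t => ξ !₂[s, t] := hξ.comp (continuous_mk_right s)
    rw [h1, h2, integral_Icc_eq_integral_Ioc, integral_Icc_eq_integral_Ioc,
      ← intervalIntegral.integral_of_le h3, ← intervalIntegral.integral_of_le h4,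
      ← intervalIntegral.integral_add_adjacent_intervals (hc.intervalIntegrable (w s) (f s))
        (hc.intervalIntegrable (f s) g), add_sub_cancel_right]
  · simp only [indicator_of_notMem hs]
    rw [h.slice_eq s hs, sub_self]

lemma apply_increment {Ω K : Set Plane} (hΩ : IsCompact Ω) (hK : IsCompact K)
    (D : ℝ × Plane →L[ℝ] ℝ) :
    D (increment Ω K) = (∫ x in K, D (1, x)) - ∫ x in Ω, D (1, x) := by
  have key : ∀ X : Set Plane, IsCompact X → ∫ x in X, D (1, x) = D (area X, moment X) := by
    intro X hX
    have hsplit : ∀ (u : ℝ) (x : Plane), D (u, x) = u * D (1, 0) + D (0, x) := by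
      intro u x
      rw [← smul_eq_mul, ← map_smul, ← map_add]
      exact congrArg D (Prod.ext (by simp) (by simp))
    have hc : Continuous fun x : Plane => D (0, x) := D.continuous.comp (by fun_prop)
    have h2 := ContinuousLinearMap.integral_comp_comm (μ := volume.restrict X)
      (D.comp (ContinuousLinearMap.inr ℝ ℝ Plane)) (φ := fun x => x)
      (integrableOn_of_isCompact hX continuous_id)
    simp only [ContinuousLinearMap.coe_comp, Function.comp_apply,
      ContinuousLinearMap.inr_apply] at h2
    rw [integral_congr_ae (Eventually.of_forall fun x => hsplit 1 x), hsplit (area X) (moment X)]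
    simp only [one_mul]
    rw [integral_add (f := fun _ => D (1, 0)) (g := fun x => D (0, x))
      (integrableOn_of_isCompact hX continuous_const) (integrableOn_of_isCompact hX hc), h2,
      setIntegral_const]
    rfl
  rw [key K hK, key Ω hΩ, increment_eq_sub, map_sub]

lemma apply_mk (D : ℝ × Plane →L[ℝ] ℝ) (s t : ℝ) :
    D (1, !₂[s, t]) = D (1, 0) + D (0, !₂[1, 0]) * s + D (0, !₂[0, 1]) * t := by
  have : ((1 : ℝ), (!₂[s, t] : Plane)) =
      (1, 0) + s • ((0 : ℝ), (!₂[1, 0] : Plane)) + t • ((0 : ℝ), (!₂[0, 1] : Plane)) := by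
    simp only [Prod.smul_mk, smul_mk, Prod.mk_add_mk, smul_zero, add_zero, add_mk,
      mul_zero, mul_one, zero_add]
  rw [this, map_add, map_add, map_smul, map_smul, smul_eq_mul, smul_eq_mul]
  ring

/-- A linear functional of area and moment is the integral over the set of an affine function of the
point. On each vertical segment between `w` and `f`, an affine function integrates to the signed
length times its value at the midpoint. -/
lemma ReplacesLower.apply_increment {Ω K : Set Plane} {a b : ℝ} {f w : ℝ → ℝ}
    (h : ReplacesLower Ω K a b f w) (hab : a ≤ b) (hΩ : IsCompact Ω) (hK : IsCompact K)
    (D : ℝ × Plane →L[ℝ] ℝ) :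
    D (increment Ω K) = ∫ s in a..b, (f s - w s) *
      (D (1, 0) + D (0, !₂[1, 0]) * s + D (0, !₂[0, 1]) * ((f s + w s) / 2)) := by
  rw [PlanarShape.apply_increment hΩ hK, h.setIntegral_sub (ξ := fun x => D (1, x)) hab hΩ hK
    (D.continuous.comp (by fun_prop))]
  refine intervalIntegral.integral_congr fun s _ => ?_
  simp only [apply_mk]
  rw [intervalIntegral.integral_add (by simp) (by
    exact Continuous.intervalIntegrable (by fun_prop) _ _), intervalIntegral.integral_const,
    intervalIntegral.integral_const_mul, integral_id, smul_eq_mul]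
  ring

lemma ReplacesLower.norm_increment_le {Ω K : Set Plane} {a b : ℝ} {f w : ℝ → ℝ}
    (h : ReplacesLower Ω K a b f w) (hab : a ≤ b) (hΩ : IsCompact Ω) (hK : IsCompact K)
    {κ R : ℝ} (hκ : ∀ s ∈ Icc a b, |f s - w s| ≤ κ) (hR : ∀ s ∈ Icc a b, |s| ≤ R)
    (hfR : ∀ s ∈ Icc a b, |f s| ≤ R) (hwR : ∀ s ∈ Icc a b, |w s| ≤ R) :
    ‖increment Ω K‖ ≤ (1 + 2 * R) * (κ * (b - a)) := by
  have hκ0 : 0 ≤ κ := (abs_nonneg _).trans (hκ a ⟨le_rfl, hab⟩)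
  have hR0 : 0 ≤ R := (abs_nonneg _).trans (hR a ⟨le_rfl, hab⟩)
  have key : ∀ (D : ℝ × Plane →L[ℝ] ℝ) (M : ℝ), (∀ s t, |s| ≤ R → |t| ≤ R → |D (1, !₂[s, t])| ≤ M) →
      |D (increment Ω K)| ≤ M * (κ * (b - a)) := by
    intro D M hD
    rw [h.apply_increment hab hΩ hK D, ← Real.norm_eq_abs]
    refine (intervalIntegral.norm_integral_le_of_norm_le_const (C := κ * M) fun s hs => ?_).trans ?_
    · rw [uIoc_of_le hab] at hs
      have hs' := Ioc_subset_Icc_self hs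
      rw [Real.norm_eq_abs, abs_mul, ← apply_mk]
      refine mul_le_mul (hκ s hs') (hD _ _ (hR s hs') ?_) (abs_nonneg _) hκ0
      rw [abs_div, abs_two]
      linarith [abs_add_le (f s) (w s), hfR s hs', hwR s hs']
    · rw [abs_of_nonneg (sub_nonneg.2 hab)]
      linarith
  -- The norm is controlled by the three coordinate functionals: area and the two components of the
  -- moment.
  have h1 := key (ContinuousLinearMap.fst ℝ ℝ Plane) 1 (by simp)
  have h2 := key ((EuclideanSpace.proj (0 : Fin 2)).comp (ContinuousLinearMap.snd ℝ ℝ Plane)) R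
    (by intro s t hs ht; simpa using hs)
  have h3 := key ((EuclideanSpace.proj (1 : Fin 2)).comp (ContinuousLinearMap.snd ℝ ℝ Plane)) R
    (by intro s t hs ht; simpa using ht)
  simp only [ContinuousLinearMap.coe_fst', ContinuousLinearMap.coe_comp, Function.comp_apply,
    ContinuousLinearMap.coe_snd'] at h1 h2 h3
  change |(increment Ω K).2 0| ≤ _ at h2
  change |(increment Ω K).2 1| ≤ _ at h3
  have hprod : 0 ≤ κ * (b - a) := mul_nonneg hκ0 (sub_nonneg.2 hab)
  have hnorm : ∀ x : Plane, ‖x‖ ≤ |x 0| + |x 1| := by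
    intro x
    rw [← mk_coords x, norm_mk]
    refine Real.sqrt_le_iff.2 ⟨by positivity, ?_⟩
    simp only [Matrix.cons_val_zero, Matrix.cons_val_one]
    nlinarith [sq_abs (x 0), sq_abs (x 1), abs_nonneg (x 0), abs_nonneg (x 1)]
  rw [Prod.norm_def]
  refine max_le ?_ ((hnorm _).trans ?_)
  · rw [Real.norm_eq_abs]
    nlinarith
  · nlinarith

lemma overlap_mono {K Ω : Set Plane} (hΩ : IsCompact Ω) (h : K ⊆ Ω) (c : Plane) (r : ℝ) :
    overlap K c r ≤ overlap Ω c r :=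
  area_mono (hΩ.inter_right isClosed_closedBall) (inter_subset_inter_left _ h)

lemma overlap_eq_of_mem_iff {K Ω : Set Plane} {c : Plane} {r : ℝ}
    (h : ∀ x ∈ closedBall c r, x ∈ K ↔ x ∈ Ω) : overlap K c r = overlap Ω c r := by
  rw [overlap, overlap]
  congr 1
  ext x
  exact ⟨fun hx => ⟨(h x hx.2).1 hx.1, hx.2⟩, fun hx => ⟨(h x hx.2).2 hx.1, hx.2⟩⟩

lemma overlap_sub_eq_of_mem_iff {K Ω : Set Plane} (hK : IsCompact K) (hΩ : IsCompact Ω) {c : Plane}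
    {r : ℝ} (h : ∀ x ∉ closedBall c r, x ∈ K ↔ x ∈ Ω) :
    overlap K c r = overlap Ω c r + (area K - area Ω) := by
  have hB : MeasurableSet (closedBall c r) := isClosed_closedBall.measurableSet
  have h1 := measureReal_sdiff_add_inter (μ := volume) (s := K) hB hK.measure_lt_top.ne
  have h2 := measureReal_sdiff_add_inter (μ := volume) (s := Ω) hB hΩ.measure_lt_top.ne
  have h3 : K \ closedBall c r = Ω \ closedBall c r := by
    ext x
    exact ⟨fun hx => ⟨(h x hx.2).1 hx.1, hx.2⟩, fun hx => ⟨(h x hx.2).2 hx.1, hx.2⟩⟩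
  rw [h3] at h1
  simp only [overlap, area]
  linarith

lemma ReplacesLower.mem_iff {Ω K : Set Plane} {a b : ℝ} {f w : ℝ → ℝ}
    (h : ReplacesLower Ω K a b f w) {s t : ℝ} (hst : s ∈ Icc a b → t ∉ [[f s, w s]]) :
    !₂[s, t] ∈ K ↔ !₂[s, t] ∈ Ω := by
  rw [← mem_slice, ← mem_slice]
  by_cases hs : s ∈ Icc a b
  · obtain ⟨g, h1, h2, h3, h4⟩ := h.slices s hs
    rw [h1, h2]
    have := hst hs
    rw [mem_uIcc] at this
    push Not at this
    constructor
    · rintro ⟨h5, h6⟩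
      refine ⟨?_, h6⟩
      by_contra! h7
      exact absurd (this.2 h5) (not_lt.2 h7.le)
    · rintro ⟨h5, h6⟩
      refine ⟨?_, h6⟩
      by_contra! h7
      exact absurd (this.1 h5) (not_lt.2 h7.le)
  · rw [h.slice_eq s hs]

/-! ### Invariance under isometries -/

lemma affineIsometryEquiv_apply (φ : Plane ≃ᵃⁱ[ℝ] Plane) (x : Plane) :
    φ x = φ.linearIsometryEquiv x + φ 0 := by
  have := φ.map_vadd 0 x
  rwa [vadd_eq_add, vadd_eq_add, add_zero] at this

lemma measurePreserving_affineIsometryEquiv (φ : Plane ≃ᵃⁱ[ℝ] Plane) :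
    MeasurePreserving φ volume volume := by
  have h1 := (measurePreserving_add_right (volume : Measure Plane) (φ 0)).comp
    φ.linearIsometryEquiv.measurePreserving
  convert! h1 using 1
  ext1 x
  exact affineIsometryEquiv_apply φ x

lemma area_preimage (φ : Plane ≃ᵃⁱ[ℝ] Plane) (X : Set Plane) : area (φ ⁻¹' X) = area X := by
  rw [area, area, Measure.real, Measure.real]
  congr 1
  have h := measurePreserving_affineIsometryEquiv φ
  exact h.measure_preimage_emb φ.toHomeomorph.measurableEmbedding X

lemma cthickening_preimage (φ : Plane ≃ᵃⁱ[ℝ] Plane) (ε : ℝ) (X : Set Plane) :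
    cthickening ε (φ ⁻¹' X) = φ ⁻¹' cthickening ε X := by
  ext x
  have h := infEDist_image φ.isometry (x := x) (t := φ ⁻¹' X)
  rw [image_preimage_eq _ φ.surjective] at h
  rw [mem_preimage, mem_cthickening_iff, mem_cthickening_iff, h]

lemma perimeter_preimage (φ : Plane ≃ᵃⁱ[ℝ] Plane) (X : Set Plane) :
    perimeter (φ ⁻¹' X) = perimeter X := by
  simp only [perimeter, cthickening_preimage, area_preimage]

lemma apply_barycentre_preimage (φ : Plane ≃ᵃⁱ[ℝ] Plane) {X : Set Plane} (hX : IsCompact X)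
    (h : 0 < area X) : φ (barycentre (φ ⁻¹' X)) = barycentre X := by
  have hX' : IsCompact (φ ⁻¹' X) := φ.toHomeomorph.isCompact_preimage.2 hX
  have hφ := affineIsometryEquiv_apply φ
  have h1 := (measurePreserving_affineIsometryEquiv φ).setIntegral_preimage_emb
    φ.toHomeomorph.measurableEmbedding (fun x : Plane => x) X
  have h2 : ∫ x in φ ⁻¹' X, φ x =
      φ.linearIsometryEquiv (∫ x in φ ⁻¹' X, x) + area X • φ 0 := by
    rw [integral_congr_ae (Eventually.of_forall hφ),
      integral_add (f := fun x => φ.linearIsometryEquiv x) (g := fun _ => φ 0)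
        (integrableOn_of_isCompact hX' φ.linearIsometryEquiv.continuous)
        (integrableOn_of_isCompact hX' continuous_const), setIntegral_const]
    congr 1
    · exact ContinuousLinearMap.integral_comp_comm (μ := volume.restrict (φ ⁻¹' X))
        (φ.linearIsometryEquiv.toContinuousLinearEquiv : Plane →L[ℝ] Plane) (φ := fun x => x)
        (integrableOn_of_isCompact hX' continuous_id)
    · rw [← area_preimage φ X]
      rfl
  rw [hφ, barycentre, barycentre, area_preimage, ← h1, h2, map_smul, smul_add, smul_smul,
    inv_mul_cancel₀ h.ne', one_smul]

lemma barycentricDisc_preimage (φ : Plane ≃ᵃⁱ[ℝ] Plane) {X : Set Plane} (hX : IsCompact X)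
    (h : 0 < area X) : barycentricDisc (φ ⁻¹' X) = φ ⁻¹' barycentricDisc X := by
  ext x
  rw [mem_preimage, barycentricDisc, barycentricDisc, mem_closedBall, mem_closedBall,
    ← apply_barycentre_preimage φ hX h, φ.dist_map, discRadius, discRadius, area_preimage]

lemma barycentricCircle_preimage (φ : Plane ≃ᵃⁱ[ℝ] Plane) {X : Set Plane} (hX : IsCompact X)
    (h : 0 < area X) : barycentricCircle (φ ⁻¹' X) = φ ⁻¹' barycentricCircle X := by
  ext x
  rw [mem_preimage, barycentricCircle, barycentricCircle, mem_sphere, mem_sphere,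
    ← apply_barycentre_preimage φ hX h, φ.dist_map, discRadius, discRadius, area_preimage]

lemma asymmetry_preimage (φ : Plane ≃ᵃⁱ[ℝ] Plane) {X : Set Plane} (hX : IsCompact X)
    (h : 0 < area X) : asymmetry (φ ⁻¹' X) = asymmetry X := by
  rw [asymmetry, asymmetry, barycentricDisc_preimage φ hX h, ← preimage_symmDiff, area_preimage,
    area_preimage]

lemma ratio_preimage (φ : Plane ≃ᵃⁱ[ℝ] Plane) {X : Set Plane} (hX : IsCompact X)
    (h : 0 < area X) : ratio (φ ⁻¹' X) = ratio X := by
  rw [ratio, ratio, asymmetry_preimage φ hX h, deficit, deficit, barycentricDisc_preimage φ hX h,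
    perimeter_preimage, perimeter_preimage]

lemma Admissible.preimage {X : Set Plane} (hX : Admissible X) (φ : Plane ≃ᵃⁱ[ℝ] Plane) :
    Admissible (φ ⁻¹' X) where
  isCompact := φ.toHomeomorph.isCompact_preimage.2 hX.isCompact
  convex := hX.convex.affine_preimage φ.toAffineEquiv.toAffineMap
  area_pos := by rw [area_preimage]; exact hX.area_pos
  asymmetry_ne_zero := by
    rw [asymmetry_preimage φ hX.isCompact hX.area_pos]; exact hX.asymmetry_ne_zero

/-- This allows a boundary point to be moved to the origin, with an interior point vertically above
it. -/
lemma IsMinimizer.preimage {Ω : Set Plane} (hΩ : IsMinimizer Ω) (φ : Plane ≃ᵃⁱ[ℝ] Plane) :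
    IsMinimizer (φ ⁻¹' Ω) := by
  refine ⟨hΩ.1.preimage φ, fun K hK => ?_⟩
  rw [ratio_preimage φ hΩ.1.isCompact hΩ.1.area_pos, ← ratio_preimage φ.symm hK.isCompact hK.area_pos]
  exact hΩ.2 _ (hK.preimage φ.symm)

/-! ### Graph charts of the boundary -/

/-- Over `[-R, R]` the lower boundary of `Ω` is the graph of `f`, which passes through the origin;
the part of `Ω` over `[-R, R]` reaches the height `h`. -/
structure LowerChart (Ω : Set Plane) (f : ℝ → ℝ) (R h : ℝ) (L : ℝ≥0) : Prop where
  R_pos : 0 < R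
  h_pos : 0 < h
  zero : f 0 = 0
  lipschitz : LipschitzWith L f
  convexOn : ConvexOn ℝ (Icc (-R) R) f
  abs_lt : ∀ s ∈ Icc (-R) R, |f s| < h
  slices : ∀ s ∈ Icc (-R) R, ∃ g, h ≤ g ∧ slice Ω s = Icc (f s) g

lemma LowerChart.le {Ω : Set Plane} {f : ℝ → ℝ} {R h : ℝ} {L : ℝ≥0} (H : LowerChart Ω f R h L)
    {s t : ℝ} (hs : s ∈ Icc (-R) R) (ht : !₂[s, t] ∈ Ω) : f s ≤ t := by
  obtain ⟨g, -, hg⟩ := H.slices s hs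
  rw [← mem_slice, hg] at ht
  exact ht.1

lemma LowerChart.mem {Ω : Set Plane} {f : ℝ → ℝ} {R h : ℝ} {L : ℝ≥0} (H : LowerChart Ω f R h L)
    {s t : ℝ} (hs : s ∈ Icc (-R) R) (ht : f s ≤ t) (ht' : t ≤ h) : !₂[s, t] ∈ Ω := by
  obtain ⟨g, hg', hg⟩ := H.slices s hs
  rw [← mem_slice, hg]
  exact ⟨ht, ht'.trans hg'⟩

lemma LowerChart.mono {Ω : Set Plane} {f : ℝ → ℝ} {R r h : ℝ} {L : ℝ≥0} (H : LowerChart Ω f R h L)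
    (hr : 0 < r) (hrR : r ≤ R) : LowerChart Ω f r h L := by
  have hsub : Icc (-r) r ⊆ Icc (-R) R := Icc_subset_Icc (by linarith) hrR
  exact ⟨hr, H.h_pos, H.zero, H.lipschitz, H.convexOn.subset hsub (convex_Icc _ _),
    fun s hs => H.abs_lt s (hsub hs), fun s hs => H.slices s (hsub hs)⟩

lemma LowerChart.isLocalEpigraphAt {Ω : Set Plane} {φ : Plane ≃ᵃⁱ[ℝ] Plane} {f : ℝ → ℝ}
    {R h r : ℝ} {L : ℝ≥0} (H : LowerChart (φ ⁻¹' Ω) f R h L) {P : (ℝ → ℝ) → ℝ → Prop} {p : Plane}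
    (hp : φ 0 = p) (hr : 0 < r) (hrR : r ≤ R) (hP : P f r) : IsLocalEpigraphAt P Ω p := by
  have hsub : ∀ s ∈ Ioo (-r) r, s ∈ Icc (-R) R := fun s hs =>
    ⟨by linarith [hs.1], by linarith [hs.2]⟩
  refine ⟨φ, f, r, h, hp, hr, H.h_pos, H.zero, hP, fun s hs => _root_.abs_lt.1 (H.abs_lt s (hsub s hs)),
    fun s hs t ht => ?_⟩
  change !₂[s, t] ∈ φ ⁻¹' Ω ↔ _
  exact ⟨H.le (hsub s hs), fun h => H.mem (hsub s hs) h ht.2.le⟩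

lemma mk_zero_zero : (!₂[0, 0] : Plane) = 0 := by
  ext i; fin_cases i <;> rfl

/-- Over a ball around the interior point, the lower ends of the slices form a convex, hence locally
Lipschitz, function. Outside a small interval it is replaced by a globally Lipschitz extension, so
that shifted arguments and almost everywhere derivatives need no domain conditions. -/
lemma exists_lowerChart_of_zero_mem_frontier {Ω : Set Plane} (hΩ : IsCompact Ω) (hΩ' : Convex ℝ Ω)
    {τ : ℝ} (hτ : 0 < τ) (hint : !₂[0, τ] ∈ interior Ω) (h0 : (0 : Plane) ∈ frontier Ω) :
    ∃ f R h L, LowerChart Ω f R h L := by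
  obtain ⟨ρ, hρ, hball⟩ := Metric.nhds_basis_closedBall.mem_iff.1 (mem_interior_iff_mem_nhds.1 hint)
  set lo : ℝ → ℝ := fun s => sInf (slice Ω s) with hlo
  have hτmem : ∀ s ∈ Icc (-ρ) ρ, τ ∈ slice Ω s := by
    intro s hs
    refine hball ?_
    rw [mem_closedBall, dist_mk]
    refine Real.sqrt_le_iff.2 ⟨hρ.le, ?_⟩
    have := abs_le.2 hs
    nlinarith [sq_abs s, abs_nonneg s]
  have hleast : ∀ s ∈ Icc (-ρ) ρ, IsLeast (slice Ω s) (lo s) := fun s hs =>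
    (isCompact_slice hΩ s).isLeast_sInf ⟨τ, hτmem s hs⟩
  have hconv : ConvexOn ℝ (Icc (-ρ) ρ) lo := by
    refine ⟨convex_Icc _ _, fun s hs s' hs' a b ha hb hab => ?_⟩
    exact (hleast _ (convex_Icc (-ρ) ρ hs hs' ha hb hab)).2
      (convex_mix_mem hΩ' (hleast s hs).1 (hleast s' hs').1 ha hb hab)
  have h0mem : (0 : ℝ) ∈ Icc (-ρ) ρ := ⟨by linarith, hρ.le⟩
  have hlo0 : lo 0 = 0 := by
    refine le_antisymm ((hleast 0 h0mem).2 ?_) ?_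
    · rw [mem_slice, mk_zero_zero]
      exact hΩ.isClosed.frontier_subset h0
    -- If the slice extended below the origin, the origin would lie strictly between a point of `Ω`
    -- and an interior point, hence be interior.
    · by_contra! hneg
      refine h0.2 (hΩ'.openSegment_self_interior_subset_interior (hleast 0 h0mem).1 hint ?_)
      have hd : 0 < τ - lo 0 := by linarith
      refine ⟨τ / (τ - lo 0), -lo 0 / (τ - lo 0), by positivity, div_pos (by linarith) hd, ?_, ?_⟩
      · field_simp; ring
      · have h1 : τ / (τ - lo 0) * 0 + -lo 0 / (τ - lo 0) * 0 = 0 := by ring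
        have h2 : τ / (τ - lo 0) * lo 0 + -lo 0 / (τ - lo 0) * τ = 0 := by field_simp; ring
        rw [smul_mk, smul_mk, add_mk, h1, h2, mk_zero_zero]
  have hIoo : Ioo (-ρ) ρ ∈ 𝓝 (0 : ℝ) := Ioo_mem_nhds (by linarith) hρ
  have hconv' := hconv.subset Ioo_subset_Icc_self (convex_Ioo (-ρ) ρ)
  obtain ⟨L, U, hU, hLip⟩ := hconv'.locallyLipschitzOn isOpen_Ioo (mem_of_mem_nhds hIoo)
  rw [nhdsWithin_eq_nhds.2 hIoo] at hU
  have hcont : ContinuousAt lo 0 := (hconv'.continuousOn isOpen_Ioo).continuousAt hIoo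
  have hsmall : ∀ᶠ s in 𝓝 (0 : ℝ), |lo s| < τ :=
    hcont.abs.eventually_lt continuousAt_const (by rwa [hlo0, abs_zero])
  obtain ⟨R, hR, hRsub⟩ := Metric.nhds_basis_closedBall.mem_iff.1
    (inter_mem (inter_mem hU hIoo) hsmall)
  rw [Real.closedBall_eq_Icc, zero_sub, zero_add] at hRsub
  obtain ⟨f, hf, hfeq⟩ := (hLip.mono fun s hs => (hRsub hs).1.1).extend_real
  have hsub : Icc (-R) R ⊆ Icc (-ρ) ρ := fun s hs => Ioo_subset_Icc_self (hRsub hs).1.2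
  refine ⟨f, R, τ, L, hR, hτ, ?_, hf, ?_, ?_, ?_⟩
  · rw [← hfeq ⟨by linarith, hR.le⟩, hlo0]
  · exact (hconv.subset hsub (convex_Icc _ _)).congr hfeq
  · intro s hs
    rw [← hfeq hs]
    exact (hRsub hs).2
  · intro s hs
    obtain ⟨g, hg⟩ := (isCompact_slice hΩ s).exists_isGreatest ⟨τ, hτmem s (hsub hs)⟩
    refine ⟨g, hg.2 (hτmem s (hsub hs)), ?_⟩
    rw [← hfeq hs]
    refine Subset.antisymm (fun t ht => ⟨(hleast s (hsub hs)).2 ht, hg.2 ht⟩) ?_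
    exact (convex_slice hΩ' s).ordConnected.out (hleast s (hsub hs)).1 hg.1

lemma exists_lowerChart {Ω : Set Plane} (hΩ : IsCompact Ω) (hΩ' : Convex ℝ Ω) (h : 0 < area Ω)
    {p : Plane} (hp : p ∈ frontier Ω) :
    ∃ (φ : Plane ≃ᵃⁱ[ℝ] Plane) (f : ℝ → ℝ) (R k : ℝ) (L : ℝ≥0),
      φ 0 = p ∧ LowerChart (φ ⁻¹' Ω) f R k L := by
  obtain ⟨q, hq⟩ := interior_nonempty_of_area_pos hΩ' h
  have hne : q - p ≠ 0 := by
    intro h0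
    rw [sub_eq_zero] at h0
    exact hp.2 (h0 ▸ hq)
  set τ := ‖q - p‖ with hτ
  have hτ0 : 0 < τ := norm_pos_iff.2 hne
  have hnorm : ‖(!₂[0, τ] : Plane)‖ = ‖q - p‖ := by
    rw [norm_mk]; simp [hτ0.le, ← hτ]
  -- The reflection that exchanges two vectors of equal norm sends the upward vertical to the
  -- direction of the interior point.
  set A := Submodule.reflection (Submodule.span ℝ {!₂[0, τ] - (q - p)})ᗮ with hA
  set φ : Plane ≃ᵃⁱ[ℝ] Plane := A.toAffineIsometryEquiv.trans (AffineIsometryEquiv.constVAdd ℝ Plane p)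
    with hφ
  have hφx : ∀ x, φ x = p + A x := fun x => rfl
  have hφ0 : φ 0 = p := by rw [hφx, map_zero, add_zero]
  have hφτ : φ !₂[0, τ] = q := by
    rw [hφx, hA, Submodule.reflection_sub hnorm]
    abel
  have h1 : φ ⁻¹' interior Ω = interior (φ ⁻¹' Ω) := φ.toHomeomorph.preimage_interior Ω
  have h2 : φ ⁻¹' frontier Ω = frontier (φ ⁻¹' Ω) := φ.toHomeomorph.preimage_frontier Ω
  have hc : IsCompact (φ ⁻¹' Ω) := φ.toHomeomorph.isCompact_preimage.2 hΩ
  obtain ⟨f, R, k, L, H⟩ := exists_lowerChart_of_zero_mem_frontier hc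
    (hΩ'.affine_preimage φ.toAffineEquiv.toAffineMap) hτ0
    (by rw [← h1, mem_preimage, hφτ]; exact hq) (by rw [← h2, mem_preimage, hφ0]; exact hp)
  exact ⟨φ, f, R, k, L, hφ0, H⟩

/-! ### Elementary inequalities for the length of graphs -/

lemma sqrt_one_add_sq_ge (x k : ℝ) : (1 + k * x) / √(1 + k ^ 2) ≤ √(1 + x ^ 2) := by
  rw [div_le_iff₀ (by positivity), ← Real.sqrt_mul (by positivity)]
  refine Real.le_sqrt_of_sq_le ?_
  nlinarith [sq_nonneg (x - k)]

/-- Quantitative convexity. The tangent value is `q = (1 + kx) / S`, and `(T² - q²) S² = (x - k)²`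
exactly; dividing by `T + q ≤ 2M` and `S² ≤ M²` gives the quadratic gap. -/
lemma sqrt_one_add_sq_strong {x k L : ℝ} (hx : |x| ≤ L) (hk : |k| ≤ L) :
    √(1 + k ^ 2) + k * (x - k) / √(1 + k ^ 2) + (x - k) ^ 2 / (2 * √(1 + L ^ 2) ^ 3) ≤
      √(1 + x ^ 2) := by
  set S := √(1 + k ^ 2) with hS
  set T := √(1 + x ^ 2) with hT
  set M := √(1 + L ^ 2) with hM
  have hS2 : S ^ 2 = 1 + k ^ 2 := Real.sq_sqrt (by positivity)
  have hT2 : T ^ 2 = 1 + x ^ 2 := Real.sq_sqrt (by positivity)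
  have hS0 : 0 < S := by positivity
  have hT0 : 0 < T := by positivity
  have hM0 : 0 < M := by positivity
  have hSM : S ≤ M := Real.sqrt_le_sqrt (by
    rw [← sq_abs]; gcongr)
  have hTM : T ≤ M := Real.sqrt_le_sqrt (by
    rw [← sq_abs]; gcongr)
  set q := (1 + k * x) / S with hq
  have hqT : q ≤ T := sqrt_one_add_sq_ge x k
  have hqeq : S + k * (x - k) / S = q := by
    rw [hq]; field_simp; rw [hS2]; ring
  have hqS : q * S = 1 + k * x := by rw [hq]; field_simp
  have hdiff : (T - q) * (T + q) * S ^ 2 = (x - k) ^ 2 := by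
    have : (T - q) * (T + q) * S ^ 2 = T ^ 2 * S ^ 2 - (q * S) ^ 2 := by ring
    rw [this, hqS, hT2, hS2]; ring
  rw [hqeq]
  have hle : (x - k) ^ 2 ≤ (T - q) * (2 * M ^ 3) := by
    rw [← hdiff]
    have h1 : T + q ≤ 2 * M := by linarith
    have h2 : S ^ 2 ≤ M ^ 2 := by gcongr
    calc (T - q) * (T + q) * S ^ 2 ≤ (T - q) * (2 * M) * S ^ 2 := by
          gcongr
      _ ≤ (T - q) * (2 * M) * M ^ 2 := by
          gcongr
      _ = _ := by ring
  have : (x - k) ^ 2 / (2 * M ^ 3) ≤ T - q := by rwa [div_le_iff₀ (by positivity)]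
  linarith

lemma intervalIntegrable_of_abs_le {a b : ℝ} {g : ℝ → ℝ}
    (hg : Measurable g) {C : ℝ} (hC : ∀ x, |g x| ≤ C) : IntervalIntegrable g volume a b :=
  intervalIntegrable_iff.2 (Measure.integrableOn_of_bounded (by simp) hg.aestronglyMeasurable
    (M := C) (Eventually.of_forall hC))

lemma abs_deriv_le {f : ℝ → ℝ} {L : ℝ≥0} (hf : LipschitzWith L f) (s : ℝ) : |deriv f s| ≤ L :=
  norm_deriv_le_of_lipschitz hf

lemma integral_deriv_of_lipschitz {f : ℝ → ℝ} {L : ℝ≥0} (hf : LipschitzWith L f) (a b : ℝ) :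
    ∫ s in a..b, deriv f s = f b - f a :=
  (hf.lipschitzOnWith (s := uIcc a b)).absolutelyContinuousOnInterval.integral_deriv_eq_sub

lemma intervalIntegrable_deriv_of_lipschitz {f : ℝ → ℝ} {L : ℝ≥0} (hf : LipschitzWith L f)
    (a b : ℝ) : IntervalIntegrable (deriv f) volume a b :=
  intervalIntegrable_of_abs_le (measurable_deriv f) (abs_deriv_le hf)

lemma intervalIntegrable_arc {f : ℝ → ℝ} {L : ℝ≥0} (hf : LipschitzWith L f) (a b : ℝ) :
    IntervalIntegrable (fun s => √(1 + deriv f s ^ 2)) volume a b := by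
  have h := measurable_deriv f
  refine intervalIntegrable_of_abs_le (by fun_prop) (C := √(1 + (L : ℝ) ^ 2)) fun s => ?_
  rw [abs_of_nonneg (Real.sqrt_nonneg _)]
  refine Real.sqrt_le_sqrt ?_
  rw [← sq_abs]
  have := abs_deriv_le hf s
  gcongr

/-- The graph of a Lipschitz function is at least as long as its chord. -/
lemma chord_le_arc {f : ℝ → ℝ} {L : ℝ≥0} (hf : LipschitzWith L f) {a b k : ℝ} (hab : a ≤ b)
    (hk : f b - f a = k * (b - a)) :
    (b - a) * √(1 + k ^ 2) ≤ ∫ s in a..b, √(1 + deriv f s ^ 2) := by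
  have hT : 0 < √(1 + k ^ 2) := by positivity
  have h1 := intervalIntegrable_deriv_of_lipschitz hf a b
  have h2 : ∫ s in a..b, (1 + k * deriv f s) / √(1 + k ^ 2) = (b - a) * √(1 + k ^ 2) := by
    rw [intervalIntegral.integral_div, intervalIntegral.integral_add (by simp) (h1.const_mul k),
      intervalIntegral.integral_const_mul, integral_deriv_of_lipschitz hf, hk,
      intervalIntegral.integral_const, div_eq_iff hT.ne', mul_assoc, ← sq, Real.sq_sqrt (by positivity)]
    simp only [smul_eq_mul]
    ring
  rw [← h2]
  exact intervalIntegral.integral_mono_on hab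
    (((by simp : IntervalIntegrable (fun _ => (1 : ℝ)) volume a b).add (h1.const_mul k)).div_const _)
    (intervalIntegrable_arc hf a b) fun s _ => sqrt_one_add_sq_ge _ _

/-! ### Cutting along a chord -/

/-- The chord of the graph of `f` over `[a, b]`. -/
noncomputable def chord (f : ℝ → ℝ) (a b s : ℝ) : ℝ := f a + (f b - f a) / (b - a) * (s - a)

lemma chord_left (f : ℝ → ℝ) (a b : ℝ) : chord f a b a = f a := by simp [chord]

lemma chord_right (f : ℝ → ℝ) {a b : ℝ} (hab : a < b) : chord f a b b = f b := by
  have : b - a ≠ 0 := by linarith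
  rw [chord, div_mul_cancel₀ _ this]; ring

lemma chord_mix (f : ℝ → ℝ) (a b : ℝ) {u v x y : ℝ} (huv : u + v = 1) :
    chord f a b (u * x + v * y) = u * chord f a b x + v * chord f a b y := by
  obtain rfl : u = 1 - v := by linarith
  simp only [chord]; ring

/-- Every point of an interval is a convex combination of the end points. -/
lemma exists_mix {a b s : ℝ} (hs : s ∈ Icc a b) :
    ∃ u v : ℝ, 0 ≤ u ∧ 0 ≤ v ∧ u + v = 1 ∧ u * a + v * b = s := by
  have : s ∈ segment ℝ a b := by rwa [segment_eq_Icc (hs.1.trans hs.2)]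
  obtain ⟨u, v, hu, hv, huv, h⟩ := this
  exact ⟨u, v, hu, hv, huv, h⟩

lemma le_chord {f : ℝ → ℝ} {S : Set ℝ} (hf : ConvexOn ℝ S f) {a b : ℝ} (ha : a ∈ S) (hb : b ∈ S)
    (hab : a < b) {s : ℝ} (hs : s ∈ Icc a b) : f s ≤ chord f a b s := by
  obtain ⟨u, v, hu, hv, huv, rfl⟩ := exists_mix hs
  rw [chord_mix _ _ _ huv, chord_left, chord_right _ hab]
  exact hf.2 ha hb hu hv huv

/-- The gap `chord - f` is concave and vanishes at the end points. The midpoint is a mixture of `s`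
and an end point with weight at least `1/2` on `s`, so the gap at `s` is at most twice the gap at
the midpoint. -/
lemma chord_sub_le {f : ℝ → ℝ} {a b : ℝ} (hf : ConvexOn ℝ (Icc a b) f)
    (hab : a < b) {s : ℝ} (hs : s ∈ Icc a b) :
    chord f a b s - f s ≤ f a + f b - 2 * f ((a + b) / 2) := by
  have hm : chord f a b ((a + b) / 2) = (f a + f b) / 2 := by
    rw [show (a + b) / 2 = 1 / 2 * a + 1 / 2 * b by ring, chord_mix _ _ _ (by norm_num), chord_left,
      chord_right _ hab]
    ring
  have ha : a ∈ Icc a b := ⟨le_rfl, hab.le⟩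
  have hb : b ∈ Icc a b := ⟨hab.le, le_rfl⟩
  have key : ∀ e ∈ Icc a b, f e = chord f a b e → ∀ u v : ℝ, 1 / 2 ≤ u → 0 ≤ v → u + v = 1 →
      u * s + v * e = (a + b) / 2 → chord f a b s - f s ≤ f a + f b - 2 * f ((a + b) / 2) := by
    intro e he hfe u v hu hv huv hmid
    have h1 := hf.2 hs he (by linarith) hv huv
    have h2 := chord_mix f a b (x := s) (y := e) huv
    rw [hmid, hm] at h2
    simp only [smul_eq_mul] at h1
    rw [hmid] at h1
    have h3 := le_chord hf ha hb hab hs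
    nlinarith
  rcases le_total s ((a + b) / 2) with hsm | hsm
  · obtain ⟨u, v, hu, hv, huv, h⟩ := exists_mix (show (a + b) / 2 ∈ Icc s b from ⟨hsm, by linarith⟩)
    refine key b hb (chord_right f hab).symm u v ?_ hv huv h
    by_contra! hlt
    obtain rfl : v = 1 - u := by linarith
    linarith [mul_lt_mul_of_pos_right hlt (show 0 < b - s by linarith), hs.1]
  · obtain ⟨u, v, hu, hv, huv, h⟩ := exists_mix (show (a + b) / 2 ∈ Icc a s from ⟨by linarith, hsm⟩)
    refine key a ha (chord_left f a b).symm v u ?_ hu (by linarith) (by linarith)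
    by_contra! hlt
    obtain rfl : u = 1 - v := by linarith
    linarith [mul_lt_mul_of_pos_right hlt (show 0 < s - a by linarith), hs.2]

/-- The part of `Ω` above the chord of `f` over `[a, b]`. -/
def chordCut (Ω : Set Plane) (f : ℝ → ℝ) (a b : ℝ) : Set Plane :=
  Ω ∩ {x | chord f a b (x 0) ≤ x 1}

lemma mk_mem_chordCut {Ω : Set Plane} {f : ℝ → ℝ} {a b s t : ℝ} :
    !₂[s, t] ∈ chordCut Ω f a b ↔ !₂[s, t] ∈ Ω ∧ chord f a b s ≤ t := by
  simp [chordCut]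

lemma continuous_chord (f : ℝ → ℝ) (a b : ℝ) : Continuous (chord f a b) := by
  unfold chord; fun_prop

lemma isCompact_chordCut {Ω : Set Plane} (hΩ : IsCompact Ω) (f : ℝ → ℝ) (a b : ℝ) :
    IsCompact (chordCut Ω f a b) := by
  have := continuous_chord f a b
  exact hΩ.inter_right (isClosed_le (by fun_prop) (by fun_prop))

lemma convex_chordCut {Ω : Set Plane} (hΩ : Convex ℝ Ω) (f : ℝ → ℝ) (a b : ℝ) :
    Convex ℝ (chordCut Ω f a b) := by
  refine hΩ.inter fun x hx y hy u v hu hv huv => ?_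
  simp only [mem_ofPred_eq, PiLp.add_apply, PiLp.smul_apply, smul_eq_mul] at hx hy ⊢
  rw [chord_mix _ _ _ huv]
  gcongr

lemma LowerChart.chord_le {Ω : Set Plane} {f : ℝ → ℝ} {R h : ℝ} {L : ℝ≥0}
    (H : LowerChart Ω f R h L) {a b : ℝ} (ha : -R ≤ a) (hab : a < b) (hb : b ≤ R) {s : ℝ}
    (hs : s ∈ Icc a b) : |chord f a b s| ≤ h := by
  obtain ⟨u, v, hu, hv, huv, rfl⟩ := exists_mix hs
  rw [chord_mix _ _ _ huv, chord_left, chord_right _ hab]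
  have h1 := abs_le.1 (H.abs_lt a ⟨ha, by linarith⟩).le
  have h2 := abs_le.1 (H.abs_lt b ⟨by linarith, hb⟩).le
  have h3 : h = u * h + v * h := by rw [← add_mul, huv, one_mul]
  rw [abs_le]
  constructor <;> nlinarith

lemma LowerChart.replacesLower_chordCut {Ω : Set Plane} {f : ℝ → ℝ} {R h : ℝ} {L : ℝ≥0}
    (H : LowerChart Ω f R h L) (hΩ : Convex ℝ Ω) {a b : ℝ} (ha : -R ≤ a) (hab : a < b)
    (hb : b ≤ R) : ReplacesLower Ω (chordCut Ω f a b) a b f (chord f a b) where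
  slices s hs := by
    have haR : a ∈ Icc (-R) R := ⟨ha, by linarith⟩
    have hbR : b ∈ Icc (-R) R := ⟨by linarith, hb⟩
    have hsR : s ∈ Icc (-R) R := ⟨ha.trans hs.1, hs.2.trans hb⟩
    obtain ⟨g, hg, hsl⟩ := H.slices s hsR
    have h1 := (le_abs_self _).trans (H.chord_le ha hab hb hs)
    have h2 := le_chord H.convexOn haR hbR hab hs
    refine ⟨g, hsl, ?_, by linarith, h1.trans hg⟩
    ext t
    rw [mem_slice, mk_mem_chordCut, ← mem_slice, hsl]
    exact ⟨fun h => ⟨h.2, h.1.2⟩, fun h => ⟨⟨h2.trans h.1, h.2⟩, h.1⟩⟩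
  slice_eq s hs := by
    have haR : a ∈ Icc (-R) R := ⟨ha, by linarith⟩
    have hbR : b ∈ Icc (-R) R := ⟨by linarith, hb⟩
    ext t
    rw [mem_slice, mem_slice, mk_mem_chordCut, and_iff_left_iff_imp]
    intro hst
    by_contra! hlt
    -- Outside `[a, b]` no point of `Ω` lies below the chord line: joined to the far end `e` of the
    -- chord, it would put a point of `Ω` strictly below the graph at the near end `e'`.
    have key : ∀ e e' : ℝ, e ∈ Icc (-R) R → e' ∈ Icc (-R) R → chord f a b e = f e →
        chord f a b e' = f e' → ∀ u v : ℝ, 0 ≤ u → 0 < v → u + v = 1 → u * e + v * s = e' → False := by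
      intro e e' he he' hce hce' u v hu hv huv h'
      have h1 := convex_mix_mem hΩ (H.mem he le_rfl ((le_abs_self _).trans (H.abs_lt e he).le)) hst hu
        hv.le huv
      rw [h'] at h1
      have h2 := H.le he' h1
      have h3 := chord_mix f a b (x := e) (y := s) huv
      rw [h', hce, hce'] at h3
      nlinarith
    rcases lt_or_ge s a with hsa | hsa
    · obtain ⟨u, v, hu, hv, huv, h'⟩ := exists_mix (show a ∈ Icc s b from ⟨hsa.le, hab.le⟩)
      refine key b a hbR haR (chord_right f hab) (chord_left f a b) v u hv ?_ (by linarith)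
        (by linarith)
      rcases hu.eq_or_lt with rfl | hu
      · obtain rfl : v = 1 := by linarith
        linarith
      · exact hu
    · have hsb : b < s := by
        by_contra! hsb
        exact hs ⟨hsa, hsb⟩
      obtain ⟨u, v, hu, hv, huv, h'⟩ := exists_mix (show b ∈ Icc a s from ⟨hab.le, hsb.le⟩)
      refine key a b haR hbR (chord_left f a b) (chord_right f hab) u v hu ?_ huv h'
      rcases hv.eq_or_lt with rfl | hv
      · obtain rfl : u = 1 := by linarith
        linarith
      · exact hv

lemma area_pos_of_norm_increment_lt {Ω K : Set Plane} (h : ‖increment Ω K‖ < area Ω) :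
    0 < area K := by
  have h1 : |area K - area Ω| ≤ ‖increment Ω K‖ := norm_fst_le (increment Ω K)
  linarith [neg_le_abs (area K - area Ω)]

lemma LowerChart.chord_mem {Ω : Set Plane} {f : ℝ → ℝ} {R h : ℝ} {L : ℝ≥0}
    (H : LowerChart Ω f R h L) {s : ℝ} (hs : s ∈ Icc (-R) R) : !₂[s, f s] ∈ Ω :=
  H.mem hs le_rfl ((le_abs_self _).trans (H.abs_lt s hs).le)

/-! ### `C^{1,1}` regularity -/

/-- A chord of the graph is much shorter than the arc when the second difference is large. -/
lemma arc_sub_chord_ge {f : ℝ → ℝ} {L : ℝ≥0} (hf : LipschitzWith L f) {a b : ℝ} (hab : a < b) :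
    (f a + f b - 2 * f ((a + b) / 2)) ^ 2 / (2 * √(1 + (L : ℝ) ^ 2) ^ 3 * (b - a)) ≤
      (∫ s in a..b, √(1 + deriv f s ^ 2)) - (b - a) * √(1 + ((f b - f a) / (b - a)) ^ 2) := by
  set m := (a + b) / 2 with hm
  set k₁ := (f m - f a) / (m - a) with hk₁
  set k₂ := (f b - f m) / (b - m) with hk₂
  set k := (f b - f a) / (b - a) with hk
  have hma : 0 < m - a := by rw [hm]; linarith
  have hbm : 0 < b - m := by rw [hm]; linarith
  have hba : 0 < b - a := by linarith
  have e1 : f m - f a = k₁ * (m - a) := by rw [hk₁]; field_simp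
  have e2 : f b - f m = k₂ * (b - m) := by rw [hk₂]; field_simp
  have e3 : f b - f a = k * (b - a) := by rw [hk]; field_simp
  have hkk : k₁ + k₂ = 2 * k := by
    have h1 : m - a = (b - a) / 2 := by rw [hm]; ring
    have h2 : b - m = (b - a) / 2 := by rw [hm]; ring
    rw [h1] at e1
    rw [h2] at e2
    have : (k₁ + k₂ - 2 * k) * (b - a) = 0 := by linarith
    rcases mul_eq_zero.1 this with h | h <;> linarith
  have habs : ∀ x y : ℝ, x < y → |(f y - f x) / (y - x)| ≤ L := by
    intro x y hxy
    rw [abs_div, div_le_iff₀ (abs_pos.2 (by linarith)), ← Real.dist_eq, ← Real.dist_eq]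
    exact hf.dist_le_mul y x
  have h1 := chord_le_arc hf (by linarith) e1
  have h2 := chord_le_arc hf (by linarith) e2
  have h3 := intervalIntegral.integral_add_adjacent_intervals (intervalIntegrable_arc hf a m)
    (intervalIntegrable_arc hf m b)
  have hkL : |k| ≤ L := habs a b hab
  have s1 := sqrt_one_add_sq_strong (habs a m (by linarith)) hkL
  have s2 := sqrt_one_add_sq_strong (habs m b (by linarith)) hkL
  rw [← hk₁] at s1
  rw [← hk₂] at s2
  set M := √(1 + (L : ℝ) ^ 2) with hM
  have hM0 : 0 < M := by positivity
  -- The arc is at least as long as its two half chords. As `k` is the mean of their slopes, the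
  -- first-order terms cancel and only the quadratic gaps remain.
  have hlin : k * (k₁ - k) / √(1 + k ^ 2) + k * (k₂ - k) / √(1 + k ^ 2) = 0 := by
    rw [← add_div, ← mul_add, show k₁ - k + (k₂ - k) = 0 by linarith]; simp
  have hm1 : m - a = (b - a) / 2 := by rw [hm]; ring
  have hm2 : b - m = (b - a) / 2 := by rw [hm]; ring
  rw [hm1] at h1 e1
  rw [hm2] at h2 e2
  have hΔ : f a + f b - 2 * f m = (b - a) / 2 * (k₂ - k₁) := by linarith
  have hd1 : k₁ - k = -((k₂ - k₁) / 2) := by linarith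
  have hd2 : k₂ - k = (k₂ - k₁) / 2 := by linarith
  have hgoal : (f a + f b - 2 * f m) ^ 2 / (2 * M ^ 3 * (b - a)) =
      (b - a) / 2 * ((k₁ - k) ^ 2 / (2 * M ^ 3) + (k₂ - k) ^ 2 / (2 * M ^ 3)) := by
    rw [hΔ, hd1, hd2]
    field_simp
    ring
  rw [hgoal, ← h3]
  have hsum := mul_le_mul_of_nonneg_left (add_le_add s1 s2) (show 0 ≤ (b - a) / 2 by linarith)
  have hlin2 : (b - a) / 2 * (k * (k₁ - k) / √(1 + k ^ 2) + k * (k₂ - k) / √(1 + k ^ 2)) = 0 := by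
    rw [hlin, mul_zero]
  linarith

/-- The second differences of the lower boundary of a minimizer are quadratically small. -/
lemma IsMinimizer.exists_second_difference_le {Ω : Set Plane} (hΩ : IsMinimizer Ω) {f : ℝ → ℝ}
    {R h : ℝ} {L : ℝ≥0} (H : LowerChart Ω f R h L) :
    ∃ r > 0, r ≤ R ∧ ∃ C ≥ 0, ∀ a b, -r ≤ a → a < b → b ≤ r →
      f a + f b - 2 * f ((a + b) / 2) ≤ C * (b - a) ^ 2 := by
  obtain ⟨D, hD⟩ := hΩ.exists_linear_lower_bound 0
  obtain ⟨η, hη, hD⟩ := hD 1 one_pos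
  have hadm := hΩ.1
  have hR := H.R_pos
  have hh := H.h_pos
  set Q : ℝ := 1 + 2 * (R + h) with hQ
  have hQ0 : 0 < Q := by positivity
  set η' := min η (area Ω / 2) with hη'
  have hη'0 : 0 < η' := lt_min hη (half_pos hadm.area_pos)
  -- With `Δ ≤ 4h` and `b - a ≤ 2r`, the increment bound `Q Δ (b - a)` stays below `η'`; the term `R
  -- / 2` leaves room around `[a, b]` inside the chart.
  set r := min (R / 2) (η' / (Q * (4 * h) * 2)) with hr
  have hr0 : 0 < r := by positivity
  have hrR : r ≤ R / 2 := min_le_left _ _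
  set M := √(1 + (L : ℝ) ^ 2) with hM
  have hM0 : 0 < M := by positivity
  refine ⟨r, hr0, by linarith, (‖D‖ + 1) * Q * (2 * M ^ 3), by positivity, fun a b ha hab hb => ?_⟩
  have ha' : -R ≤ a := by linarith
  have hb' : b ≤ R := by linarith
  have haR : a ∈ Icc (-R) R := ⟨ha', by linarith⟩
  have hbR : b ∈ Icc (-R) R := ⟨by linarith, hb'⟩
  have hrep := H.replacesLower_chordCut hadm.convex ha' hab hb'
  have hcK := isCompact_chordCut hadm.isCompact f a b
  have hvK := convex_chordCut hadm.convex f a b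
  set K := chordCut Ω f a b with hK
  set Δ := f a + f b - 2 * f ((a + b) / 2) with hΔ
  have hΔ0 : 0 ≤ Δ := by
    have h1 := H.convexOn.2 haR hbR (show (0 : ℝ) ≤ 1 / 2 by norm_num) (show (0 : ℝ) ≤ 1 / 2 by norm_num)
      (by norm_num)
    simp only [smul_eq_mul] at h1
    rw [show 1 / 2 * a + 1 / 2 * b = (a + b) / 2 by ring] at h1
    linarith
  have hin : ∀ s ∈ Icc a b, s ∈ Icc (-R) R := fun s hs => ⟨ha'.trans hs.1, hs.2.trans hb'⟩
  have hfconv : ConvexOn ℝ (Icc a b) f := H.convexOn.subset hin (convex_Icc a b)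
  have hdev : ∀ s ∈ Icc a b, |f s - chord f a b s| ≤ Δ := by
    intro s hs
    rw [abs_sub_comm, abs_of_nonneg (sub_nonneg.2 (le_chord H.convexOn haR hbR hab hs))]
    exact chord_sub_le hfconv hab hs
  have hΔ2 : Δ ≤ 4 * h := by
    have h1 := abs_lt.1 (H.abs_lt a haR)
    have h2 := abs_lt.1 (H.abs_lt b hbR)
    have h3 := abs_lt.1 (H.abs_lt ((a + b) / 2) ⟨by linarith, by linarith⟩)
    linarith [h1.2, h2.2, h3.1]
  have hinc : ‖increment Ω K‖ ≤ Q * (Δ * (b - a)) := by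
    refine hrep.norm_increment_le hab.le hadm.isCompact hcK (R := R + h) hdev ?_ ?_ ?_
    · exact fun s hs => (abs_le.2 (hin s hs)).trans (by linarith)
    · exact fun s hs => (H.abs_lt s (hin s hs)).le.trans (by linarith)
    · exact fun s hs => (H.chord_le ha' hab hb' hs).trans (by linarith)
  have hincη : ‖increment Ω K‖ ≤ η' := by
    refine hinc.trans ?_
    have h1 : b - a ≤ 2 * (η' / (Q * (4 * h) * 2)) := by
      have := min_le_right (R / 2) (η' / (Q * (4 * h) * 2))
      linarith
    calc Q * (Δ * (b - a)) ≤ Q * (4 * h * (2 * (η' / (Q * (4 * h) * 2)))) := by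
          gcongr
      _ = _ := by field_simp
  have hareaK : 0 < area K := by
    refine area_pos_of_norm_increment_lt (hincη.trans_lt ?_)
    exact (min_le_right _ _).trans_lt (half_lt_self hadm.area_pos)
  -- The cut set is contained in `Ω`, so its overlap with any disc is no larger, and `χ = 0`
  -- suffices at every boundary point.
  have hlow := hD K hcK hvK (hincη.trans (min_le_left _ _)) (by
    rw [zero_mul, add_zero]
    exact overlap_mono hadm.isCompact inter_subset_left _ _)
  have hslope : |(f b - f a) / (b - a)| ≤ L := by
    rw [abs_div, div_le_iff₀ (abs_pos.2 (by linarith)), ← Real.dist_eq, ← Real.dist_eq]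
    exact H.lipschitz.dist_le_mul b a
  have hup := hrep.perimeter_sub_le (p := fun _ => (f b - f a) / (b - a)) hab.le hadm.isCompact
    hadm.convex hadm.area_pos hcK hvK hareaK H.lipschitz (d := R / 2) (by linarith)
    (fun s hs => H.chord_mem ⟨by linarith [hs.1], by linarith [hs.2]⟩) (chord_left f a b)
    (chord_right f hab) measurable_const (fun _ _ => hslope) (by
      intro s _ σ τ hτ
      have := (mk_mem_chordCut.1 hτ).2
      simp only [chord] at this ⊢
      linarith)
  rw [intervalIntegral.integral_const, smul_eq_mul] at hup
  have harc := arc_sub_chord_ge H.lipschitz hab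
  rw [← hΔ, ← hM] at harc
  have hDle : -(‖D‖ * ‖increment Ω K‖) ≤ D (increment Ω K) :=
    neg_le_of_abs_le (D.le_opNorm _)
  -- Quadratic gain against linear cost in `Δ`; dividing by `Δ` gives the claim.
  have hfin : Δ ^ 2 / (2 * M ^ 3 * (b - a)) ≤ (‖D‖ + 1) * (Q * (Δ * (b - a))) := by
    have : (‖D‖ + 1) * ‖increment Ω K‖ ≤ (‖D‖ + 1) * (Q * (Δ * (b - a))) := by gcongr
    linarith
  have hba : 0 < b - a := by linarith
  rw [div_le_iff₀ (by positivity)] at hfin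
  rcases hΔ0.eq_or_lt with h0 | hpos
  · rw [← h0]; positivity
  · refine le_of_mul_le_mul_left ?_ hpos
    calc Δ * Δ = Δ ^ 2 := by ring
      _ ≤ _ := hfin
      _ = _ := by ring

/-- A convex function with quadratically small second differences is `C^{1,1}`. -/
lemma exists_deriv_lipschitz_of_second_difference {f : ℝ → ℝ} {R C : ℝ} (hR : 0 < R) (hC : 0 ≤ C)
    (hf : ConvexOn ℝ (Icc (-R) R) f)
    (h : ∀ a b, -R ≤ a → a < b → b ≤ R → f a + f b - 2 * f ((a + b) / 2) ≤ C * (b - a) ^ 2) :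
    (∀ x ∈ Ioo (-(R / 3)) (R / 3), DifferentiableAt ℝ f x) ∧
      LipschitzOnWith (8 * C).toNNReal (deriv f) (Ioo (-(R / 3)) (R / 3)) := by
  set p : ℝ → ℝ := fun x => derivWithin f (Ioi x) x with hp
  have hint : ∀ x ∈ Ioo (-(R / 3)) (R / 3), x ∈ interior (Icc (-R) R) := by
    intro x hx
    rw [interior_Icc]
    exact ⟨by linarith [hx.1], by linarith [hx.2]⟩
  have hup : ∀ x ∈ Ioo (-(R / 3)) (R / 3), ∀ y ∈ Icc (-R) R, x < y →
      p x * (y - x) ≤ f y - f x := by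
    intro x hx y hy hxy
    have := hf.rightDeriv_le_slope_of_mem_interior (hint x hx) hy hxy
    rw [slope_def_field, le_div_iff₀ (by linarith)] at this
    exact this
  have hdown : ∀ x ∈ Ioo (-(R / 3)) (R / 3), ∀ y ∈ Icc (-R) R, y < x →
      f x - f y ≤ p x * (x - y) := by
    intro x hx y hy hyx
    have := (hf.slope_le_leftDeriv_of_mem_interior hy (hint x hx) hyx).trans
      (hf.leftDeriv_le_rightDeriv_of_mem_interior (hint x hx))
    rw [slope_def_field, div_le_iff₀ (by linarith)] at this
    exact this
  have hmono : ∀ x ∈ Ioo (-(R / 3)) (R / 3), ∀ y ∈ Ioo (-(R / 3)) (R / 3), x < y → p x ≤ p y :=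
    fun x hx y hy hxy => hf.monotoneOn_rightDeriv (hint x hx) (hint y hy) hxy.le
  -- With `d = y - x`, the increments over `[x - d, x]` and `[y, y + d]` bound the two slopes, and
  -- their difference is the sum of two second differences on intervals of length `2d`. Staying
  -- within a third of `R` keeps `x - d` and `y + d` in range.
  have hlip : ∀ x ∈ Ioo (-(R / 3)) (R / 3), ∀ y ∈ Ioo (-(R / 3)) (R / 3), x < y →
      p y - p x ≤ 8 * C * (y - x) := by
    intro x hx y hy hxy
    have hd : 0 < y - x := by linarith
    have h1 := hdown x hx (x - (y - x)) ⟨by linarith [hx.1, hy.2], by linarith [hx.2]⟩ (by linarith)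
    have h2 := hup y hy (y + (y - x)) ⟨by linarith [hy.1], by linarith [hy.2, hx.1]⟩ (by linarith)
    have h3 := h (x - (y - x)) y (by linarith [hx.1, hy.2]) (by linarith) (by linarith [hy.2])
    have h4 := h x (y + (y - x)) (by linarith [hx.1]) (by linarith) (by linarith [hx.1, hy.2])
    rw [show (x - (y - x) + y) / 2 = x by ring] at h3
    rw [show (x + (y + (y - x))) / 2 = y by ring] at h4
    refine le_of_mul_le_mul_right ?_ hd
    nlinarith
  have hderiv : ∀ x ∈ Ioo (-(R / 3)) (R / 3), HasDerivAt f (p x) x := by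
    intro x hx
    rw [hasDerivAt_iff_isLittleO]
    have hO : (fun y => f y - f x - (y - x) • p x) =O[𝓝 x] fun y => (y - x) ^ 2 := by
      refine Asymptotics.IsBigO.of_bound (8 * C) ?_
      filter_upwards [isOpen_Ioo.mem_nhds hx] with y hy
      rw [Real.norm_eq_abs, Real.norm_eq_abs, abs_of_nonneg (sq_nonneg (y - x)), smul_eq_mul, abs_le]
      have hsub : Ioo (-(R / 3)) (R / 3) ⊆ Icc (-R) R := fun z hz =>
        ⟨by linarith [hz.1], by linarith [hz.2]⟩
      rcases lt_trichotomy x y with hxy | rfl | hxy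
      · have h1 := hup x hx y (hsub hy) hxy
        have h2 := hdown y hy x (hsub hx) hxy
        have h3 := hlip x hx y hy hxy
        constructor <;> nlinarith [sq_nonneg (y - x)]
      · simp
      · have h1 := hdown x hx y (hsub hy) hxy
        have h2 := hup y hy x (hsub hx) hxy
        have h3 := hlip y hy x hx hxy
        constructor <;> nlinarith [sq_nonneg (y - x)]
    refine hO.trans_isLittleO ?_
    have h1 : (fun y : ℝ => y - x) =o[𝓝 x] fun _ => (1 : ℝ) := by
      rw [Asymptotics.isLittleO_one_iff]
      have : Tendsto (fun y : ℝ => y - x) (𝓝 x) (𝓝 (x - x)) := Continuous.tendsto (by fun_prop) x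
      simpa using this
    have h2 := h1.mul_isBigO (Asymptotics.isBigO_refl (fun y : ℝ => y - x) (𝓝 x))
    simpa [sq] using h2
  refine ⟨fun x hx => (hderiv x hx).differentiableAt, LipschitzOnWith.of_dist_le_mul ?_⟩
  intro x hx y hy
  rw [(hderiv x hx).deriv, (hderiv y hy).deriv, Real.dist_eq, Real.dist_eq,
    Real.coe_toNNReal _ (by positivity)]
  rcases lt_trichotomy x y with hxy | rfl | hxy
  · rw [abs_sub_comm, abs_sub_comm x y, abs_of_nonneg (sub_nonneg.2 (hmono x hx y hy hxy)),
      abs_of_nonneg (by linarith)]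
    exact hlip x hx y hy hxy
  · simp
  · rw [abs_of_nonneg (sub_nonneg.2 (hmono y hy x hx hxy)), abs_of_nonneg (by linarith)]
    exact hlip y hy x hx hxy

/-- The lower boundary of a minimizer is of class `C^{1,1}`. -/
lemma IsMinimizer.exists_c11 {Ω : Set Plane} (hΩ : IsMinimizer Ω) {f : ℝ → ℝ}
    {R h : ℝ} {L : ℝ≥0} (H : LowerChart Ω f R h L) :
    ∃ r > 0, r ≤ R ∧ (∀ x ∈ Ioo (-r) r, DifferentiableAt ℝ f x) ∧
      ∃ K : ℝ≥0, LipschitzOnWith K (deriv f) (Ioo (-r) r) := by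
  obtain ⟨r, hr, hrR, C, hC, hsd⟩ := hΩ.exists_second_difference_le H
  obtain ⟨h1, h2⟩ := exists_deriv_lipschitz_of_second_difference hr hC
    (H.mono hr hrR).convexOn hsd
  exact ⟨r / 3, by linarith, by linarith, h1, _, h2⟩

lemma isC11_of_differentiableAt {f : ℝ → ℝ} {r : ℝ} (h1 : ∀ x ∈ Ioo (-r) r, DifferentiableAt ℝ f x)
    {K : ℝ≥0} (h2 : LipschitzOnWith K (deriv f) (Ioo (-r) r)) : IsC11 f r := by
  refine ⟨?_, K, h2⟩
  rw [show (1 : ℕ∞ω) = 0 + 1 from rfl, contDiffOn_succ_iff_deriv_of_isOpen isOpen_Ioo]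
  exact ⟨fun x hx => (h1 x hx).differentiableWithinAt, by simp, contDiffOn_zero.2 h2.continuousOn⟩

/-- The boundary of a minimizer is of class `C^{1,1}`. -/
theorem IsMinimizer.boundaryC11At {Ω : Set Plane} (hΩ : IsMinimizer Ω) {p : Plane}
    (hp : p ∈ frontier Ω) : BoundaryC11At Ω p := by
  obtain ⟨φ, f, R, h, L, hφ, H⟩ := exists_lowerChart hΩ.1.isCompact hΩ.1.convex hΩ.1.area_pos hp
  obtain ⟨r, hr, hrR, h1, K, h2⟩ := (hΩ.preimage φ).exists_c11 H
  exact H.isLocalEpigraphAt hφ hr hrR (isC11_of_differentiableAt h1 h2)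

/-! ### Competitors -/

/-- The fiberwise convex combination of `A` and `B` along vertical lines. -/
def fiberMix (t : ℝ) (A B : Set Plane) : Set Plane :=
  (fun z : Plane × Plane => (!₂[z.1 0, (1 - t) * z.1 1 + t * z.2 1] : Plane)) ''
    ((A ×ˢ B) ∩ {z | z.1 0 = z.2 0})

lemma mk_mem_fiberMix {t : ℝ} {A B : Set Plane} {s τ : ℝ} :
    !₂[s, τ] ∈ fiberMix t A B ↔
      ∃ x y, !₂[s, x] ∈ A ∧ !₂[s, y] ∈ B ∧ (1 - t) * x + t * y = τ := by
  constructor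
  · rintro ⟨⟨x, y⟩, ⟨⟨hx, hy⟩, hxy⟩, h⟩
    have h0 : x 0 = s := by simpa using congrArg (fun z : Plane => z 0) h
    have h1 : (1 - t) * x 1 + t * y 1 = τ := by simpa using congrArg (fun z : Plane => z 1) h
    have hxy : x 0 = y 0 := hxy
    refine ⟨x 1, y 1, ?_, ?_, h1⟩
    · rw [← h0, mk_coords]; exact hx
    · rw [← h0, hxy, mk_coords]; exact hy
  · rintro ⟨x, y, hx, hy, rfl⟩
    exact ⟨(!₂[s, x], !₂[s, y]), ⟨⟨hx, hy⟩, by simp⟩, by simp⟩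

lemma isCompact_fiberMix {A B : Set Plane} (hA : IsCompact A) (hB : IsCompact B) (t : ℝ) :
    IsCompact (fiberMix t A B) := by
  refine ((hA.prod hB).inter_right (isClosed_eq (by fun_prop) (by fun_prop))).image ?_
  exact continuous_mk.comp
    (by fun_prop : Continuous fun z : Plane × Plane => (z.1 0, (1 - t) * z.1 1 + t * z.2 1))

lemma convex_fiberMix {A B : Set Plane} (hA : Convex ℝ A) (hB : Convex ℝ B) (t : ℝ) :
    Convex ℝ (fiberMix t A B) := by
  intro p hp q hq u v hu hv huv
  rw [← mk_coords p] at hp ⊢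
  rw [← mk_coords q] at hq ⊢
  obtain ⟨x, y, hx, hy, h1⟩ := mk_mem_fiberMix.1 hp
  obtain ⟨x', y', hx', hy', h2⟩ := mk_mem_fiberMix.1 hq
  rw [smul_mk, smul_mk, add_mk]
  refine mk_mem_fiberMix.2 ⟨_, _, convex_mix_mem hA hx hx' hu hv huv,
    convex_mix_mem hB hy hy' hu hv huv, ?_⟩
  rw [← h1, ← h2]
  ring

lemma ReplacesLower.fiberMix {Ω K : Set Plane} {a b : ℝ} {f w : ℝ → ℝ}
    (h : ReplacesLower Ω K a b f w) (hΩ : Convex ℝ Ω) {t : ℝ} (ht0 : 0 ≤ t) (ht1 : t ≤ 1) :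
    ReplacesLower Ω (fiberMix t Ω K) a b f (fun s => (1 - t) * f s + t * w s) where
  slices s hs := by
    obtain ⟨g, h1, h2, h3, h4⟩ := h.slices s hs
    have hle : (1 - t) * f s + t * w s ≤ g := by nlinarith
    refine ⟨g, h1, ?_, h3, hle⟩
    ext τ
    rw [mem_slice, mk_mem_fiberMix]
    simp only [← mem_slice, h1, h2]
    constructor
    · rintro ⟨x, y, hx, hy, rfl⟩
      constructor <;> nlinarith [hx.1, hx.2, hy.1, hy.2]
    · intro hτ
      obtain ⟨u, v, hu, hv, huv, h5⟩ := exists_mix hτ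
      -- A point of the mixed slice divides it in some ratio; the points dividing both given slices
      -- in that same ratio mix to it.
      have hmem : ∀ e ≤ g, u * e + v * g ∈ Icc e g := fun e he => by
        obtain rfl : u = 1 - v := by linarith
        constructor <;> nlinarith
      refine ⟨_, _, hmem _ h3, hmem _ h4, ?_⟩
      rw [← h5]; ring
  slice_eq s hs := by
    ext τ
    rw [mem_slice, mk_mem_fiberMix]
    simp only [← mem_slice, h.slice_eq s hs]
    constructor
    · rintro ⟨x, y, hx, hy, rfl⟩
      exact convex_slice hΩ s hx hy (by linarith) ht0 (by ring)
    · intro hτ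
      exact ⟨τ, τ, hτ, hτ, by ring⟩

/-- The tangent line of the graph of `f` at `a`. -/
noncomputable def tangent (f : ℝ → ℝ) (a s : ℝ) : ℝ := f a + deriv f a * (s - a)

lemma tangent_self (f : ℝ → ℝ) (a : ℝ) : tangent f a a = f a := by simp [tangent]

lemma continuous_tangent (f : ℝ → ℝ) (a : ℝ) : Continuous (tangent f a) := by
  unfold tangent; fun_prop

lemma tangent_mix (f : ℝ → ℝ) (a : ℝ) {u v x y : ℝ} (huv : u + v = 1) :
    tangent f a (u * x + v * y) = u * tangent f a x + v * tangent f a y := by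
  obtain rfl : u = 1 - v := by linarith
  simp only [tangent]; ring

/-- The tangent lines of the lower boundary support the convex set. -/
lemma LowerChart.tangent_le {Ω : Set Plane} {f : ℝ → ℝ} {R h : ℝ} {L : ℝ≥0}
    (H : LowerChart Ω f R h L) (hΩ : Convex ℝ Ω) {a : ℝ} (ha : a ∈ Ioo (-R) R)
    (hd : DifferentiableAt ℝ f a) {s t : ℝ} (hst : !₂[s, t] ∈ Ω) : tangent f a s ≤ t := by
  have h1 : HasDerivAt (fun θ : ℝ => f (a + θ * (s - a))) (deriv f a * (1 * (s - a))) 0 := by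
    have h2 : HasDerivAt (fun θ : ℝ => a + θ * (s - a)) (1 * (s - a)) 0 :=
      ((hasDerivAt_id (0 : ℝ)).mul_const (s - a)).const_add a
    refine HasDerivAt.comp (h₂ := f) 0 ?_ h2
    simpa using hd.hasDerivAt
  have h3 := (hasDerivAt_iff_tendsto_slope.1 h1).mono_left
    (nhdsWithin_mono 0 (show Ioi (0 : ℝ) ⊆ {0}ᶜ from fun x hx => (ne_of_gt hx)))
  have h4 : ∀ᶠ θ : ℝ in 𝓝[>] 0, a + θ * (s - a) ∈ Ioo (-R) R := by
    have hc : Tendsto (fun θ : ℝ => a + θ * (s - a)) (𝓝[>] 0) (𝓝 (a + 0 * (s - a))) :=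
      tendsto_nhdsWithin_of_tendsto_nhds (Continuous.tendsto (by fun_prop) 0)
    refine hc.eventually (isOpen_Ioo.mem_nhds ?_)
    simpa using ha
  have h5 : deriv f a * (1 * (s - a)) ≤ t - f a := by
    refine le_of_tendsto h3 ?_
    filter_upwards [h4, Ioc_mem_nhdsGT (zero_lt_one' ℝ)] with θ hθ hθ1
    have hm := convex_mix_mem hΩ (H.chord_mem (Ioo_subset_Icc_self ha)) hst
      (show 0 ≤ 1 - θ by linarith [hθ1.2]) hθ1.1.le (by ring)
    rw [show (1 - θ) * a + θ * s = a + θ * (s - a) by ring] at hm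
    have hle := H.le (Ioo_subset_Icc_self hθ) hm
    rw [slope_def_field, zero_mul, add_zero, sub_zero, div_le_iff₀ hθ1.1]
    linarith
  rw [tangent]
  linarith

/-- Enlarging `Ω` to a convex superset over a strip keeps convexity when nothing is added on the two
bounding lines. -/
lemma convex_union_inter_strip {Ω S : Set Plane} {a b : ℝ} (hΩ : Convex ℝ Ω) (hS : Convex ℝ S)
    (hsub : Ω ⊆ S) (ha : slice S a ⊆ slice Ω a) (hb : slice S b ⊆ slice Ω b) :
    Convex ℝ (Ω ∪ (S ∩ {x | a ≤ x 0 ∧ x 0 ≤ b})) := by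
  have hall : Ω ∪ (S ∩ {x | a ≤ x 0 ∧ x 0 ≤ b}) ⊆ S := union_subset hsub inter_subset_left
  -- A segment from a point of `S` to a point of `Ω` that crosses the line of abscissa `e` is in `Ω`
  -- at the crossing, and hence on the rest of its way.
  have key : ∀ e : ℝ, slice S e ⊆ slice Ω e → ∀ s t s' t', !₂[s, t] ∈ S → !₂[s', t'] ∈ Ω →
      ∀ u v : ℝ, 0 ≤ u → 0 ≤ v → u + v = 1 →
      e ∈ Ico s (u * s + v * s') ∨ e ∈ Ioc (u * s + v * s') s →
      !₂[u * s + v * s', u * t + v * t'] ∈ Ω := by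
    intro e he s t s' t' hst hst' u v hu hv huv hcase
    obtain rfl : u = 1 - v := by linarith
    have hne : s' - s ≠ 0 := by
      intro h0
      obtain rfl : s' = s := by linarith
      rcases hcase with h | h
      · linarith [h.1, h.2]
      · linarith [h.1, h.2]
    obtain ⟨θ, hθ0, hθv, hθ⟩ : ∃ θ, 0 ≤ θ ∧ θ < v ∧ s + θ * (s' - s) = e := by
      refine ⟨(e - s) / (s' - s), ?_, ?_, by field_simp; ring⟩
      · rcases hcase with h | h
        · have : 0 < s' - s := by
            by_contra! hle
            nlinarith [h.1, h.2]
          exact div_nonneg (by linarith [h.1]) this.le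
        · have : s' - s < 0 := by
            by_contra! hle
            nlinarith [h.1, h.2]
          exact div_nonneg_of_nonpos (by linarith [h.2]) this.le
      · rcases hcase with h | h
        · have : 0 < s' - s := by
            by_contra! hle
            nlinarith [h.1, h.2]
          rw [div_lt_iff₀ this]
          linarith [h.2]
        · have : s' - s < 0 := by
            by_contra! hle
            nlinarith [h.1, h.2]
          rw [div_lt_iff_of_neg this]
          linarith [h.1]
    have h1 := convex_mix_mem hS hst (hsub hst') (show 0 ≤ 1 - θ by linarith) hθ0 (by ring)
    rw [show (1 - θ) * s + θ * s' = e by linarith] at h1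
    have h2 : !₂[e, (1 - θ) * t + θ * t'] ∈ Ω := he h1
    have hθ1 : 0 < 1 - θ := by linarith
    have h3 := convex_mix_mem hΩ h2 hst' (a := (1 - v) / (1 - θ)) (b := (v - θ) / (1 - θ))
      (div_nonneg hu hθ1.le) (div_nonneg (by linarith) hθ1.le) (by field_simp; ring)
    have e1 : (1 - v) / (1 - θ) * e + (v - θ) / (1 - θ) * s' = (1 - v) * s + v * s' := by
      rw [← hθ]; field_simp; ring
    have e2 : (1 - v) / (1 - θ) * ((1 - θ) * t + θ * t') + (v - θ) / (1 - θ) * t' =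
        (1 - v) * t + v * t' := by
      field_simp; ring
    rwa [e1, e2] at h3
  intro p hp q hq u v hu hv huv
  have hpS := hall hp
  have hqS := hall hq
  rw [← mk_coords p] at hp hpS ⊢
  rw [← mk_coords q] at hq hqS ⊢
  rw [smul_mk, smul_mk, add_mk]
  generalize p 0 = s at *
  generalize p 1 = t at *
  generalize q 0 = s' at *
  generalize q 1 = t' at *
  have hz := convex_mix_mem hS hpS hqS hu hv huv
  by_cases hin : a ≤ u * s + v * s' ∧ u * s + v * s' ≤ b
  · exact Or.inr ⟨hz, by simpa using hin⟩
  left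
  have hmem : ∀ s t, !₂[s, t] ∈ Ω ∪ (S ∩ {x | a ≤ x 0 ∧ x 0 ≤ b}) → (s < a ∨ b < s) →
      !₂[s, t] ∈ Ω := by
    rintro s t (h | h) hs
    · exact h
    · have h' : a ≤ s ∧ s ≤ b := by simpa using h.2
      rcases hs with hs | hs <;> linarith [h'.1, h'.2]
  have hswap : ∀ x y : ℝ, v * x + u * y = u * y + v * x := fun x y => add_comm _ _
  rw [not_and_or, not_le, not_le] at hin
  obtain rfl : u = 1 - v := by linarith
  rcases hin with hlt | hlt
  · rcases lt_or_ge s a with h1 | h1 <;> rcases lt_or_ge s' a with h2 | h2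
    · exact convex_mix_mem hΩ (hmem _ _ hp (Or.inl h1)) (hmem _ _ hq (Or.inl h2)) hu hv huv
    · have := key a ha s' t' s t hqS (hmem _ _ hp (Or.inl h1)) v (1 - v) hv hu (by ring)
        (Or.inr ⟨by linarith, h2⟩)
      rwa [hswap, hswap] at this
    · exact key a ha s t s' t' hpS (hmem _ _ hq (Or.inl h2)) (1 - v) v hu hv huv (Or.inr ⟨hlt, h1⟩)
    · nlinarith
  · rcases lt_or_ge b s with h1 | h1 <;> rcases lt_or_ge b s' with h2 | h2
    · exact convex_mix_mem hΩ (hmem _ _ hp (Or.inr h1)) (hmem _ _ hq (Or.inr h2)) hu hv huv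
    · have := key b hb s' t' s t hqS (hmem _ _ hp (Or.inr h1)) v (1 - v) hv hu (by ring)
        (Or.inl ⟨h2, by linarith⟩)
      rwa [hswap, hswap] at this
    · exact key b hb s t s' t' hpS (hmem _ _ hq (Or.inr h2)) (1 - v) v hu hv huv (Or.inl ⟨h1, hlt⟩)
    · nlinarith

/-- The maximum of the tangents at `a` and `b`. -/
noncomputable def tangentMax (f : ℝ → ℝ) (a b s : ℝ) : ℝ := max (tangent f a s) (tangent f b s)

lemma continuous_tangentMax (f : ℝ → ℝ) (a b : ℝ) : Continuous (tangentMax f a b) :=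
  (continuous_tangent f a).max (continuous_tangent f b)

/-- The points of `Ω` moved down by at most `A` that lie above the tangents at `a` and `b`. -/
def loweredAboveTangents (Ω : Set Plane) (f : ℝ → ℝ) (a b A : ℝ) : Set Plane :=
  (fun z : Plane × ℝ => (!₂[z.1 0, z.1 1 - z.2] : Plane)) '' (Ω ×ˢ Icc 0 A) ∩
    {x | tangentMax f a b (x 0) ≤ x 1}

lemma mk_mem_loweredAboveTangents {Ω : Set Plane} {f : ℝ → ℝ} {a b A s t : ℝ} :
    !₂[s, t] ∈ loweredAboveTangents Ω f a b A ↔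
      (∃ u ∈ Icc 0 A, !₂[s, t + u] ∈ Ω) ∧ tangentMax f a b s ≤ t := by
  have : !₂[s, t] ∈ (fun z : Plane × ℝ => (!₂[z.1 0, z.1 1 - z.2] : Plane)) '' (Ω ×ˢ Icc 0 A) ↔
      ∃ u ∈ Icc 0 A, !₂[s, t + u] ∈ Ω := by
    constructor
    · rintro ⟨⟨x, u⟩, ⟨hx, hu⟩, h⟩
      have h0 : x 0 = s := by simpa using congrArg (fun z : Plane => z 0) h
      have h1 : x 1 - u = t := by simpa using congrArg (fun z : Plane => z 1) h
      refine ⟨u, hu, ?_⟩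
      rw [← h0, ← h1, sub_add_cancel, mk_coords]
      exact hx
    · rintro ⟨u, hu, hx⟩
      exact ⟨(!₂[s, t + u], u), ⟨hx, hu⟩, by simp⟩
  rw [loweredAboveTangents, mem_inter_iff, this]
  simp

lemma isCompact_loweredAboveTangents {Ω : Set Plane} (hΩ : IsCompact Ω) (f : ℝ → ℝ) (a b A : ℝ) :
    IsCompact (loweredAboveTangents Ω f a b A) := by
  have := continuous_tangentMax f a b
  refine IsCompact.inter_right ((hΩ.prod isCompact_Icc).image ?_)
    (isClosed_le (by fun_prop) (by fun_prop))
  exact continuous_mk.comp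
    (by fun_prop : Continuous fun z : Plane × ℝ => (z.1 0, z.1 1 - z.2))

lemma convex_loweredAboveTangents {Ω : Set Plane} (hΩ : Convex ℝ Ω) (f : ℝ → ℝ) (a b A : ℝ) :
    Convex ℝ (loweredAboveTangents Ω f a b A) := by
  intro p hp q hq u v hu hv huv
  rw [← mk_coords p] at hp ⊢
  rw [← mk_coords q] at hq ⊢
  obtain ⟨⟨x, hx, hx'⟩, h1⟩ := mk_mem_loweredAboveTangents.1 hp
  obtain ⟨⟨y, hy, hy'⟩, h2⟩ := mk_mem_loweredAboveTangents.1 hq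
  rw [smul_mk, smul_mk, add_mk]
  refine mk_mem_loweredAboveTangents.2 ⟨⟨_, convex_Icc 0 A hx hy hu hv huv, ?_⟩, ?_⟩
  · have := convex_mix_mem hΩ hx' hy' hu hv huv
    rw [smul_eq_mul, smul_eq_mul,
      show u * p 1 + v * q 1 + (u * x + v * y) = u * (p 1 + x) + v * (q 1 + y) by ring]
    exact this
  · rw [tangentMax, max_le_iff] at h1 h2 ⊢
    rw [tangent_mix _ _ huv, tangent_mix _ _ huv]
    constructor
    · exact add_le_add (mul_le_mul_of_nonneg_left h1.1 hu) (mul_le_mul_of_nonneg_left h2.1 hv)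
    · exact add_le_add (mul_le_mul_of_nonneg_left h1.2 hu) (mul_le_mul_of_nonneg_left h2.2 hv)

/-- `Ω` enlarged by the region between the graph of `f` over `[a, b]` and the tangents at the
end points. -/
def tangentCap (Ω : Set Plane) (f : ℝ → ℝ) (a b A : ℝ) : Set Plane :=
  Ω ∪ (loweredAboveTangents Ω f a b A ∩ {x | a ≤ x 0 ∧ x 0 ≤ b})

lemma isCompact_tangentCap {Ω : Set Plane} (hΩ : IsCompact Ω) (f : ℝ → ℝ) (a b A : ℝ) :
    IsCompact (tangentCap Ω f a b A) := by
  refine hΩ.union ((isCompact_loweredAboveTangents hΩ f a b A).inter_right ?_)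
  exact isClosed_Icc.preimage (by fun_prop : Continuous fun x : Plane => x 0)

lemma LowerChart.tangentMax_le {Ω : Set Plane} {f : ℝ → ℝ} {R h : ℝ} {L : ℝ≥0}
    (H : LowerChart Ω f R h L) (hΩ : Convex ℝ Ω) {a b : ℝ} (ha : a ∈ Ioo (-R) R)
    (hb : b ∈ Ioo (-R) R) (hda : DifferentiableAt ℝ f a) (hdb : DifferentiableAt ℝ f b) {s t : ℝ}
    (hst : !₂[s, t] ∈ Ω) : tangentMax f a b s ≤ t :=
  max_le (H.tangent_le hΩ ha hda hst) (H.tangent_le hΩ hb hdb hst)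

lemma LowerChart.tangentMax_left {Ω : Set Plane} {f : ℝ → ℝ} {R h : ℝ} {L : ℝ≥0}
    (H : LowerChart Ω f R h L) (hΩ : Convex ℝ Ω) {a b : ℝ} (ha : a ∈ Ioo (-R) R)
    (hb : b ∈ Ioo (-R) R) (hdb : DifferentiableAt ℝ f b) : tangentMax f a b a = f a := by
  rw [tangentMax, tangent_self]
  exact max_eq_left (H.tangent_le hΩ hb hdb (H.chord_mem (Ioo_subset_Icc_self ha)))

lemma LowerChart.tangentMax_right {Ω : Set Plane} {f : ℝ → ℝ} {R h : ℝ} {L : ℝ≥0}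
    (H : LowerChart Ω f R h L) (hΩ : Convex ℝ Ω) {a b : ℝ} (ha : a ∈ Ioo (-R) R)
    (hb : b ∈ Ioo (-R) R) (hda : DifferentiableAt ℝ f a) : tangentMax f a b b = f b := by
  rw [tangentMax, tangent_self]
  exact max_eq_right (H.tangent_le hΩ ha hda (H.chord_mem (Ioo_subset_Icc_self hb)))

/-- Lowering `Ω` by up to `A` before cutting with the tangents lets each slice over `[a, b]` reach
down to `tangentMax` while its upper end stays put. At `a` and `b` the larger tangent meets the
graph, so the strip lemma gives convexity. -/
lemma LowerChart.tangentCap_spec {Ω : Set Plane} {f : ℝ → ℝ} {R h : ℝ} {L : ℝ≥0}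
    (H : LowerChart Ω f R h L) (hΩ : Convex ℝ Ω) {a b A : ℝ} (ha : a ∈ Ioo (-R) R)
    (hb : b ∈ Ioo (-R) R) (hda : DifferentiableAt ℝ f a)
    (hdb : DifferentiableAt ℝ f b) (hA : ∀ s ∈ Icc a b, f s - tangentMax f a b s ≤ A) (hA0 : 0 ≤ A) :
    Convex ℝ (tangentCap Ω f a b A) ∧
      ReplacesLower Ω (tangentCap Ω f a b A) a b f (tangentMax f a b) ∧
      ∀ s t, !₂[s, t] ∈ tangentCap Ω f a b A → tangentMax f a b s ≤ t := by
  have hTle : ∀ s t, !₂[s, t] ∈ Ω → tangentMax f a b s ≤ t := fun s t hst =>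
    H.tangentMax_le hΩ ha hb hda hdb hst
  have hslice : ∀ s ∈ Icc (-R) R, f s - tangentMax f a b s ≤ A → ∃ g, slice Ω s = Icc (f s) g ∧
      f s ≤ g ∧ slice (loweredAboveTangents Ω f a b A) s = Icc (tangentMax f a b s) g := by
    intro s hsR hAs
    obtain ⟨g, hg, hsl⟩ := H.slices s hsR
    have hfg : f s ≤ g := ((le_abs_self _).trans (H.abs_lt s hsR).le).trans hg
    refine ⟨g, hsl, hfg, ?_⟩
    ext t
    rw [mem_slice, mk_mem_loweredAboveTangents]
    simp only [← mem_slice, hsl]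
    constructor
    · rintro ⟨⟨u, hu, hut⟩, ht⟩
      exact ⟨ht, by linarith [hut.2, hu.1]⟩
    · rintro ⟨h1, h2⟩
      -- The smallest upward shift that brings the point back into `Ω`.
      refine ⟨⟨max 0 (f s - t), ⟨le_max_left _ _, max_le hA0 (by linarith)⟩, ?_, ?_⟩, h1⟩
      · linarith [le_max_right 0 (f s - t)]
      · rcases max_cases 0 (f s - t) with ⟨h3, -⟩ | ⟨h3, -⟩ <;> rw [h3] <;> linarith
  have hsub : Ω ⊆ loweredAboveTangents Ω f a b A := by
    intro x hx
    rw [← mk_coords x] at hx ⊢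
    exact mk_mem_loweredAboveTangents.2 ⟨⟨0, ⟨le_rfl, hA0⟩, by rwa [add_zero]⟩, hTle _ _ hx⟩
  have hTa := H.tangentMax_left hΩ ha hb hdb
  have hTb := H.tangentMax_right hΩ ha hb hda
  refine ⟨?_, ⟨?_, ?_⟩, ?_⟩
  · refine convex_union_inter_strip hΩ (convex_loweredAboveTangents hΩ f a b A) hsub ?_ ?_
    · obtain ⟨g, h1, -, h2⟩ := hslice a (Ioo_subset_Icc_self ha) (by rw [hTa, sub_self]; exact hA0)
      rw [h1, h2, hTa]
    · obtain ⟨g, h1, -, h2⟩ := hslice b (Ioo_subset_Icc_self hb) (by rw [hTb, sub_self]; exact hA0)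
      rw [h1, h2, hTb]
  · intro s hs
    have hsR : s ∈ Icc (-R) R := ⟨ha.1.le.trans hs.1, hs.2.trans hb.2.le⟩
    obtain ⟨g, h1, h3, h2⟩ := hslice s hsR (hA s hs)
    have hTs := hTle s (f s) (H.chord_mem hsR)
    refine ⟨g, h1, ?_, h3, hTs.trans h3⟩
    rw [← h2]
    ext t
    simp only [mem_slice, tangentCap]
    constructor
    · rintro (h | h)
      · exact hsub h
      · exact h.1
    · intro h
      exact Or.inr ⟨h, by simpa using hs⟩
  · intro s hs
    ext t
    simp only [mem_slice, tangentCap]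
    constructor
    · rintro (h | h)
      · exact h
      · exact absurd (by simpa using h.2) hs
    · exact Or.inl
  · rintro s t (h | h)
    · exact hTle s t h
    · exact (mk_mem_loweredAboveTangents.1 h.1).2

/-! ### The first variation -/

/-- Away from the barycentric circle, small perturbations are on one side of the circle. -/
lemma exists_overlap_le {Ω : Set Plane} (hΩ : IsCompact Ω) (hΩa : 0 < area Ω)
    (h0 : (0 : Plane) ∉ barycentricCircle Ω) :
    ∃ χ : ℝ, ∃ δ > 0, ∃ η > 0, ∀ (K : Set Plane) (a b : ℝ) (f w : ℝ → ℝ), IsCompact K →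
      ReplacesLower Ω K a b f w → (∀ s ∈ Icc a b, ∀ t ∈ [[f s, w s]], ‖(!₂[s, t] : Plane)‖ < δ) →
      ‖increment Ω K‖ ≤ η →
      overlap K (barycentre K) (discRadius K) ≤
        overlap Ω (barycentre K) (discRadius K) + χ * (area K - area Ω) := by
  set c := barycentre Ω with hc
  set r := discRadius Ω with hr
  have hiff : ∀ {K : Set Plane} {a b δ : ℝ} {f w : ℝ → ℝ}, ReplacesLower Ω K a b f w →
      (∀ s ∈ Icc a b, ∀ t ∈ [[f s, w s]], ‖(!₂[s, t] : Plane)‖ < δ) → ∀ x : Plane, δ ≤ ‖x‖ →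
      (x ∈ K ↔ x ∈ Ω) := by
    intro K a b δ f w h hδ x hx
    rw [← mk_coords x] at hx ⊢
    exact h.mem_iff fun hs ht => absurd (hδ _ hs _ ht) (not_lt.2 hx)
  have hdist : ∀ x c' : Plane, dist c' c < |‖c‖ - r| / 3 → ‖x‖ < |‖c‖ - r| / 3 →
      |dist x c' - ‖c‖| < 2 * (|‖c‖ - r| / 3) := by
    intro x c' h1 h2
    have h3 := dist_dist_dist_le x c' (0 : Plane) c
    rw [dist_zero_left, Real.dist_eq, dist_zero_right] at h3
    linarith
  have hne : ‖c‖ ≠ r := by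
    intro h
    refine h0 ?_
    rw [barycentricCircle, mem_sphere, dist_zero_left]
    exact h
  -- A third of the distance from the origin to the circle for each of three errors: the position of
  -- the point, the motion of the centre and the change of radius.
  have hδ : 0 < |‖c‖ - r| / 3 := div_pos (abs_pos.2 (sub_ne_zero.2 hne)) (by norm_num)
  obtain ⟨η, hη, hclose⟩ := exists_dist_disc_lt hΩa hδ
  rcases lt_or_gt_of_ne hne with hlt | hgt
  -- Origin inside the disc: the whole change lies in the disc of `K`, so the overlap changes by the
  -- area change.
  · refine ⟨1, _, hδ, η, hη, fun K a b f w hK hrep hreg hinc => ?_⟩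
    obtain ⟨h1, h2⟩ := hclose K hinc
    rw [one_mul]
    refine (overlap_sub_eq_of_mem_iff hK hΩ fun x hx => hiff hrep hreg x ?_).le
    by_contra! hx'
    refine hx ?_
    have h3 := hdist x (barycentre K) h1 hx'
    rw [abs_of_neg (by linarith : ‖c‖ - r < 0)] at h2 h3
    rw [mem_closedBall]
    have h4 := abs_lt.1 h2
    have h5 := abs_lt.1 h3
    linarith [h4.1, h5.2]
  -- Origin outside: the change misses the disc of `K`, so the overlap is unchanged.
  · refine ⟨0, _, hδ, η, hη, fun K a b f w hK hrep hreg hinc => ?_⟩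
    obtain ⟨h1, h2⟩ := hclose K hinc
    rw [zero_mul, add_zero]
    refine (overlap_eq_of_mem_iff fun x hx => hiff hrep hreg x ?_).le
    by_contra! hx'
    have h3 := hdist x (barycentre K) h1 hx'
    rw [abs_of_pos (by linarith : 0 < ‖c‖ - r)] at h2 h3
    rw [mem_closedBall] at hx
    have h4 := abs_lt.1 h2
    have h5 := abs_lt.1 h3
    linarith [h4.2, h5.1]

lemma sqrt_one_add_sq_le (x y : ℝ) :
    √(1 + (x + y) ^ 2) ≤ √(1 + x ^ 2) + x / √(1 + x ^ 2) * y + y ^ 2 / 2 := by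
  set S := √(1 + x ^ 2) with hS
  have hS2 : S ^ 2 = 1 + x ^ 2 := Real.sq_sqrt (by positivity)
  have hS1 : 1 ≤ S := by rw [hS, Real.one_le_sqrt]; nlinarith [sq_nonneg x]
  have hT2 : √(1 + (x + y) ^ 2) ^ 2 = 1 + (x + y) ^ 2 := Real.sq_sqrt (by positivity)
  set T := √(1 + (x + y) ^ 2) with hT
  have h1 : T * (2 * S) ≤ (S + x / S * y + y ^ 2 / 2) * (2 * S) := by
    have h2 : (S + x / S * y + y ^ 2 / 2) * (2 * S) = 2 * S ^ 2 + 2 * x * y + y ^ 2 * S := by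
      field_simp
    rw [h2]
    nlinarith [sq_nonneg (T - S), mul_le_mul_of_nonneg_left hS1 (sq_nonneg y)]
  exact le_of_mul_le_mul_right h1 (by linarith)

lemma nonneg_of_forall_pos_exists {x C : ℝ}
    (h : ∀ e > 0, ∃ M, ∃ t₀ > 0, ∀ t, 0 < t → t ≤ t₀ → 0 ≤ x + e * C + t * M) : 0 ≤ x := by
  have h1 : ∀ e > 0, 0 ≤ x + e * C := by
    intro e he
    obtain ⟨M, t₀, ht₀, hM⟩ := h e he
    have hc : Tendsto (fun t : ℝ => x + e * C + t * M) (𝓝[>] 0) (𝓝 (x + e * C + 0 * M)) :=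
      tendsto_nhdsWithin_of_tendsto_nhds (Continuous.tendsto (by fun_prop) 0)
    rw [zero_mul, add_zero] at hc
    refine ge_of_tendsto hc ?_
    filter_upwards [Ioc_mem_nhdsGT ht₀] with t ht
    exact hM t ht.1 ht.2
  have hc : Tendsto (fun e : ℝ => x + e * C) (𝓝[>] 0) (𝓝 (x + 0 * C)) :=
    tendsto_nhdsWithin_of_tendsto_nhds (Continuous.tendsto (by fun_prop) 0)
  rw [zero_mul, add_zero] at hc
  refine ge_of_tendsto hc ?_
  filter_upwards [self_mem_nhdsWithin] with e he
  exact h1 e he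

lemma abs_mix_le {t x y C : ℝ} (ht0 : 0 ≤ t) (ht1 : t ≤ 1) (hx : |x| ≤ C) (hy : |y| ≤ C) :
    |(1 - t) * x + t * y| ≤ C := by
  have h1 := abs_le.1 hx
  have h2 := abs_le.1 hy
  have h3 : 0 ≤ 1 - t := by linarith
  rw [abs_le]
  constructor <;> nlinarith

lemma intervalIntegrable_of_abs_le_on {a b : ℝ} (hab : a ≤ b) {g : ℝ → ℝ}
    (hg : Measurable g) {C : ℝ} (hC : ∀ x ∈ Icc a b, |g x| ≤ C) :
    IntervalIntegrable g volume a b := by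
  rw [intervalIntegrable_iff_integrableOn_Icc_of_le hab]
  refine Measure.integrableOn_of_bounded (by simp) hg.aestronglyMeasurable (M := C) ?_
  exact (ae_restrict_iff' measurableSet_Icc).2 (Eventually.of_forall hC)

lemma abs_div_sqrt_le (x : ℝ) : |x / √(1 + x ^ 2)| ≤ 1 := by
  rw [abs_div, div_le_one (by positivity), abs_of_nonneg (Real.sqrt_nonneg _)]
  exact Real.abs_le_sqrt (by linarith)

/-- The first variation inequality at a boundary point off the barycentric circle. -/
lemma IsMinimizer.first_variation {Ω : Set Plane} (hΩ : IsMinimizer Ω) {f : ℝ → ℝ}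
    {R h : ℝ} {L : ℝ≥0} (H : LowerChart Ω f R h L) (h0 : (0 : Plane) ∉ barycentricCircle Ω) :
    ∃ δ > 0, ∃ α β γ : ℝ, ∀ (K : Set Plane) (a b : ℝ) (w p : ℝ → ℝ), a < b →
      a ∈ Ioo (-R) R → b ∈ Ioo (-R) R → (∀ s ∈ Icc a b, DifferentiableAt ℝ f s) →
      IsCompact K → Convex ℝ K → ReplacesLower Ω K a b f w → Continuous w → w a = f a →
      w b = f b → (∀ s ∈ Icc a b, ∀ t ∈ [[f s, w s]], ‖(!₂[s, t] : Plane)‖ < δ) →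
      Measurable p → (∀ s ∈ Icc a b, |p s| ≤ L) →
      (∀ s ∈ Icc a b, ∀ σ τ, !₂[σ, τ] ∈ K → w s + p s * (σ - s) ≤ τ) →
      0 ≤ ∫ s in a..b, (deriv f s / √(1 + deriv f s ^ 2) * (p s - deriv f s) +
        (w s - f s) * (α + β * s + γ * f s)) := by
  have hadm := hΩ.1
  obtain ⟨χ, δ, hδ, η₁, hη₁, hov⟩ := exists_overlap_le hadm.isCompact hadm.area_pos h0
  obtain ⟨D, hD⟩ := hΩ.exists_linear_lower_bound χ
  refine ⟨δ, hδ, D (1, 0), D (0, !₂[1, 0]), D (0, !₂[0, 1]), ?_⟩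
  intro K a b w p hab ha hb hdf hKc hKv hrep hw hwa hwb hreg hp hpL hsupp
  set α := D (1, 0)
  set β := D (0, !₂[1, 0])
  set γ := D (0, !₂[0, 1])
  have hin : ∀ s ∈ Icc a b, s ∈ Ioo (-R) R := fun s hs => ⟨ha.1.trans_le hs.1, hs.2.trans_lt hb.2⟩
  have hfc := H.lipschitz.continuous
  have hfm := measurable_deriv f
  obtain ⟨W, hW⟩ := (isCompact_Icc (a := a) (b := b)).exists_bound_of_continuousOn
    (f := fun s => |s| + |f s| + |w s|) (by fun_prop)
  have hW' : ∀ s ∈ Icc a b, |s| + |f s| + |w s| ≤ W := fun s hs => (le_abs_self _).trans (hW s hs)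
  have hW0 : 0 ≤ W := by
    have := hW' a ⟨le_rfl, hab.le⟩
    have : 0 ≤ |a| + |f a| + |w a| := by positivity
    linarith
  have hWs : ∀ s ∈ Icc a b, |s| ≤ W := fun s hs => by
    linarith [hW' s hs, abs_nonneg (f s), abs_nonneg (w s)]
  have hWf : ∀ s ∈ Icc a b, |f s| ≤ W := fun s hs => by
    linarith [hW' s hs, abs_nonneg s, abs_nonneg (w s)]
  have hWw : ∀ s ∈ Icc a b, |w s| ≤ W := fun s hs => by
    linarith [hW' s hs, abs_nonneg (f s), abs_nonneg s]
  set C := (1 + 2 * W) * (2 * W * (b - a)) with hC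
  set J : ℝ := ∫ s in a..b, deriv f s / √(1 + deriv f s ^ 2) * (p s - deriv f s) with hJ
  set A : ℝ := ∫ s in a..b, (w s - f s) * (α + β * s + γ * f s) with hA
  set B : ℝ := ∫ s in a..b, γ / 2 * (w s - f s) ^ 2 with hB
  have hpf : ∀ s ∈ Icc a b, |p s - deriv f s| ≤ 2 * L := fun s hs => by
    have h1 := abs_le.1 (hpL s hs)
    have h2 := abs_le.1 (abs_deriv_le H.lipschitz s)
    rw [abs_le]; constructor <;> linarith
  have hJi : IntervalIntegrable
      (fun s => deriv f s / √(1 + deriv f s ^ 2) * (p s - deriv f s)) volume a b := by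
    refine intervalIntegrable_of_abs_le_on hab.le (by fun_prop) (C := 1 * (2 * L)) fun s hs => ?_
    rw [abs_mul]
    exact mul_le_mul (abs_div_sqrt_le _) (hpf s hs) (abs_nonneg _) zero_le_one
  have hAi : IntervalIntegrable (fun s => (w s - f s) * (α + β * s + γ * f s)) volume a b :=
    Continuous.intervalIntegrable (by fun_prop) _ _
  rw [intervalIntegral.integral_add hJi hAi]
  change 0 ≤ J + A
  refine nonneg_of_forall_pos_exists (C := C) fun e he => ?_
  obtain ⟨η₂, hη₂, hD⟩ := hD e he
  set η := min (min η₁ η₂) (area Ω / 2) with hη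
  have hη0 : 0 < η := lt_min (lt_min hη₁ hη₂) (half_pos hadm.area_pos)
  have hC0 : 0 ≤ C := by
    have : 0 ≤ b - a := by linarith
    positivity
  -- The coefficient collects the two second-order terms: `B` from area and moment, and the other
  -- from the length. The bound on `t` makes the increment, at most `tC`, smaller than `η`.
  refine ⟨B + (b - a) * (2 * (L : ℝ) ^ 2), min 1 (η / (C + 1)), by positivity, fun t ht htle => ?_⟩
  have ht1 : t ≤ 1 := htle.trans (min_le_left _ _)
  have hrep' := hrep.fiberMix hadm.convex ht.le ht1
  have hKt := isCompact_fiberMix hadm.isCompact hKc t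
  have hKtv := convex_fiberMix hadm.convex hKv t
  set Kt := fiberMix t Ω K with hKtdef
  have hinc : ‖increment Ω Kt‖ ≤ t * C := by
    have := hrep'.norm_increment_le hab.le hadm.isCompact hKt (κ := t * (2 * W)) (R := W) (fun s hs => by
      rw [show f s - ((1 - t) * f s + t * w s) = t * (f s - w s) by ring, abs_mul, abs_of_pos ht]
      refine mul_le_mul_of_nonneg_left ?_ ht.le
      have h1 := abs_le.1 (hWf s hs)
      have h2 := abs_le.1 (hWw s hs)
      rw [abs_le]; constructor <;> linarith) hWs hWf
      fun s hs => abs_mix_le ht.le ht1 (hWf s hs) (hWw s hs)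
    refine this.trans_eq ?_
    rw [hC]; ring
  have hincη : ‖increment Ω Kt‖ ≤ η := by
    refine hinc.trans ?_
    have h1 : t ≤ η / (C + 1) := htle.trans (min_le_right _ _)
    rw [le_div_iff₀ (by positivity)] at h1
    linarith
  have hKta : 0 < area Kt := area_pos_of_norm_increment_lt
    ((hincη.trans (min_le_right _ _)).trans_lt (half_lt_self hadm.area_pos))
  have hlow := hD Kt hKt hKtv (hincη.trans ((min_le_left _ _).trans (min_le_right _ _)))
    (hov Kt a b f _ hKt hrep' (fun s hs τ hτ => hreg s hs τ (by
      refine (convex_uIcc (f s) (w s)).ordConnected.uIcc_subset left_mem_uIcc ?_ hτ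
      exact (convex_uIcc (f s) (w s)) left_mem_uIcc right_mem_uIcc (by linarith) ht.le (by ring)))
      (hincη.trans ((min_le_left _ _).trans (min_le_left _ _))))
  rw [hrep'.apply_increment hab.le hadm.isCompact hKt D] at hlow
  obtain ⟨d, hd, hda, hdb⟩ : ∃ d > 0, -R ≤ a - d ∧ b + d ≤ R :=
    ⟨min (a + R) (R - b), lt_min (by linarith [ha.1]) (by linarith [hb.2]),
      by linarith [min_le_left (a + R) (R - b)], by linarith [min_le_right (a + R) (R - b)]⟩
  have hup := hrep'.perimeter_sub_le (p := fun s => (1 - t) * deriv f s + t * p s) hab.le hadm.isCompact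
    hadm.convex hadm.area_pos hKt hKtv hKta H.lipschitz hd
    (fun s hs => H.chord_mem ⟨hda.trans hs.1, hs.2.trans hdb⟩) (by rw [hwa]; ring) (by rw [hwb]; ring)
    -- Supporting lines mix fibrewise: the tangent of `f` supports `Ω`, the line of slope `p`
    -- supports `K`, and the mixed line supports the mixture.
    (by fun_prop) (fun s hs => abs_mix_le ht.le ht1 (abs_deriv_le H.lipschitz s) (hpL s hs)) (by
      intro s hs σ τ hτ
      obtain ⟨x, y, hx, hy, rfl⟩ := mk_mem_fiberMix.1 hτ
      have h1 := H.tangent_le hadm.convex (hin s hs) (hdf s hs) hx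
      have h2 := hsupp s hs σ y hy
      rw [tangent] at h1
      have h3 := mul_le_mul_of_nonneg_left h1 (show 0 ≤ 1 - t by linarith)
      have h4 := mul_le_mul_of_nonneg_left h2 ht.le
      linarith)
  -- The integrand is quadratic in `w - f`, so the expansion in `t` is exact.
  have hDeq : (∫ s in a..b, (f s - ((1 - t) * f s + t * w s)) *
      (α + β * s + γ * ((f s + ((1 - t) * f s + t * w s)) / 2))) = -(t * A) - t ^ 2 * B := by
    rw [hA, hB, ← intervalIntegral.integral_const_mul, ← intervalIntegral.integral_const_mul,
      ← intervalIntegral.integral_neg, ← intervalIntegral.integral_sub]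
    · refine intervalIntegral.integral_congr fun s _ => ?_
      ring
    · exact Continuous.intervalIntegrable (by fun_prop) _ _
    · exact Continuous.intervalIntegrable (by fun_prop) _ _
  have hPle : (∫ s in a..b, √(1 + ((1 - t) * deriv f s + t * p s) ^ 2)) ≤
      (∫ s in a..b, √(1 + deriv f s ^ 2)) + t * J + (b - a) * (t ^ 2 * (2 * (L : ℝ) ^ 2)) := by
    rw [hJ, ← intervalIntegral.integral_const_mul,
      ← intervalIntegral.integral_add (intervalIntegrable_arc H.lipschitz a b) (hJi.const_mul t),
      ← smul_eq_mul (b - a), ← intervalIntegral.integral_const, ← intervalIntegral.integral_add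
        ((intervalIntegrable_arc H.lipschitz a b).add (hJi.const_mul t)) (by simp)]
    refine intervalIntegral.integral_mono_on hab.le ?_
      (((intervalIntegrable_arc H.lipschitz a b).add (hJi.const_mul t)).add (by simp)) fun s hs => ?_
    · refine intervalIntegrable_of_abs_le_on hab.le (by fun_prop) (C := √(1 + (L : ℝ) ^ 2))
        fun s hs => ?_
      rw [abs_of_nonneg (Real.sqrt_nonneg _)]
      refine Real.sqrt_le_sqrt ?_
      have := abs_mix_le ht.le ht1 (abs_deriv_le H.lipschitz s) (hpL s hs)
      rw [← sq_abs]
      gcongr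
    · have h1 := sqrt_one_add_sq_le (deriv f s) (t * (p s - deriv f s))
      have h2 : (t * (p s - deriv f s)) ^ 2 / 2 ≤ t ^ 2 * (2 * (L : ℝ) ^ 2) := by
        have h3 : (p s - deriv f s) ^ 2 ≤ (2 * (L : ℝ)) ^ 2 := by
          rw [← sq_abs]
          have := hpf s hs
          gcongr
        have := mul_le_mul_of_nonneg_left h3 (sq_nonneg t)
        nlinarith
      rw [show (1 - t) * deriv f s + t * p s = deriv f s + t * (p s - deriv f s) by ring]
      linarith
  rw [hDeq] at hlow
  have h5 := mul_le_mul_of_nonneg_left hinc he.le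
  refine le_of_mul_le_mul_left ?_ ht
  nlinarith

/-! ### The Euler inequality and its consequences -/

lemma absolutelyContinuousOnInterval_of_hasDerivAt {F F' : ℝ → ℝ}
    (hF : ∀ s, HasDerivAt F (F' s) s) (hF' : Continuous F') (a b : ℝ) :
    AbsolutelyContinuousOnInterval F a b := by
  obtain ⟨C, hC⟩ := (isCompact_uIcc (a := a) (b := b)).exists_bound_of_continuousOn hF'.continuousOn
  refine LipschitzOnWith.absolutelyContinuousOnInterval (K := C.toNNReal) ?_
  refine (convex_uIcc a b).lipschitzOnWith_of_nnnorm_hasDerivWithin_le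
    (fun s _ => (hF s).hasDerivWithinAt) fun s hs => ?_
  rw [← NNReal.coe_le_coe, coe_nnnorm]
  exact (hC s hs).trans (Real.le_coe_toNNReal C)

/-- The first variation inequality, integrated by parts. -/
lemma IsMinimizer.euler_inequality {Ω : Set Plane} (hΩ : IsMinimizer Ω) {f : ℝ → ℝ}
    {R h : ℝ} {L : ℝ≥0} (H : LowerChart Ω f R h L) (h0 : (0 : Plane) ∉ barycentricCircle Ω) :
    ∃ δ > 0, ∃ (α β γ : ℝ) (Q : ℝ → ℝ), (∀ s, HasDerivAt Q (α + β * s + γ * f s) s) ∧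
      ∀ (K : Set Plane) (a b : ℝ) (w p : ℝ → ℝ) (M : ℝ≥0), a < b →
      a ∈ Ioo (-R) R → b ∈ Ioo (-R) R → (∀ s ∈ Icc a b, DifferentiableAt ℝ f s) →
      IsCompact K → Convex ℝ K → ReplacesLower Ω K a b f w → LipschitzWith M w → w a = f a →
      w b = f b → (∀ s ∈ Icc a b, ∀ t ∈ [[f s, w s]], ‖(!₂[s, t] : Plane)‖ < δ) →
      Measurable p → (∀ s ∈ Icc a b, |p s| ≤ L) → (∀ᵐ s, s ∈ Icc a b → deriv w s = p s) →
      (∀ s ∈ Icc a b, ∀ σ τ, !₂[σ, τ] ∈ K → w s + p s * (σ - s) ≤ τ) →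
      ∀ c, ∫ s in a..b, (Q s - deriv f s / √(1 + deriv f s ^ 2) - c) * (p s - deriv f s) ≤ 0 := by
  obtain ⟨δ, hδ, α, β, γ, hvar⟩ := hΩ.first_variation H h0
  have hfc := H.lipschitz.continuous
  set q : ℝ → ℝ := fun s => α + β * s + γ * f s with hq
  have hqc : Continuous q := by fun_prop
  have hQ : ∀ s, HasDerivAt (fun s => ∫ x in (0 : ℝ)..s, q x) (q s) s := fun s =>
    hqc.integral_hasStrictDerivAt 0 s |>.hasDerivAt
  refine ⟨δ, hδ, α, β, γ, fun s => ∫ x in (0 : ℝ)..s, q x, hQ, ?_⟩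
  set Q : ℝ → ℝ := fun s => ∫ x in (0 : ℝ)..s, q x with hQdef
  intro K a b w p M hab ha hb hdf hKc hKv hrep hw hwa hwb hreg hp hpL hdw hsupp c
  have hineq := hvar K a b w p hab ha hb hdf hKc hKv hrep hw.continuous hwa hwb hreg hp hpL hsupp
  have hQc : Continuous Q := continuous_iff_continuousAt.2 fun s => (hQ s).continuousAt
  have hfm := measurable_deriv f
  have hwl := hw.sub H.lipschitz
  have hv := (hwl.lipschitzOnWith (s := uIcc a b)).absolutelyContinuousOnInterval
  have hQac := absolutelyContinuousOnInterval_of_hasDerivAt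
    (fun s => (hQ s).sub_const c) hqc a b
  have hpf : ∀ s ∈ Icc a b, |p s - deriv f s| ≤ 2 * L := fun s hs => by
    have h1 := abs_le.1 (hpL s hs)
    have h2 := abs_le.1 (abs_deriv_le H.lipschitz s)
    rw [abs_le]; constructor <;> linarith
  have hpfi : IntervalIntegrable (fun s => p s - deriv f s) volume a b :=
    intervalIntegrable_of_abs_le_on hab.le (by fun_prop) hpf
  have hJi : IntervalIntegrable
      (fun s => deriv f s / √(1 + deriv f s ^ 2) * (p s - deriv f s)) volume a b := by
    refine intervalIntegrable_of_abs_le_on hab.le (by fun_prop) (C := 1 * (2 * L)) fun s hs => ?_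
    rw [abs_mul]
    exact mul_le_mul (abs_div_sqrt_le _) (hpf s hs) (abs_nonneg _) zero_le_one
  -- The boundary terms vanish because `w = f` at both ends; for the same reason any constant `c`
  -- may be subtracted from `Q`.
  have hparts := hQac.integral_mul_deriv_eq_deriv_mul hv
  simp only [hwa, hwb, sub_self, mul_zero, zero_sub] at hparts
  have hder : ∀ᵐ s, s ∈ Ι a b → deriv (fun s => w s - f s) s = p s - deriv f s := by
    filter_upwards [hdw, hw.ae_differentiableAt_real] with s hs hws hs'
    rw [uIoc_of_le hab.le] at hs'
    have hsI := Ioc_subset_Icc_self hs'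
    rw [← hs hsI]
    exact deriv_fun_sub hws (hdf s hsI)
  have hq' : ∀ s, deriv (fun s => Q s - c) s = q s := fun s => ((hQ s).sub_const c).deriv
  simp only [hq'] at hparts
  rw [intervalIntegral.integral_congr_ae (g := fun s => (Q s - c) * (p s - deriv f s))
    (hder.mono fun s hs hs' => by rw [hs hs'])] at hparts
  have hwc := hw.continuous
  rw [intervalIntegral.integral_add hJi (Continuous.intervalIntegrable (by fun_prop) _ _)] at hineq
  have hcomm : ∫ s in a..b, (w s - f s) * (α + β * s + γ * f s) = ∫ s in a..b, q s * (w s - f s) :=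
    intervalIntegral.integral_congr fun s _ => mul_comm _ _
  have hsplit : ∫ s in a..b, (Q s - deriv f s / √(1 + deriv f s ^ 2) - c) * (p s - deriv f s) =
      (∫ s in a..b, (Q s - c) * (p s - deriv f s)) -
        ∫ s in a..b, deriv f s / √(1 + deriv f s ^ 2) * (p s - deriv f s) := by
    have hcont : Continuous fun s => Q s - c := by fun_prop
    rw [← intervalIntegral.integral_sub (hpfi.continuousOn_mul hcont.continuousOn) hJi]
    exact intervalIntegral.integral_congr fun s _ => by ring
  rw [hsplit, hparts]
  linarith

/-- If all chords of `∫ g` are seen by `D` with the sign of an increasing function, then `D` is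
monotone. -/
lemma monotoneOn_of_integral_le {D g : ℝ → ℝ} {K : ℝ≥0} (hD : Continuous D) (hg : LipschitzWith K g)
    {S : Set ℝ} (hS : S.OrdConnected) (hmono : StrictMonoOn g S)
    (h : ∀ a ∈ S, ∀ b ∈ S, a < b → ∀ c, ∃ k, ∫ s in a..b, (D s - c) * (k - g s) ≤ 0) :
    MonotoneOn D S := by
  intro x hx y hy hxy
  by_contra! hlt
  have hxy' : x < y := lt_of_le_of_ne hxy (by rintro rfl; exact lt_irrefl _ hlt)
  set G : ℝ → ℝ := fun s => ∫ u in x..s, D u with hG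
  set m : ℝ := G y / (y - x) with hm
  set E : ℝ → ℝ := fun s => G s - m * (s - x) with hE
  have hEd : ∀ s, HasDerivAt E (D s - m) s := fun s => by
    have h1 := (hD.integral_hasStrictDerivAt x s).hasDerivAt
    have h2 := ((hasDerivAt_id s).sub_const x).const_mul m
    rw [mul_one] at h2
    exact h1.sub h2
  have hEc : Continuous E := continuous_iff_continuousAt.2 fun s => (hEd s).continuousAt
  have hEx : E x = 0 := by simp [hE, hG]
  have hEy : E y = 0 := by
    have : y - x ≠ 0 := by linarith
    simp only [hE, hm]
    field_simp
    ring
  -- Were `E ≤ 0` between its zeros `x` and `y`, the one-sided derivatives there would give `D x ≤ m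
  -- ≤ D y`, against `D y < D x`.
  obtain ⟨z, hz, hEz⟩ : ∃ z ∈ Icc x y, 0 < E z := by
    by_contra! hneg
    have h1 : D x - m ≤ 0 := by
      refine le_of_tendsto ((hasDerivAt_iff_tendsto_slope.1 (hEd x)).mono_left
        (nhdsWithin_mono x (show Ioi x ⊆ {x}ᶜ from fun u hu => ne_of_gt hu))) ?_
      filter_upwards [Ioc_mem_nhdsGT hxy'] with u hu
      rw [slope_def_field, hEx, sub_zero]
      exact div_nonpos_of_nonpos_of_nonneg (hneg u ⟨hu.1.le, hu.2⟩) (by linarith [hu.1])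
    have h2 : 0 ≤ D y - m := by
      refine ge_of_tendsto ((hasDerivAt_iff_tendsto_slope.1 (hEd y)).mono_left
        (nhdsWithin_mono y (show Iio y ⊆ {y}ᶜ from fun u hu => ne_of_lt hu))) ?_
      filter_upwards [Ico_mem_nhdsLT hxy'] with u hu
      rw [slope_def_field, hEy, sub_zero]
      exact div_nonneg_of_nonpos (hneg u ⟨hu.1, hu.2.le⟩) (by linarith [hu.2])
    linarith
  -- The nearest zeros of `E` on either side of `z` bound an interval on which `E` is positive.
  have hzero : IsClosed {s | E s = 0} := isClosed_eq hEc continuous_const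
  obtain ⟨a, ⟨haI, hEa⟩, hamax⟩ := (isCompact_Icc.inter_right hzero).exists_isGreatest
    ⟨x, left_mem_Icc.2 hz.1, hEx⟩
  obtain ⟨b, ⟨hbI, hEb⟩, hbmin⟩ := (isCompact_Icc.inter_right hzero).exists_isLeast
    ⟨y, right_mem_Icc.2 hz.2, hEy⟩
  have hEa : E a = 0 := hEa
  have hEb : E b = 0 := hEb
  have haz : a < z := lt_of_le_of_ne haI.2 (by rintro rfl; linarith)
  have hzb : z < b := lt_of_le_of_ne hbI.1 (by rintro rfl; linarith)
  have hpos : ∀ s ∈ Ioo a b, 0 < E s := by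
    intro s hs
    by_contra! hle
    rcases le_total s z with hsz | hsz
    · obtain ⟨u, hu, hEu⟩ := intermediate_value_Icc hsz hEc.continuousOn
        (show (0 : ℝ) ∈ Icc (E s) (E z) from ⟨hle, hEz.le⟩)
      have := hamax ⟨⟨haI.1.trans (hs.1.le.trans hu.1), hu.2⟩, hEu⟩
      linarith [hs.1, hu.1]
    · obtain ⟨u, hu, hEu⟩ := intermediate_value_Icc' hsz hEc.continuousOn
        (show (0 : ℝ) ∈ Icc (E s) (E z) from ⟨hle, hEz.le⟩)
      have := hbmin ⟨⟨hu.1, hu.2.trans (hs.2.le.trans hbI.2)⟩, hEu⟩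
      linarith [hs.2, hu.2]
  have hab : a < b := haz.trans hzb
  have hsub : Icc a b ⊆ S := (Icc_subset_Icc haI.1 hbI.2).trans (hS.out hx hy)
  obtain ⟨k, hk⟩ := h a (hsub (left_mem_Icc.2 hab.le)) b (hsub (right_mem_Icc.2 hab.le)) hab m
  have hEac := absolutelyContinuousOnInterval_of_hasDerivAt hEd (hD.sub continuous_const) a b
  have hgac := (hg.lipschitzOnWith (s := uIcc a b)).absolutelyContinuousOnInterval
  have hparts := hEac.integral_mul_deriv_eq_deriv_mul hgac
  have hE' : ∀ s, deriv E s = D s - m := fun s => (hEd s).deriv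
  simp only [hEa, hEb, zero_mul, sub_self, zero_sub, hE'] at hparts
  have hint : ∫ s in a..b, (D s - m) = 0 := by
    rw [intervalIntegral.integral_eq_sub_of_hasDerivAt (fun s _ => hEd s)
      (Continuous.intervalIntegrable (by fun_prop) _ _), hEa, hEb, sub_self]
  have hgc := hg.continuous
  -- As `D - m` has integral zero on `[a, b]`, the slope `k` drops out, and integration by parts
  -- turns the hypothesis into this. With `E > 0` and `g' ≥ 0`, it forces `g' = 0` almost
  -- everywhere, against strict monotonicity.
  have hEg : ∫ s in a..b, E s * deriv g s ≤ 0 := by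
    have h1 : ∫ s in a..b, (D s - m) * (k - g s) =
        (∫ s in a..b, (D s - m)) * k - ∫ s in a..b, (D s - m) * g s := by
      rw [← intervalIntegral.integral_mul_const, ← intervalIntegral.integral_sub
        (Continuous.intervalIntegrable (by fun_prop) _ _)
        (Continuous.intervalIntegrable (by fun_prop) _ _)]
      exact intervalIntegral.integral_congr fun s _ => by ring
    rw [hint, zero_mul, zero_sub] at h1
    linarith
  have hg' : ∀ s ∈ Ioo a b, 0 ≤ deriv g s := by
    intro s hs
    have hmon : MonotoneOn g (Ioo a b) :=
      (hmono.monotoneOn).mono (Ioo_subset_Icc_self.trans hsub)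
    rw [← derivWithin_of_isOpen isOpen_Ioo hs]
    exact hmon.derivWithin_nonneg
  have hnn : 0 ≤ᵐ[volume.restrict (Ioc a b)] fun s => E s * deriv g s := by
    rw [← restrict_Ioo_eq_restrict_Ioc]
    refine (ae_restrict_iff' measurableSet_Ioo).2 (Eventually.of_forall fun s hs => ?_)
    exact mul_nonneg (hpos s hs).le (hg' s hs)
  have hi : IntervalIntegrable (fun s => E s * deriv g s) volume a b :=
    (intervalIntegrable_deriv_of_lipschitz hg a b).continuousOn_mul hEc.continuousOn
  have h0 := (intervalIntegral.integral_eq_zero_iff_of_le_of_nonneg_ae hab.le hnn hi).1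
    (le_antisymm hEg (intervalIntegral.integral_nonneg_of_ae_restrict hab.le
      (by rw [← restrict_Ioc_eq_restrict_Icc]; exact hnn)))
  have hgab : ∫ s in a..b, deriv g s = 0 := by
    rw [← intervalIntegral.integral_zero (a := a) (b := b) (μ := volume)]
    refine intervalIntegral.integral_congr_ae_restrict ?_
    rw [uIoc_of_le hab.le]
    rw [← restrict_Ioo_eq_restrict_Ioc] at h0 ⊢
    filter_upwards [h0, ae_restrict_mem measurableSet_Ioo] with s hs hsI
    exact (mul_eq_zero.1 hs).resolve_left (hpos s hsI).ne'
  rw [integral_deriv_of_lipschitz hg] at hgab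
  linarith [hmono (hsub (left_mem_Icc.2 hab.le)) (hsub (right_mem_Icc.2 hab.le)) hab]

/-- Both factors change sign at `c` in the same direction, so the integrand is nonnegative and
vanishes almost everywhere. Strict monotonicity of `g` makes the second factor nonzero, and
continuity of `D` removes the null set. -/
lemma eqOn_of_integral_le {D g : ℝ → ℝ} {a b c : ℝ} (hD : Continuous D) (hg : Continuous g)
    (hab : a < b) (hDm : MonotoneOn D (Icc a b)) (hgm : StrictMonoOn g (Icc a b))
    (hc : c ∈ Icc a b)
    (h : ∫ s in a..b, (D s - D c) * ((if s < c then g a else g b) - g s) ≤ 0) :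
    ∀ s ∈ Ioo a b, D s = D c := by
  set p : ℝ → ℝ := fun s => if s < c then g a else g b with hp
  have ha : a ∈ Icc a b := left_mem_Icc.2 hab.le
  have hb : b ∈ Icc a b := right_mem_Icc.2 hab.le
  have hpm : Measurable p := Measurable.ite measurableSet_Iio measurable_const measurable_const
  have hnn : 0 ≤ᵐ[volume.restrict (Ioc a b)] fun s => (D s - D c) * (p s - g s) := by
    refine (ae_restrict_iff' measurableSet_Ioc).2 (Eventually.of_forall fun s hs => ?_)
    have hsI := Ioc_subset_Icc_self hs
    change 0 ≤ (D s - D c) * (p s - g s)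
    simp only [hp]
    split_ifs with hsc
    · exact mul_nonneg_of_nonpos_of_nonpos (sub_nonpos.2 (hDm hsI hc hsc.le))
        (sub_nonpos.2 (hgm.monotoneOn ha hsI hsI.1))
    · exact mul_nonneg (sub_nonneg.2 (hDm hc hsI (not_lt.1 hsc)))
        (sub_nonneg.2 (hgm.monotoneOn hsI hb hsI.2))
  have hpi : IntervalIntegrable p volume a b := by
    refine intervalIntegrable_of_abs_le hpm (C := max |g a| |g b|) fun s => ?_
    simp only [hp]
    split_ifs
    · exact le_max_left _ _
    · exact le_max_right _ _
  have hi : IntervalIntegrable (fun s => (D s - D c) * (p s - g s)) volume a b :=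
    (hpi.sub (hg.intervalIntegrable a b)).continuousOn_mul (hD.sub continuous_const).continuousOn
  have h0 := (intervalIntegral.integral_eq_zero_iff_of_le_of_nonneg_ae hab.le hnn hi).1
    (le_antisymm h (intervalIntegral.integral_nonneg_of_ae_restrict hab.le
      (by rw [← restrict_Ioc_eq_restrict_Icc]; exact hnn)))
  refine Measure.eqOn_open_of_ae_eq (μ := volume) (g := fun _ => D c) ?_ isOpen_Ioo hD.continuousOn
    continuousOn_const
  rw [← restrict_Ioo_eq_restrict_Ioc] at h0
  have hne : ∀ᵐ s ∂(volume.restrict (Ioo a b)), s ≠ c :=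
    ae_restrict_of_ae (Measure.ae_ne volume c)
  filter_upwards [h0, ae_restrict_mem measurableSet_Ioo, hne] with s hs hsI hsc
  have hsI' := Ioo_subset_Icc_self hsI
  rcases mul_eq_zero.1 hs with h1 | h1
  · exact sub_eq_zero.1 h1
  · exfalso
    simp only [hp] at h1
    split_ifs at h1 with hlt
    · linarith [hgm ha hsI' hsI.1]
    · linarith [hgm hsI' hb hsI.2]

/-- The abscissa `c` where the tangents cross is the jump of the cap's slope, which is therefore the
step function required by `eqOn_of_integral_le`. -/
lemma exists_tangentMax_eq {f : ℝ → ℝ} {a b : ℝ} (hab : a ≤ b) (hlt : deriv f a < deriv f b)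
    (ha : tangent f b a ≤ f a) (hb : tangent f a b ≤ f b) :
    ∃ c ∈ Icc a b, (∀ s ≤ c, tangentMax f a b s = tangent f a s) ∧
      ∀ s, c ≤ s → tangentMax f a b s = tangent f b s := by
  have h1 := continuous_tangent f a
  have h2 := continuous_tangent f b
  obtain ⟨c, hc, h0⟩ := intermediate_value_Icc' hab
    (f := fun s => tangent f a s - tangent f b s) (by fun_prop)
    (show (0 : ℝ) ∈ Icc _ _ by rw [tangent_self, tangent_self]; constructor <;> linarith)
  have hdiff : ∀ s, tangent f a s - tangent f b s = (deriv f b - deriv f a) * (c - s) := by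
    intro s
    have h0 : tangent f a c - tangent f b c = 0 := h0
    simp only [tangent] at h0 ⊢
    linarith
  have hpos : 0 < deriv f b - deriv f a := by linarith
  refine ⟨c, hc, fun s hs => max_eq_left ?_, fun s hs => max_eq_right ?_⟩
  · have := mul_nonneg hpos.le (sub_nonneg.2 hs)
    linarith [hdiff s]
  · have := mul_nonneg hpos.le (sub_nonneg.2 hs)
    linarith [hdiff s]

lemma hasDerivAt_tangent (f : ℝ → ℝ) (a s : ℝ) : HasDerivAt (tangent f a) (deriv f a) s := by
  have := (((hasDerivAt_id s).sub_const a).const_mul (deriv f a)).const_add (f a)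
  rwa [mul_one] at this

lemma hasDerivAt_chord (f : ℝ → ℝ) (a b s : ℝ) :
    HasDerivAt (chord f a b) ((f b - f a) / (b - a)) s := by
  have := (((hasDerivAt_id s).sub_const a).const_mul ((f b - f a) / (b - a))).const_add (f a)
  rwa [mul_one] at this

lemma lipschitzWith_of_hasDerivAt_const {w : ℝ → ℝ} {k : ℝ} (h : ∀ s, HasDerivAt w k s) :
    LipschitzWith ‖k‖₊ w :=
  lipschitzWith_of_nnnorm_deriv_le (fun s => (h s).differentiableAt) fun s => by rw [(h s).deriv]

/-! ### Smoothness of strictly convex parts -/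

/-- A solution of the Euler equation is smooth. -/
lemma isSmooth_of_euler_equation {f Q : ℝ → ℝ} {r α β γ C : ℝ}
    (hf : ∀ s ∈ Ioo (-r) r, DifferentiableAt ℝ f s)
    (hQ : ∀ s, HasDerivAt Q (α + β * s + γ * f s) s)
    (h : ∀ s ∈ Ioo (-r) r, Q s - deriv f s / √(1 + deriv f s ^ 2) = C) : IsSmooth f r := by
  -- The map `x ↦ x / √(1 + x²)` is inverted by `y ↦ y / √(1 - y²)`, smooth for `|y| < 1`. Thus `f'`
  -- inherits the regularity of `Q`, whose derivative is affine in `s` and `f`.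
  have hfQ : ∀ s ∈ Ioo (-r) r, deriv f s = (Q s - C) / √(1 - (Q s - C) ^ 2) ∧
      0 < 1 - (Q s - C) ^ 2 := by
    intro s hs
    have hS : 0 < √(1 + deriv f s ^ 2) := by positivity
    have hS2 : √(1 + deriv f s ^ 2) ^ 2 = 1 + deriv f s ^ 2 := Real.sq_sqrt (by positivity)
    have hQs : Q s - C = deriv f s / √(1 + deriv f s ^ 2) := by linarith [h s hs]
    have h1 : 1 - (Q s - C) ^ 2 = (1 / √(1 + deriv f s ^ 2)) ^ 2 := by
      rw [hQs]
      field_simp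
      linarith
    rw [h1, Real.sqrt_sq (by positivity), hQs]
    exact ⟨by field_simp, by positivity⟩
  refine contDiffOn_infty.2 fun n => ?_
  induction n with
  | zero => exact contDiffOn_zero.2 fun s hs => (hf s hs).continuousAt.continuousWithinAt
  | succ n ih =>
    have hQn : ContDiffOn ℝ n Q (Ioo (-r) r) := by
      have h1 : ContDiffOn ℝ (n + 1) Q (Ioo (-r) r) := by
        rw [contDiffOn_succ_iff_deriv_of_isOpen isOpen_Ioo]
        refine ⟨fun s _ => (hQ s).differentiableAt.differentiableWithinAt, by simp, ?_⟩
        have : deriv Q = fun s => α + β * s + γ * f s := funext fun s => (hQ s).deriv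
        rw [this]
        exact (contDiffOn_const.add (contDiffOn_const.mul contDiffOn_id)).add (contDiffOn_const.mul ih)
      exact h1.of_le (by norm_cast; omega)
    push_cast
    rw [contDiffOn_succ_iff_deriv_of_isOpen isOpen_Ioo]
    refine ⟨fun s hs => (hf s hs).differentiableWithinAt, by simp, ?_⟩
    have hΨ := hQn.sub (contDiffOn_const (c := C))
    have h2 := (contDiffOn_const (c := (1 : ℝ))).sub (hΨ.pow 2)
    refine (hΨ.div (h2.sqrt fun s hs => (hfQ s hs).2.ne') fun s hs => ?_).congr
      fun s hs => (hfQ s hs).1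
    exact (Real.sqrt_pos.2 (hfQ s hs).2).ne'

lemma LowerChart.mem_frontier {Ω : Set Plane} {f : ℝ → ℝ} {R h : ℝ} {L : ℝ≥0}
    (H : LowerChart Ω f R h L) (hΩ : IsClosed Ω) {s : ℝ} (hs : s ∈ Icc (-R) R) :
    !₂[s, f s] ∈ frontier Ω := by
  rw [hΩ.frontier_eq]
  refine ⟨H.chord_mem hs, fun hint => ?_⟩
  have h1 : ∀ᶠ t in 𝓝 (f s), (!₂[s, t] : Plane) ∈ Ω :=
    (continuous_mk_right s).continuousAt.eventually (mem_interior_iff_mem_nhds.1 hint)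
  obtain ⟨t, ht, ht'⟩ := ((h1.filter_mono nhdsWithin_le_nhds).and
    (self_mem_nhdsWithin (a := f s) (s := Iio (f s)))).exists
  exact absurd (H.le hs ht) (not_le.2 ht')

/-- If the boundary contains no segment, the derivative of the lower boundary is strictly
increasing. -/
lemma LowerChart.strictMonoOn_deriv {Ω V : Set Plane} {f : ℝ → ℝ} {R h : ℝ} {L : ℝ≥0}
    (H : LowerChart Ω f R h L) (hΩ : IsClosed Ω) {r : ℝ} (hrR : r ≤ R)
    (hd : ∀ s ∈ Ioo (-r) r, DifferentiableAt ℝ f s)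
    (hV : ∀ s ∈ Ioo (-r) r, !₂[s, f s] ∈ V)
    (hseg : ∀ x y : Plane, segment ℝ x y ⊆ frontier Ω ∩ V → x = y) :
    StrictMonoOn (deriv f) (Ioo (-r) r) := by
  have hsub : Ioo (-r) r ⊆ Icc (-R) R := fun s hs => ⟨by linarith [hs.1], by linarith [hs.2]⟩
  have hmono := (H.convexOn.subset hsub (convex_Ioo _ _)).monotoneOn_deriv hd
  intro x hx y hy hxy
  by_contra! hle
  have hI : Icc x y ⊆ Ioo (-r) r := fun s hs => ⟨hx.1.trans_le hs.1, hs.2.trans_lt hy.2⟩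
  have hconst : ∀ s ∈ Icc x y, deriv f s = deriv f x := fun s hs =>
    le_antisymm ((hmono (hI hs) hy hs.2).trans hle) (hmono hx (hI hs) hs.1)
  -- Failure of strict monotonicity makes `f'` constant on `[x, y]`, and the graph over it would be
  -- a boundary segment.
  have hlin : ∀ s ∈ Icc x y, f s = f x + deriv f x * (s - x) := by
    intro s hs
    have h1 := integral_deriv_of_lipschitz H.lipschitz x s
    rw [intervalIntegral.integral_congr (g := fun _ => deriv f x) (fun u hu => by
      rw [uIcc_of_le hs.1] at hu
      exact hconst u ⟨hu.1, hu.2.trans hs.2⟩), intervalIntegral.integral_const, smul_eq_mul] at h1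
    linarith
  have hne := hseg !₂[x, f x] !₂[y, f y] (by
    rintro z ⟨u, v, hu, hv, huv, rfl⟩
    have hs : u * x + v * y ∈ Icc x y := by
      obtain rfl : u = 1 - v := by linarith
      constructor <;> nlinarith
    have hfs : u * f x + v * f y = f (u * x + v * y) := by
      rw [hlin _ hs, hlin y ⟨hxy.le, le_rfl⟩]
      obtain rfl : u = 1 - v := by linarith
      ring
    rw [smul_mk, smul_mk, add_mk, hfs]
    exact ⟨H.mem_frontier hΩ (hsub (hI hs)), hV _ (hI hs)⟩)
  have : x = y := by simpa using congrArg (fun z : Plane => z 0) hne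
  exact hxy.ne this

lemma norm_mk_lt_of_abs_le {s t r C δ : ℝ} (hs : |s| ≤ r) (ht : |t| ≤ C * r) (hC : 0 ≤ C)
    (h : r * (1 + C) < δ) : ‖(!₂[s, t] : Plane)‖ < δ := by
  refine lt_of_le_of_lt ?_ h
  have hr : 0 ≤ r := (abs_nonneg s).trans hs
  rw [norm_mk]
  refine Real.sqrt_le_iff.2 ⟨by positivity, ?_⟩
  have h1 : s ^ 2 ≤ r ^ 2 := by rw [← sq_abs]; gcongr
  have h2 : t ^ 2 ≤ (C * r) ^ 2 := by rw [← sq_abs]; gcongr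
  nlinarith [mul_nonneg (mul_nonneg hC hr) hr]

lemma norm_mk_lt_of_mem_uIcc {s t x y r C δ : ℝ} (hs : |s| ≤ r) (ht : t ∈ [[x, y]])
    (hx : |x| ≤ C * r) (hy : |y| ≤ C * r) (hC : 0 ≤ C) (h : r * (1 + C) < δ) :
    ‖(!₂[s, t] : Plane)‖ < δ :=
  norm_mk_lt_of_abs_le hs (abs_le.2 (uIcc_subset_Icc (abs_le.1 hx) (abs_le.1 hy) ht)) hC h

/-- Away from the barycentric circle, the lower boundary of a minimizer is smooth if it contains no
segment. -/
lemma IsMinimizer.exists_isSmooth {Ω V : Set Plane} (hΩ : IsMinimizer Ω) {f : ℝ → ℝ}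
    {R h : ℝ} {L : ℝ≥0} (H : LowerChart Ω f R h L) (h0 : (0 : Plane) ∉ barycentricCircle Ω)
    (hV : V ∈ 𝓝 (0 : Plane)) (hseg : ∀ x y : Plane, segment ℝ x y ⊆ frontier Ω ∩ V → x = y) :
    ∃ r > 0, r ≤ R ∧ IsSmooth f r := by
  have hadm := hΩ.1
  obtain ⟨r₁, hr₁, hrR₁, hd₁, K, hK⟩ := hΩ.exists_c11 H
  obtain ⟨δ, hδ, α, β, γ, Q, hQ, hE⟩ := hΩ.euler_inequality H h0
  obtain ⟨ρ, hρ, hball⟩ := Metric.mem_nhds_iff.1 hV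
  obtain ⟨g, hg, hgeq⟩ := hK.extend_real
  have hL0 : (0 : ℝ) ≤ 3 * L := by positivity
  -- Over `(-r, r)` the graph and its chords have height at most `Lr`, and tangents at most `Lr + L
  -- · 2r = 3Lr`. This `r` keeps them all within `δ` and the graph within `ρ` of the origin.
  set r := min r₁ (min δ ρ / (2 * (1 + 3 * (L : ℝ)))) with hr
  have hr0 : 0 < r := by positivity
  have hrr₁ : r ≤ r₁ := min_le_left _ _
  have hrsmall : r * (1 + 3 * (L : ℝ)) < min δ ρ := by
    have h1 : r ≤ min δ ρ / (2 * (1 + 3 * (L : ℝ))) := min_le_right _ _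
    rw [le_div_iff₀ (by positivity)] at h1
    have h2 : 0 < min δ ρ := lt_min hδ hρ
    linarith
  have hrδ := hrsmall.trans_le (min_le_left δ ρ)
  have hI₁ : ∀ s ∈ Ioo (-r) r, s ∈ Ioo (-r₁) r₁ := fun s hs =>
    ⟨by linarith [hs.1], by linarith [hs.2]⟩
  have hIR : ∀ s ∈ Ioo (-r) r, s ∈ Ioo (-R) R := fun s hs =>
    ⟨by linarith [hs.1], by linarith [hs.2]⟩
  have hd : ∀ s ∈ Ioo (-r) r, DifferentiableAt ℝ f s := fun s hs => hd₁ s (hI₁ s hs)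
  have hfg : ∀ s ∈ Ioo (-r) r, deriv f s = g s := fun s hs => hgeq (hI₁ s hs)
  have hsr : ∀ s ∈ Ioo (-r) r, |s| ≤ r := fun s hs => abs_le.2 ⟨hs.1.le, hs.2.le⟩
  have hfs : ∀ s ∈ Ioo (-r) r, |f s| ≤ L * r := by
    intro s hs
    have h1 := H.lipschitz.dist_le_mul s 0
    rw [Real.dist_eq, Real.dist_eq, H.zero, sub_zero, sub_zero] at h1
    exact h1.trans (mul_le_mul_of_nonneg_left (hsr s hs) L.coe_nonneg)
  have hL3 : (L : ℝ) * r ≤ 3 * L * r := by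
    have := mul_nonneg L.coe_nonneg hr0.le
    linarith
  have hmono : StrictMonoOn (deriv f) (Ioo (-r) r) :=
    H.strictMonoOn_deriv hadm.isCompact.isClosed (hrr₁.trans hrR₁) hd (fun s hs => hball (by
      rw [mem_ball_zero_iff]
      exact norm_mk_lt_of_abs_le (hsr s hs) ((hfs s hs).trans hL3) hL0
        (hrsmall.trans_le (min_le_right δ ρ)))) hseg
  have hgmono : StrictMonoOn g (Ioo (-r) r) := fun x hx y hy hxy => by
    rw [← hfg x hx, ← hfg y hy]
    exact hmono hx hy hxy
  have hQc : Continuous Q := continuous_iff_continuousAt.2 fun s => (hQ s).continuousAt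
  have hgc := hg.continuous
  -- The derivative is replaced by its global Lipschitz extension `g`, so that `D` is continuous on
  -- the whole line.
  set D : ℝ → ℝ := fun s => Q s - g s / √(1 + g s ^ 2) with hD
  have hDc : Continuous D := by
    have h1 : ∀ s, √(1 + g s ^ 2) ≠ 0 := fun s => by positivity
    fun_prop (disch := assumption)
  have hsub : ∀ a ∈ Ioo (-r) r, ∀ b ∈ Ioo (-r) r, ∀ s ∈ Icc a b, s ∈ Ioo (-r) r :=
    fun a ha b hb s hs => ⟨ha.1.trans_le hs.1, hs.2.trans_lt hb.2⟩
  have hcongr : ∀ a ∈ Ioo (-r) r, ∀ b ∈ Ioo (-r) r, a < b → ∀ (p : ℝ → ℝ) (c : ℝ),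
      ∫ s in a..b, (Q s - deriv f s / √(1 + deriv f s ^ 2) - c) * (p s - deriv f s) =
        ∫ s in a..b, (D s - c) * (p s - g s) := by
    intro a ha b hb hab p c
    refine intervalIntegral.integral_congr fun s hs => ?_
    rw [uIcc_of_le hab.le] at hs
    simp only [hD, hfg s (hsub a ha b hb s hs)]
  -- Chord cuts: the slope is constant.
  have hDmono : MonotoneOn D (Ioo (-r) r) := by
    refine monotoneOn_of_integral_le hDc hg ordConnected_Ioo hgmono fun a ha b hb hab c => ?_
    have hin := hsub a ha b hb
    have haR := hIR a ha
    have hbR := hIR b hb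
    refine ⟨(f b - f a) / (b - a), ?_⟩
    rw [← hcongr a ha b hb hab (fun _ => (f b - f a) / (b - a))]
    refine hE (chordCut Ω f a b) a b (chord f a b) _ _ hab haR hbR (fun s hs => hd s (hin s hs))
      (isCompact_chordCut hadm.isCompact f a b) (convex_chordCut hadm.convex f a b)
      (H.replacesLower_chordCut hadm.convex haR.1.le hab hbR.2.le)
      (lipschitzWith_of_hasDerivAt_const (hasDerivAt_chord f a b)) (chord_left f a b)
      (chord_right f hab) ?_ measurable_const ?_
      (Eventually.of_forall fun s _ => (hasDerivAt_chord f a b s).deriv) ?_ c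
    · intro s hs t ht
      refine norm_mk_lt_of_mem_uIcc (hsr s (hin s hs)) ht ((hfs s (hin s hs)).trans hL3) ?_ hL0 hrδ
      obtain ⟨u, v, hu, hv, huv, rfl⟩ := exists_mix hs
      rw [chord_mix _ _ _ huv, chord_left, chord_right _ hab]
      obtain rfl : u = 1 - v := by linarith
      exact abs_mix_le hv (by linarith) ((hfs a ha).trans hL3) ((hfs b hb).trans hL3)
    · intro s _
      rw [abs_div, div_le_iff₀ (abs_pos.2 (by linarith)), ← Real.dist_eq, ← Real.dist_eq]
      exact H.lipschitz.dist_le_mul b a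
    · intro s _ σ τ hτ
      have := (mk_mem_chordCut.1 hτ).2
      simp only [chord] at this ⊢
      linarith
  obtain ⟨a, b, hab, ha, hb, hab'⟩ : ∃ a b : ℝ, a < b ∧ a ∈ Ioo (-r) r ∧ b ∈ Ioo (-r) r ∧
      Ioo a b = Ioo (-(r / 2)) (r / 2) :=
    ⟨-(r / 2), r / 2, by linarith, ⟨by linarith, by linarith⟩, ⟨by linarith, by linarith⟩, rfl⟩
  have hin := hsub a ha b hb
  have haR := hIR a ha
  have hbR := hIR b hb
  have hTab := H.tangent_le hadm.convex haR (hd a ha) (H.chord_mem (Ioo_subset_Icc_self hbR))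
  have hTba := H.tangent_le hadm.convex hbR (hd b hb) (H.chord_mem (Ioo_subset_Icc_self haR))
  obtain ⟨c, hc, hTl, hTr⟩ := exists_tangentMax_eq hab.le (hmono ha hb hab) hTba hTab
  have htan : ∀ e ∈ Ioo (-r) r, ∀ s ∈ Ioo (-r) r, |tangent f e s| ≤ 3 * L * r := by
    intro e he s hs
    have h1 := abs_add_le (f e) (deriv f e * (s - e))
    rw [abs_mul] at h1
    have h2 : |deriv f e| * |s - e| ≤ L * (2 * r) := by
      refine mul_le_mul (abs_deriv_le H.lipschitz e) ?_ (abs_nonneg _) L.coe_nonneg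
      rw [abs_le]
      constructor <;> linarith [he.1, he.2, hs.1, hs.2]
    have h3 := hfs e he
    rw [tangent]
    linarith
  have hTabs : ∀ s ∈ Icc a b, |tangentMax f a b s| ≤ 3 * L * r := fun s hs =>
    abs_max_le_max_abs_abs.trans (max_le (htan a ha s (hin s hs)) (htan b hb s (hin s hs)))
  obtain ⟨hcv, hrep, hsupp⟩ := H.tangentCap_spec hadm.convex haR hbR (hd a ha) (hd b hb)
    (A := 3 * L * r + 3 * L * r) (fun s hs => by
      have h1 := (le_abs_self _).trans ((hfs s (hin s hs)).trans hL3)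
      have h2 := (neg_le_abs _).trans (hTabs s hs)
      linarith) (by positivity)
  -- Tangent caps: the slope jumps from `f'(a)` to `f'(b)` at `c`, and the free constant is taken to
  -- be `D c`.
  have hkey := hE (tangentCap Ω f a b (3 * L * r + 3 * L * r)) a b (tangentMax f a b)
    (fun s => if s < c then deriv f a else deriv f b) _ hab haR hbR (fun s hs => hd s (hin s hs))
    (isCompact_tangentCap hadm.isCompact f a b _) hcv hrep
    ((lipschitzWith_of_hasDerivAt_const (hasDerivAt_tangent f a)).max
      (lipschitzWith_of_hasDerivAt_const (hasDerivAt_tangent f b)))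
    (H.tangentMax_left hadm.convex haR hbR (hd b hb))
    (H.tangentMax_right hadm.convex haR hbR (hd a ha))
    (fun s hs t ht => norm_mk_lt_of_mem_uIcc (hsr s (hin s hs)) ht ((hfs s (hin s hs)).trans hL3)
      (hTabs s hs) hL0 hrδ)
    (Measurable.ite measurableSet_Iio measurable_const measurable_const)
    (fun s _ => by split_ifs <;> exact abs_deriv_le H.lipschitz _)
    (by
      filter_upwards [Measure.ae_ne volume c] with s hs _
      rcases lt_or_gt_of_ne hs with hlt | hgt
      · rw [if_pos hlt, ← (hasDerivAt_tangent f a s).deriv]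
        refine EventuallyEq.deriv_eq ?_
        filter_upwards [Iio_mem_nhds hlt] with u hu
        exact hTl u (le_of_lt hu)
      · rw [if_neg hgt.le.not_gt, ← (hasDerivAt_tangent f b s).deriv]
        refine EventuallyEq.deriv_eq ?_
        filter_upwards [Ioi_mem_nhds hgt] with u hu
        exact hTr u (le_of_lt hu))
    (by
      intro s _ σ τ hτ
      have h1 := max_le_iff.1 (hsupp σ τ hτ)
      split_ifs with hlt
      · rw [hTl s hlt.le]
        simp only [tangent] at h1 ⊢
        linarith [h1.1]
      · rw [hTr s (not_lt.1 hlt)]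
        simp only [tangent] at h1 ⊢
        linarith [h1.2]) (D c)
  rw [hcongr a ha b hb hab, hfg a ha, hfg b hb] at hkey
  have hDconst := eqOn_of_integral_le hDc hgc hab (hDmono.mono hin) (hgmono.mono hin) hc hkey
  rw [hab'] at hDconst
  have hIr : ∀ s ∈ Ioo (-(r / 2)) (r / 2), s ∈ Ioo (-r) r := fun s hs =>
    ⟨by linarith [hs.1], by linarith [hs.2]⟩
  refine ⟨r / 2, by positivity, by linarith, isSmooth_of_euler_equation
    (fun s hs => hd s (hIr s hs)) hQ (C := D c) fun s hs => ?_⟩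
  rw [hfg s (hIr s hs)]
  exact hDconst s hs

/-- The strictly convex parts of the boundary of a minimizer are smooth away from the barycentric
circle. -/
theorem IsMinimizer.boundarySmoothAt {Ω Γ : Set Plane} (hΩ : IsMinimizer Ω)
    (hΓ : IsStrictlyConvexPart Ω Γ) {p : Plane} (hp : p ∈ Γ \ barycentricCircle Ω) :
    BoundarySmoothAt Ω p := by
  obtain ⟨⟨U, hU, rfl⟩, hseg⟩ := hΓ
  have hadm := hΩ.1
  obtain ⟨φ, f, R, h, L, rfl, H⟩ :=
    exists_lowerChart hadm.isCompact hadm.convex hadm.area_pos hp.1.1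
  have hfr : φ ⁻¹' frontier Ω = frontier (φ ⁻¹' Ω) := φ.toHomeomorph.preimage_frontier Ω
  obtain ⟨r, hr, hrR, hs⟩ := (hΩ.preimage φ).exists_isSmooth H (V := φ ⁻¹' U)
    (by rw [barycentricCircle_preimage φ hadm.isCompact hadm.area_pos]; exact hp.2)
    (φ.continuous.continuousAt.preimage_mem_nhds (hU.mem_nhds hp.1.2)) (by
      intro x y hxy
      refine φ.injective (hseg _ _ ?_)
      have himg := image_segment ℝ φ.toAffineEquiv.toAffineMap x y
      change φ '' segment ℝ x y = segment ℝ (φ x) (φ y) at himg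
      rw [← himg, image_subset_iff, preimage_inter, hfr]
      exact hxy)
  exact H.isLocalEpigraphAt rfl hr hrR hs

end PlanarShape

theorem theorem5p2 (Ω : Set PlanarShape.Plane) (hΩ : PlanarShape.IsMinimizer Ω) :
    (∀ p ∈ frontier Ω, PlanarShape.BoundaryC11At Ω p) ∧
    ∀ Γ : Set PlanarShape.Plane, PlanarShape.IsStrictlyConvexPart Ω Γ →
      ∀ p ∈ Γ \ PlanarShape.barycentricCircle Ω, PlanarShape.BoundarySmoothAt Ω p :=
  ⟨fun _ hp => hΩ.boundaryC11At hp, fun _ hΓ _ hp => hΩ.boundarySmoothAt hΓ hp⟩
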